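/- Let $n\ge 1$ and let $G=SU_{1,n}$ be the special unitary group of the Hermitian form $\operatorname{diag}(-1,1,\dots,1)$ on $\mathbb C^{1+n}$. A compact connected Lie subgroup $H$ of a Lie group $G$ is called admissible if the homogeneous manifold $G/H$ carries a $G$-invariant Lorentzian metric, and maximal admissible if it is maximal, with respect to inclusion, among the admissible (compact connected Lie) subgroups of $G$; then $G/H$ is called a minimal admissible $G$-manifold. For $G=SU_{1,n}$, the manifold $G/H$ is said to belong to class I if, for a maximal compact subgroup $K\supset H$ of $G$ with an $\operatorname{Ad}_H$-invariant decomposition $\mathfrak k=\mathfrak h+\mathfrak n$ of its Lie algebra, there is a nonzero $\operatorname{Ad}_H$-invariant vector in $\mathfrak n$. Let $SU_n\subset SU_{1,n}$ be embedded by $A\mapsto \operatorname{diag}(1,A)$ and correspondingly $\mathfrak{su}_n\subset\mathfrak{su}_{1,n}$ by $a\mapsto\operatorname{diag}(0,a)$. Put $z_0=i\operatorname{diag}(1,-\tfrac1n,\dots,-\tfrac1n)$ and, for $a\in\mathfrak{su}_n$, $T^1_a=\{\exp t(z_0+a): t\in\mathbb R\}$. For $a\in\mathfrak{su}_n$, $a\neq0$,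 let $Z'_{SU_n}(a)$ be the connected subgroup of $SU_n$ whose Lie algebra is the orthogonal complement of $a$, with respect to the form $\operatorname{tr}(XY)$, in the centralizer $\mathfrak z_{\mathfrak{su}_n}(a)$, so that $\mathfrak z_{\mathfrak{su}_n}(a)=\mathbb R a\oplus \operatorname{Lie} Z'_{SU_n}(a)$. Proposition. Every class I minimal admissible $SU_{1,n}$-manifold $SU_{1,n}/H$ is isomorphic, by an $SU_{1,n}$-equivariant diffeomorphism, to one of the manifolds (a) $SU_{1,n}/SU_n$; (b) $SU_{1,n}/\,T^1_a\cdot Z'_{SU_n}(a)$, where $0\ne a\in\mathfrak{su}_n$ is such that $T^1_a$ is closed; (c) $SU_{1,n}/\,T^1_0\cdot H'$, where $H'$ is a maximal admissible subgroup of $SU_n$. -/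

import Mathlib

open scoped Matrix ContDiff Topology

/-! ### Matrix Lie groups, their Lie algebras and their connected Lie subgroups -/

section General

variable {ι : Type*} [Fintype ι] [DecidableEq ι]

/-- The exponential of a complex matrix, as an invertible matrix. -/
noncomputable def expGL (X : Matrix ι ι ℂ) : GL ι ℂ := (Matrix.isUnit_exp X).unit

theorem coe_expGL (X : Matrix ι ι ℂ) :
    ((expGL X : GL ι ℂ) : Matrix ι ι ℂ) = NormedSpace.exp X := rfl

theorem expGL_conj (g : GL ι ℂ) (X : Matrix ι ι ℂ) :
    expGL ((g : Matrix ι ι ℂ) * X * ((g⁻¹ : GL ι ℂ) : Matrix ι ι ℂ)) = g * expGL X * g⁻¹ := by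
  apply Units.ext
  simp only [coe_expGL, Units.val_mul]
  exact Matrix.exp_units_conj g X

/-- The Lie algebra of a group `H` of matrices: the real span of the matrices `X` all of whose
exponentials `exp (t X)`, `t` real, lie in `H`. (If `H` is closed, these matrices already form a
real vector space.) -/
noncomputable def lieAlg (H : Subgroup (GL ι ℂ)) : Submodule ℝ (Matrix ι ι ℂ) :=
  Submodule.span ℝ {X | ∀ t : ℝ, expGL (t • X) ∈ H}

/-- The subgroup generated by the exponentials of the elements of a space of matrices
(for a Lie subalgebra, the connected Lie subgroup with this Lie algebra). -/
def analyticSubgroup (V : Submodule ℝ (Matrix ι ι ℂ)) : Subgroup (GL ι ℂ) :=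
  Subgroup.closure (expGL '' (V : Set (Matrix ι ι ℂ)))

/-- `H` is a connected Lie subgroup of the general linear group: the matrices whose one-parameter
group lies in `H` form a vector space, and their exponentials generate `H`. -/
def IsConnectedLieSubgroup (H : Subgroup (GL ι ℂ)) : Prop :=
  (∀ X ∈ lieAlg H, ∀ t : ℝ, expGL (t • X) ∈ H) ∧ H = analyticSubgroup (lieAlg H)

/-- The adjoint action of an invertible matrix on all matrices. -/
noncomputable def adMat (g : GL ι ℂ) : Matrix ι ι ℂ →ₗ[ℝ] Matrix ι ι ℂ where
  toFun X := (g : Matrix ι ι ℂ) * X * ((g⁻¹ : GL ι ℂ) : Matrix ι ι ℂ)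
  map_add' X Y := by rw [Matrix.mul_add, Matrix.add_mul]
  map_smul' c X := by simp

theorem adMat_mem {G : Subgroup (GL ι ℂ)} {g : GL ι ℂ} (hg : g ∈ G) {X : Matrix ι ι ℂ}
    (hX : X ∈ lieAlg G) : adMat g X ∈ lieAlg G := by
  have key : lieAlg G ≤ (lieAlg G).comap (adMat g) := by
    refine Submodule.span_le.2 fun Y hY => Submodule.subset_span fun t => ?_
    rw [← map_smul]
    change expGL ((g : Matrix ι ι ℂ) * (t • Y) * ((g⁻¹ : GL ι ℂ) : Matrix ι ι ℂ)) ∈ G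
    rw [expGL_conj]
    exact G.mul_mem (G.mul_mem hg (hY t)) (G.inv_mem hg)
  exact key hX

/-- The adjoint representation of `G` on its Lie algebra. -/
noncomputable def adGroup (G : Subgroup (GL ι ℂ)) (g : G) : lieAlg G →ₗ[ℝ] lieAlg G :=
  (adMat (g : GL ι ℂ)).restrict fun _ hX => adMat_mem g.2 hX

/-! ### Homogeneous manifolds `G/H` and their invariant Lorentzian metrics -/

/-- Smooth real functions on a (closed, hence embedded) group of matrices: those which near
every point are restrictions of smooth functions of the matrix entries. -/
def IsSmoothOnGroup (G : Subgroup (GL ι ℂ)) (f : G → ℝ) : Prop :=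
  ∀ x : G, ∃ F : (ι → ι → ℂ) → ℝ, ContDiff ℝ ∞ F ∧
    ∀ᶠ y : G in 𝓝 x, f y = F fun i j => ((y : GL ι ℂ) : Matrix ι ι ℂ) i j

/-- The homogeneous manifold `G/H`. -/
abbrev HomSpace (G H : Subgroup (GL ι ℂ)) : Type _ := G ⧸ H.subgroupOf G

/-- Smooth functions on the manifold `G/H`: those whose pull-back to `G` is smooth. -/
def IsSmoothOnHomSpace (G H : Subgroup (GL ι ℂ)) (f : HomSpace G H → ℝ) : Prop :=
  IsSmoothOnGroup G fun x => f (QuotientGroup.mk x)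

/-- `G/H` and `G/L` are isomorphic as homogeneous `G`-manifolds: there is a `G`-equivariant
diffeomorphism, i.e. a `G`-equivariant bijection under which the smooth functions on the
two manifolds correspond to each other. -/
def HomSpaceIsomorphic (G H L : Subgroup (GL ι ℂ)) : Prop :=
  ∃ φ : HomSpace G H ≃ HomSpace G L,
    (∀ (g : G) (p : HomSpace G H), φ (g • p) = g • φ p) ∧
    ∀ f : HomSpace G L → ℝ, IsSmoothOnHomSpace G L f ↔ IsSmoothOnHomSpace G H (f ∘ φ)

/-- A Lorentzian metric on the manifold `G/H`, given through its pull-back `form` under the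
projection `G → G/H`, where the tangent space `x 𝔤` of `G` at `x` is identified with `𝔤` by left
translation. The tangent space of `G/H` at `xH` is thereby identified with `𝔤/𝔥`. -/
structure LorentzMetric (G H : Subgroup (GL ι ℂ)) where
  form : G → LinearMap.BilinForm ℝ (lieAlg G)
  smooth : ∀ X Y : lieAlg G, IsSmoothOnGroup G fun x => form x X Y
  symm : ∀ (x : G) (X Y : lieAlg G), form x X Y = form x Y X
  /-- vectors tangent to the fibre `xH` are in the kernel -/
  vertical : ∀ (x : G) (X : lieAlg G), (X : Matrix ι ι ℂ) ∈ lieAlg H →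
    ∀ Y : lieAlg G, form x X Y = 0
  /-- the pull-back is invariant under right translation by elements of `H` -/
  right_inv : ∀ (x h : G), (h : GL ι ℂ) ∈ H → ∀ X Y : lieAlg G,
    form (x * h) (adGroup G h⁻¹ X) (adGroup G h⁻¹ Y) = form x X Y
  /-- the scalar product on `𝔤/𝔥` has signature `(-,+,…,+)` -/
  lorentzian : ∀ x : G, ∃ v : lieAlg G, form x v v < 0 ∧
    ∀ w : lieAlg G, form x v w = 0 → (w : Matrix ι ι ℂ) ∉ lieAlg H → 0 < form x w w

/-- The metric is invariant under the action of `G` on `G/H`. -/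
def LorentzMetric.IsInvariant {G H : Subgroup (GL ι ℂ)} (m : LorentzMetric G H) : Prop :=
  ∀ a x : G, m.form (a * x) = m.form x

/-- `H` is an admissible subgroup of `G`: a compact connected Lie subgroup such that the
(proper) homogeneous manifold `G/H` admits a `G`-invariant Lorentzian metric. -/
def IsAdmissible (G H : Subgroup (GL ι ℂ)) : Prop :=
  H ≤ G ∧ IsCompact (H : Set (GL ι ℂ)) ∧ IsConnectedLieSubgroup H ∧
    ∃ m : LorentzMetric G H, m.IsInvariant

/-- `H` is a maximal admissible subgroup of `G`, i.e. `G/H` is a minimal admissible manifold. -/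
def IsMaximalAdmissible (G H : Subgroup (GL ι ℂ)) : Prop :=
  Maximal (IsAdmissible G) H

/-- `G/H` is of class I: for a maximal compact subgroup `K` of `G` containing `H` and a reductive
decomposition `𝔨 = 𝔥 + 𝔫`, there is a nonzero `Ad_H`-invariant vector in `𝔫`. -/
def IsClassI (G H : Subgroup (GL ι ℂ)) : Prop :=
  ∃ K : Subgroup (GL ι ℂ),
    Maximal (fun K' : Subgroup (GL ι ℂ) => K' ≤ G ∧ IsCompact (K' : Set (GL ι ℂ))) K ∧ H ≤ K ∧
    ∃ N : Submodule ℝ (Matrix ι ι ℂ),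
      Disjoint (lieAlg H) N ∧ lieAlg H ⊔ N = lieAlg K ∧
      (∀ h ∈ H, ∀ X ∈ N, adMat h X ∈ N) ∧
      ∃ X ∈ N, X ≠ 0 ∧ ∀ h ∈ H, adMat h X = X

/-- The special unitary group of the Hermitian form with Gram matrix `J`. -/
def specialUnitaryOf (J : Matrix ι ι ℂ) : Subgroup (GL ι ℂ) where
  carrier := {g | (g : Matrix ι ι ℂ)ᴴ * J * (g : Matrix ι ι ℂ) = J ∧ (g : Matrix ι ι ℂ).det = 1}
  one_mem' := by simp
  mul_mem' := by
    rintro a b ⟨ha, ha'⟩ ⟨hb, hb'⟩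
    refine ⟨?_, by simp [ha', hb']⟩
    calc ((a * b : GL ι ℂ) : Matrix ι ι ℂ)ᴴ * J * ((a * b : GL ι ℂ) : Matrix ι ι ℂ)
        = (b : Matrix ι ι ℂ)ᴴ * ((a : Matrix ι ι ℂ)ᴴ * J * (a : Matrix ι ι ℂ)) *
          (b : Matrix ι ι ℂ) := by
          simp only [Units.val_mul, Matrix.conjTranspose_mul, Matrix.mul_assoc]
      _ = J := by rw [ha, hb]
  inv_mem' := by
    rintro a ⟨ha, ha'⟩
    have h1 : (a : Matrix ι ι ℂ) * ((a⁻¹ : GL ι ℂ) : Matrix ι ι ℂ) = 1 := a.mul_inv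
    have h2 : ((a⁻¹ : GL ι ℂ) : Matrix ι ι ℂ)ᴴ * (a : Matrix ι ι ℂ)ᴴ = 1 := by
      rw [← Matrix.conjTranspose_mul, h1, Matrix.conjTranspose_one]
    constructor
    · calc ((a⁻¹ : GL ι ℂ) : Matrix ι ι ℂ)ᴴ * J * ((a⁻¹ : GL ι ℂ) : Matrix ι ι ℂ)
          = ((a⁻¹ : GL ι ℂ) : Matrix ι ι ℂ)ᴴ * ((a : Matrix ι ι ℂ)ᴴ * J * (a : Matrix ι ι ℂ)) *
            ((a⁻¹ : GL ι ℂ) : Matrix ι ι ℂ) := by rw [ha]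
        _ = (((a⁻¹ : GL ι ℂ) : Matrix ι ι ℂ)ᴴ * (a : Matrix ι ι ℂ)ᴴ) * J *
            ((a : Matrix ι ι ℂ) * ((a⁻¹ : GL ι ℂ) : Matrix ι ι ℂ)) := by
            simp only [Matrix.mul_assoc]
        _ = J := by rw [h1, h2, Matrix.one_mul, Matrix.mul_one]
    · have h3 := congrArg Matrix.det h1
      rw [Matrix.det_mul, ha', one_mul, Matrix.det_one] at h3
      exact h3

end General

/-! ### The groups `SU_n` and `SU_{1,n}` -/

/-- The special unitary group `SU_n`. -/
def SUn (n : ℕ) : Subgroup (GL (Fin n) ℂ) := specialUnitaryOf 1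

/-- The group `SU_{1,n}` of the pseudo-Hermitian form with Gram matrix `diag(-1, 1, …, 1)`. -/
def SU1n (n : ℕ) : Subgroup (GL (Unit ⊕ Fin n) ℂ) :=
  specialUnitaryOf (Matrix.fromBlocks (-1) 0 0 1)

/-- The embedding `A ↦ diag(1, A)`, which maps `SU_n` into `SU_{1,n}`. -/
def blockEmb (n : ℕ) : GL (Fin n) ℂ →* GL (Unit ⊕ Fin n) ℂ :=
  Units.map
    { toFun := fun A : Matrix (Fin n) (Fin n) ℂ => Matrix.fromBlocks 1 0 0 A
      map_one' := Matrix.fromBlocks_one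
      map_mul' := fun A B => by simp [Matrix.fromBlocks_multiply] }

/-- The image of the Lie algebra element `a` of `SU_n` under the differential of the embedding
`A ↦ diag(1, A)`, i.e. `diag(0, a)`. -/
def blockLie {n : ℕ} (a : Matrix (Fin n) (Fin n) ℂ) :
    Matrix (Unit ⊕ Fin n) (Unit ⊕ Fin n) ℂ :=
  Matrix.fromBlocks 0 0 0 a

/-- The central element `z₀ = i diag(1, -1/n, …, -1/n)` of the Lie algebra
`𝔲_n = 𝔰(𝔲_1 + 𝔲_n)` of the maximal compact subgroup `U_n = S(U_1 × U_n)` of `SU_{1,n}`. -/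
noncomputable def zZero (n : ℕ) : Matrix (Unit ⊕ Fin n) (Unit ⊕ Fin n) ℂ :=
  Matrix.fromBlocks (Complex.I • 1) 0 0 (-(Complex.I / n) • 1)

/-- The one-parameter group `T¹_a = {exp (t (z₀ + a)) | t ∈ ℝ}`. -/
noncomputable def torusT {n : ℕ} (a : Matrix (Fin n) (Fin n) ℂ) :
    Subgroup (GL (Unit ⊕ Fin n) ℂ) :=
  analyticSubgroup (Submodule.span ℝ {zZero n + blockLie a})

/-- The space of those elements of the centralizer of `a` in `𝔰𝔲_n` which are orthogonal to `a`
with respect to the invariant form `tr (X Y)`. For `a ≠ 0` this is the ideal complementary to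
`ℝ a` in the centralizer of `a`. -/
noncomputable def reducedCentralizer {n : ℕ} (a : Matrix (Fin n) (Fin n) ℂ) :
    Submodule ℝ (Matrix (Fin n) (Fin n) ℂ) where
  carrier := {Y | Y ∈ lieAlg (SUn n) ∧ a * Y = Y * a ∧ (a * Y).trace = 0}
  zero_mem' := by simp
  add_mem' := by
    rintro X Y ⟨h1, h2, h3⟩ ⟨k1, k2, k3⟩
    refine ⟨Submodule.add_mem _ h1 k1, ?_, ?_⟩
    · rw [Matrix.mul_add, Matrix.add_mul, h2, k2]
    · rw [Matrix.mul_add, Matrix.trace_add, h3, k3, add_zero]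
  smul_mem' := by
    rintro c X ⟨h1, h2, h3⟩
    refine ⟨Submodule.smul_mem _ c h1, ?_, ?_⟩
    · rw [Matrix.mul_smul, Matrix.smul_mul, h2]
    · rw [Matrix.mul_smul, Matrix.trace_smul, h3, smul_zero]

/-! Two principles carry the proof. The first is a criterion for admissibility: a compact connected
`H` preserving a positive definite form on matrices is admissible as soon as it fixes a vector of
`𝔤` outside `𝔥`, because the sign of the form can be reversed along a fixed vector orthogonal to `𝔥`
(`isAdmissible_of_fixed`). Conversely an invariant Lorentzian metric, compared with an invariant
norm, singles out a timelike line, and a connected group fixes it pointwise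
(`IsAdmissible.exists_fixed`). The second is that a compact subgroup of `SU_{1,n}` preserves a
negative line and so is conjugate into `K = S(U_1 × U_n)` (`exists_conj_le_compactUn`). As conjugate
subgroups give isomorphic manifolds, `H` may be replaced by a conjugate `L ≤ K`, which is then
maximal among the compact connected subgroups of `K` fixing a vector outside their Lie algebra
(`IsMaximalFixing`).

If `z₀ ∈ Lie L`, then `L = T¹₀ · H'` with `H' ≤ SU_n`. The class I vector, made orthogonal to `Lie
L`, has no `z₀`-component, so it lies in `𝔰𝔲_n` and makes `H'` admissible; maximality of `L` gives
maximality of `H'`. This is case (c).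

If `z₀ ∉ Lie L`, the component of `z₀` orthogonal to `Lie L` is a nonzero fixed vector, diagonal
after conjugation in `K`. Compactness of `L` makes the traces of `Lie L` on its eigenspaces a
rational subspace, so the vector can be replaced by an integral diagonal `y`, still fixed by `L` and
orthogonal to `Lie L`, with `y₀ ≠ 0` (`exists_integral_fixed`). Integrality makes the connected
group whose Lie algebra is the orthogonal complement of `y` in its centralizer compact; it contains
`L` and fixes `i y`, so it equals `L` (`IsMaximalFixing.eq_orthCentralizer`). If `y` is proportional
to `z₀` this group is `SU_n`, case (a). Otherwise `a` is the multiple of the `𝔰𝔲_n`-part of `i y`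
for which `z₀ + a` is orthogonal to `y`, and the group is `T¹_a · Z'(a)`, case (b). -/

/-! ### Exponentials of matrices -/

section Exponential

variable {ι : Type*} [Fintype ι] [DecidableEq ι]

theorem Matrix.exists_unitary_diagonal_of_skew {X : Matrix ι ι ℂ} (hX : Xᴴ = -X) :
    ∃ V ∈ Matrix.unitaryGroup ι ℂ, ∃ d : ι → ℝ,
      X = V * Matrix.diagonal (fun j => Complex.I * (d j : ℂ)) * Vᴴ := by
  have hA : (-Complex.I • X).IsHermitian := by
    rw [Matrix.IsHermitian, Matrix.conjTranspose_smul, hX]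
    simp
  refine ⟨hA.eigenvectorUnitary, hA.eigenvectorUnitary.2, hA.eigenvalues, ?_⟩
  have h := hA.spectral_theorem
  rw [Unitary.conjStarAlgAut_apply] at h
  have h2 : X = Complex.I • (-Complex.I • X) := by simp [smul_smul]
  have h3 : Matrix.diagonal (fun j => Complex.I * (hA.eigenvalues j : ℂ)) =
      Complex.I • Matrix.diagonal (RCLike.ofReal ∘ hA.eigenvalues : ι → ℂ) := by
    ext i j
    by_cases hij : i = j
    · subst hij; simp
    · simp [hij]
  rw [h3, Matrix.mul_smul, Matrix.smul_mul]
  conv_lhs => rw [h2, h]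
  rfl

theorem Matrix.det_exp_of_skew {X : Matrix ι ι ℂ} (hX : Xᴴ = -X) :
    (NormedSpace.exp X).det = Complex.exp X.trace := by
  obtain ⟨V, hV, d, rfl⟩ := Matrix.exists_unitary_diagonal_of_skew hX
  have h1 : Vᴴ * V = 1 := (Matrix.mem_unitaryGroup_iff'.1 hV)
  have h2 : V * Vᴴ = 1 := (Matrix.mem_unitaryGroup_iff.1 hV)
  have hinv : Vᴴ = V⁻¹ := (Matrix.inv_eq_right_inv h2).symm
  have hu : IsUnit V := ⟨⟨V, Vᴴ, h2, h1⟩, rfl⟩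
  rw [hinv, Matrix.exp_conj _ _ hu, Matrix.exp_diagonal, ← hinv, Matrix.det_mul_right_comm, h2,
    one_mul, Matrix.det_diagonal, Matrix.trace_mul_cycle, h1, one_mul, Matrix.trace_diagonal,
    Complex.exp_sum]
  refine Finset.prod_congr rfl fun j _ => ?_
  rw [Complex.exp_eq_exp_ℂ, Pi.coe_exp]

theorem expGL_add {X Y : Matrix ι ι ℂ} (h : Commute X Y) :
    expGL (X + Y) = expGL X * expGL Y :=
  Units.ext (Matrix.exp_add_of_commute X Y h)

@[simp] theorem expGL_zero : expGL (0 : Matrix ι ι ℂ) = 1 :=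
  Units.ext (by simp [coe_expGL])

theorem expGL_neg (X : Matrix ι ι ℂ) : expGL (-X) = (expGL X)⁻¹ := by
  rw [eq_inv_iff_mul_eq_one, ← expGL_add (Commute.neg_left (Commute.refl X))]
  simp

theorem expGL_add_smul (s t : ℝ) (X : Matrix ι ι ℂ) :
    expGL ((s + t) • X) = expGL (s • X) * expGL (t • X) := by
  rw [add_smul, expGL_add]
  exact ((Commute.refl X).smul_left s).smul_right t

theorem expGL_nat_smul (n : ℕ) (X : Matrix ι ι ℂ) : expGL ((n : ℝ) • X) = expGL X ^ n := by
  induction n with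
  | zero => simp
  | succ k ih => rw [Nat.cast_succ, expGL_add_smul, ih, one_smul, pow_succ]

theorem expGL_int_smul (n : ℤ) (X : Matrix ι ι ℂ) : expGL ((n : ℝ) • X) = expGL X ^ n := by
  cases n with
  | ofNat k => simpa using expGL_nat_smul k X
  | negSucc k =>
    rw [zpow_negSucc, ← expGL_nat_smul, ← expGL_neg, ← neg_smul]
    push_cast
    rfl

open scoped Matrix.Norms.Operator in
theorem Matrix.hasDerivAt_exp_smul (X : Matrix ι ι ℂ) :
    HasDerivAt (fun t : ℝ => NormedSpace.exp (t • X)) X 0 := by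
  have h := hasDerivAt_exp_smul_const (𝕂 := ℝ) X 0
  rw [zero_smul, NormedSpace.exp_zero, one_mul] at h
  exact h

open scoped Matrix.Norms.Operator in
theorem Matrix.continuous_exp : Continuous (NormedSpace.exp : Matrix ι ι ℂ → Matrix ι ι ℂ) :=
  NormedSpace.exp_continuous

theorem continuous_expGL : Continuous (expGL : Matrix ι ι ℂ → GL ι ℂ) := by
  rw [Units.continuous_iff]
  refine ⟨Matrix.continuous_exp, ?_⟩
  have : (fun X : Matrix ι ι ℂ => (((expGL X)⁻¹ : GL ι ℂ) : Matrix ι ι ℂ)) =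
      fun X => NormedSpace.exp (-X) := by
    funext X
    rw [← expGL_neg, coe_expGL]
  rw [this]
  exact Matrix.continuous_exp.comp continuous_neg

open scoped Matrix.Norms.Operator in
/-- A continuous real linear condition on matrices that holds along a one-parameter group holds
for its generator. -/
theorem Matrix.linear_eq_of_exp {F : Type*} [NormedAddCommGroup F] [NormedSpace ℝ F]
    (f : Matrix ι ι ℂ →ₗ[ℝ] F) (c : F) {X : Matrix ι ι ℂ}
    (h : ∀ t : ℝ, f (NormedSpace.exp (t • X)) = c) : f X = 0 := by
  have h1 : HasDerivAt (fun t : ℝ => f (NormedSpace.exp (t • X))) (f X) 0 :=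
    (LinearMap.toContinuousLinearMap f).hasFDerivAt.comp_hasDerivAt 0
      (Matrix.hasDerivAt_exp_smul X)
  have h2 : (fun t : ℝ => f (NormedSpace.exp (t • X))) = fun _ => c := funext h
  rw [h2] at h1
  exact h1.unique (hasDerivAt_const _ _)

open scoped Matrix.Norms.Operator in
theorem Matrix.commute_of_commute_exp {A X : Matrix ι ι ℂ}
    (h : ∀ t : ℝ, Commute A (NormedSpace.exp (t • X))) : Commute A X := by
  have := Matrix.linear_eq_of_exp
    (LinearMap.mulLeft ℝ A - LinearMap.mulRight ℝ A) 0 (X := X) (fun t => by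
      simp [(h t).eq])
  exact sub_eq_zero.1 this

open scoped Matrix.Norms.Operator in
theorem Matrix.skew_of_exp {J X : Matrix ι ι ℂ}
    (h : ∀ t : ℝ, (NormedSpace.exp (t • X))ᴴ * J * NormedSpace.exp (t • X) = J) :
    Xᴴ * J + J * X = 0 := by
  have h1 := Matrix.hasDerivAt_exp_smul X
  have h2 : HasDerivAt (fun t : ℝ => (NormedSpace.exp (t • X))ᴴ) Xᴴ 0 := by
    have := Matrix.hasDerivAt_exp_smul Xᴴ
    refine this.congr_of_eventuallyEq (Filter.Eventually.of_forall fun t => ?_)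
    simp only
    rw [← Matrix.exp_conjTranspose, Matrix.conjTranspose_smul]
    simp
  have h3 := (h2.mul_const J).mul h1
  have h4 : ((fun t : ℝ => (NormedSpace.exp (t • X))ᴴ * J) * fun t => NormedSpace.exp (t • X)) =
      fun _ => J := funext h
  rw [h4] at h3
  simpa using h3.unique (hasDerivAt_const _ _)

theorem Complex.eq_zero_of_exp_smul {z : ℂ} (h : ∀ t : ℝ, Complex.exp (t * z) = 1) : z = 0 := by
  have h1 : HasDerivAt (fun t : ℝ => Complex.exp (t * z)) z 0 := by
    have := ((Complex.ofRealCLM.hasDerivAt (x := (0:ℝ))).mul_const z).cexp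
    simpa using this
  have h2 : (fun t : ℝ => Complex.exp (t * z)) = fun _ => 1 := funext h
  rw [h2] at h1
  exact h1.unique (hasDerivAt_const _ _)

end Exponential

/-! ### Lie algebras and analytic subgroups -/

section LieAlg

variable {ι : Type*} [Fintype ι] [DecidableEq ι]

theorem mem_lieAlg_of_forall {H : Subgroup (GL ι ℂ)} {X : Matrix ι ι ℂ}
    (h : ∀ t : ℝ, expGL (t • X) ∈ H) : X ∈ lieAlg H := Submodule.subset_span h

theorem lieAlg_mono {H L : Subgroup (GL ι ℂ)} (h : H ≤ L) : lieAlg H ≤ lieAlg L :=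
  Submodule.span_mono fun _ hX t => h (hX t)

theorem lieAlg_le_of_forall {H : Subgroup (GL ι ℂ)} {V : Submodule ℝ (Matrix ι ι ℂ)}
    (h : ∀ X, (∀ t : ℝ, expGL (t • X) ∈ H) → X ∈ V) : lieAlg H ≤ V :=
  Submodule.span_le.2 h

theorem expGL_mem_analyticSubgroup {V : Submodule ℝ (Matrix ι ι ℂ)} {X : Matrix ι ι ℂ}
    (h : X ∈ V) : expGL X ∈ analyticSubgroup V := Subgroup.subset_closure ⟨X, h, rfl⟩

theorem analyticSubgroup_le {V : Submodule ℝ (Matrix ι ι ℂ)} {H : Subgroup (GL ι ℂ)}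
    (h : ∀ X ∈ V, expGL X ∈ H) : analyticSubgroup V ≤ H :=
  (Subgroup.closure_le _).2 (by rintro _ ⟨X, hX, rfl⟩; exact h X hX)

theorem analyticSubgroup_mono {V W : Submodule ℝ (Matrix ι ι ℂ)} (h : V ≤ W) :
    analyticSubgroup V ≤ analyticSubgroup W :=
  analyticSubgroup_le fun _ hX => expGL_mem_analyticSubgroup (h hX)

theorem le_lieAlg_analyticSubgroup (V : Submodule ℝ (Matrix ι ι ℂ)) :
    V ≤ lieAlg (analyticSubgroup V) := fun _ hX =>
  mem_lieAlg_of_forall fun t => expGL_mem_analyticSubgroup (V.smul_mem t hX)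

/-- `V` is not assumed closed under brackets: the hypothesis replaces the theorem that an analytic
subgroup has the expected Lie algebra, and each use verifies it directly. -/
theorem lieAlg_analyticSubgroup {V : Submodule ℝ (Matrix ι ι ℂ)}
    (h : ∀ X, (∀ t : ℝ, expGL (t • X) ∈ analyticSubgroup V) → X ∈ V) :
    lieAlg (analyticSubgroup V) = V :=
  le_antisymm (lieAlg_le_of_forall h) (le_lieAlg_analyticSubgroup V)

theorem isConnectedLieSubgroup_analyticSubgroup {V : Submodule ℝ (Matrix ι ι ℂ)}
    (h : ∀ X, (∀ t : ℝ, expGL (t • X) ∈ analyticSubgroup V) → X ∈ V) :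
    IsConnectedLieSubgroup (analyticSubgroup V) := by
  refine ⟨fun X hX t => ?_, ?_⟩
  · rw [lieAlg_analyticSubgroup h] at hX
    exact expGL_mem_analyticSubgroup (V.smul_mem t hX)
  · rw [lieAlg_analyticSubgroup h]

theorem IsConnectedLieSubgroup.le_of_lieAlg_le {H L : Subgroup (GL ι ℂ)}
    (hH : IsConnectedLieSubgroup H) (hL : ∀ X ∈ lieAlg H, expGL X ∈ L) : H ≤ L := by
  rw [hH.2]; exact analyticSubgroup_le hL

theorem IsConnectedLieSubgroup.expGL_mem {H : Subgroup (GL ι ℂ)}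
    (hH : IsConnectedLieSubgroup H) {X : Matrix ι ι ℂ} (hX : X ∈ lieAlg H) : expGL X ∈ H := by
  simpa using hH.1 X hX 1

/-- The group of invertible matrices commuting with a given matrix. -/
def commutantGroup (A : Matrix ι ι ℂ) : Subgroup (GL ι ℂ) where
  carrier := {g | Commute (g : Matrix ι ι ℂ) A}
  one_mem' := by simp
  mul_mem' ha hb := by
    simp only [Set.mem_ofPred_eq, Units.val_mul] at *
    exact Commute.mul_left ha hb
  inv_mem' {a} ha := by
    simp only [Set.mem_ofPred_eq] at *
    exact Commute.units_inv_left ha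

theorem mem_commutantGroup {A : Matrix ι ι ℂ} {g : GL ι ℂ} :
    g ∈ commutantGroup A ↔ Commute (g : Matrix ι ι ℂ) A := Iff.rfl

theorem expGL_mem_commutantGroup {A X : Matrix ι ι ℂ} (h : Commute X A) :
    expGL X ∈ commutantGroup A := by
  rw [mem_commutantGroup, coe_expGL]
  exact h.exp_left

theorem commute_of_expGL_mem_commutantGroup {A X : Matrix ι ι ℂ}
    (h : ∀ t : ℝ, expGL (t • X) ∈ commutantGroup A) : Commute X A :=
  (Matrix.commute_of_commute_exp fun t => (h t).symm).symm

theorem adMat_apply (g : GL ι ℂ) (X : Matrix ι ι ℂ) :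
    adMat g X = (g : Matrix ι ι ℂ) * X * ((g⁻¹ : GL ι ℂ) : Matrix ι ι ℂ) := rfl

theorem adMat_eq_self_iff {g : GL ι ℂ} {X : Matrix ι ι ℂ} :
    adMat g X = X ↔ Commute (g : Matrix ι ι ℂ) X := by
  rw [adMat_apply, Commute, SemiconjBy, Units.mul_inv_eq_iff_eq_mul]

theorem adMat_mul (g h : GL ι ℂ) (X : Matrix ι ι ℂ) : adMat (g * h) X = adMat g (adMat h X) := by
  simp [adMat_apply, Matrix.mul_assoc]

@[simp] theorem adMat_one (X : Matrix ι ι ℂ) : adMat 1 X = X := by simp [adMat_apply]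

@[simp] theorem adMat_inv_adMat (g : GL ι ℂ) (X : Matrix ι ι ℂ) : adMat g⁻¹ (adMat g X) = X := by
  rw [← adMat_mul]; simp

@[simp] theorem adMat_adMat_inv (g : GL ι ℂ) (X : Matrix ι ι ℂ) : adMat g (adMat g⁻¹ X) = X := by
  rw [← adMat_mul]; simp

theorem expGL_adMat (g : GL ι ℂ) (X : Matrix ι ι ℂ) : expGL (adMat g X) = g * expGL X * g⁻¹ :=
  expGL_conj g X

theorem adMat_mem_of_mem {H : Subgroup (GL ι ℂ)} {h : GL ι ℂ} (hh : h ∈ H) {X : Matrix ι ι ℂ}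
    (hX : X ∈ lieAlg H) : adMat h X ∈ lieAlg H := adMat_mem hh hX

/-- The conjugate `g H g⁻¹`. -/
def conjSubgroup (g : GL ι ℂ) (H : Subgroup (GL ι ℂ)) : Subgroup (GL ι ℂ) :=
  H.map (MulAut.conj g).toMonoidHom

theorem mem_conjSubgroup {g x : GL ι ℂ} {H : Subgroup (GL ι ℂ)} :
    x ∈ conjSubgroup g H ↔ g⁻¹ * x * g ∈ H := by
  constructor
  · rintro ⟨y, hy, rfl⟩
    simpa [mul_assoc] using hy
  · intro h
    exact ⟨_, h, by simp [mul_assoc]⟩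

theorem conjSubgroup_mul (g k : GL ι ℂ) (H : Subgroup (GL ι ℂ)) :
    conjSubgroup (g * k) H = conjSubgroup g (conjSubgroup k H) := by
  ext x; simp [mem_conjSubgroup, mul_assoc]

@[simp] theorem conjSubgroup_one (H : Subgroup (GL ι ℂ)) : conjSubgroup 1 H = H := by
  ext x; simp [mem_conjSubgroup]

theorem conjSubgroup_mono {g : GL ι ℂ} {H L : Subgroup (GL ι ℂ)} (h : H ≤ L) :
    conjSubgroup g H ≤ conjSubgroup g L := Subgroup.map_mono h

theorem conjSubgroup_le {g : GL ι ℂ} {H G : Subgroup (GL ι ℂ)} (h : H ≤ G) (hg : g ∈ G) :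
    conjSubgroup g H ≤ G := fun x hx => by
  have := h (mem_conjSubgroup.1 hx)
  have h2 := G.mul_mem (G.mul_mem hg this) (G.inv_mem hg)
  simpa [mul_assoc] using h2

theorem mem_lieAlg_conj {g : GL ι ℂ} {H : Subgroup (GL ι ℂ)} {X : Matrix ι ι ℂ}
    (hX : X ∈ lieAlg H) : adMat g X ∈ lieAlg (conjSubgroup g H) := by
  have : lieAlg H ≤ (lieAlg (conjSubgroup g H)).comap (adMat g) := by
    refine Submodule.span_le.2 fun Y hY => mem_lieAlg_of_forall fun t => ?_
    rw [← map_smul, expGL_adMat, mem_conjSubgroup]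
    simpa [mul_assoc] using hY t
  exact this hX

theorem mem_lieAlg_conj_iff {g : GL ι ℂ} {H : Subgroup (GL ι ℂ)} {X : Matrix ι ι ℂ} :
    X ∈ lieAlg (conjSubgroup g H) ↔ adMat g⁻¹ X ∈ lieAlg H := by
  constructor
  · intro h
    have := mem_lieAlg_conj (g := g⁻¹) h
    rwa [← conjSubgroup_mul, inv_mul_cancel, conjSubgroup_one] at this
  · intro h
    simpa using mem_lieAlg_conj (g := g) h

theorem IsConnectedLieSubgroup.conj {H : Subgroup (GL ι ℂ)} (hH : IsConnectedLieSubgroup H)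
    (g : GL ι ℂ) : IsConnectedLieSubgroup (conjSubgroup g H) := by
  refine ⟨fun X hX t => ?_, le_antisymm ?_ ?_⟩
  · rw [mem_lieAlg_conj_iff] at hX
    have h := hH.1 _ hX t
    rw [← map_smul, expGL_adMat] at h
    rw [mem_conjSubgroup]
    simpa using h
  · rintro _ ⟨y, hy, rfl⟩
    have hle : H ≤ (analyticSubgroup (lieAlg (conjSubgroup g H))).comap
        (MulAut.conj g).toMonoidHom := by
      refine hH.le_of_lieAlg_le fun X hX => ?_
      rw [Subgroup.mem_comap]
      have : (MulAut.conj g).toMonoidHom (expGL X) = expGL (adMat g X) := by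
        rw [expGL_adMat]; rfl
      rw [this]
      exact expGL_mem_analyticSubgroup (mem_lieAlg_conj hX)
    exact hle hy
  · refine analyticSubgroup_le fun X hX => ?_
    rw [mem_lieAlg_conj_iff] at hX
    have h := hH.expGL_mem hX
    rw [expGL_adMat] at h
    rw [mem_conjSubgroup]
    simpa using h

theorem isCompact_conjSubgroup {H : Subgroup (GL ι ℂ)} (hH : IsCompact (H : Set (GL ι ℂ)))
    (g : GL ι ℂ) : IsCompact (conjSubgroup g H : Set (GL ι ℂ)) := by
  have : Continuous fun x : GL ι ℂ => g * x * g⁻¹ := by fun_prop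
  exact hH.image this

end LieAlg

/-! ### Integral functionals annihilating a rational subspace -/

section Lattice

/-- Baire category: a complete countable space is a countable union of points, so some point is
isolated, and translation isolates `0`. -/
theorem discreteTopology_of_countable_of_isClosed {F : Type*} [NormedAddCommGroup F] [CompleteSpace F]
    (L : AddSubgroup F) (hc : (L : Set F).Countable) (hcl : IsClosed (L : Set F)) :
    DiscreteTopology L := by
  have : Countable L := hc
  have : CompleteSpace L := hcl.completeSpace_coe
  obtain ⟨x, hx⟩ := nonempty_interior_of_iUnion_of_closed (X := L) (f := fun x : L => {x})
    (fun x => isClosed_singleton) (by ext; simp)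
  have hxo : IsOpen ({x} : Set L) := by
    obtain ⟨y, hy⟩ := hx
    have h1 := interior_subset hy
    have h2 : interior ({x} : Set L) = {x} :=
      Set.Subset.antisymm interior_subset (Set.singleton_subset_iff.2 (Set.mem_singleton_iff.1 h1 ▸ hy))
    rw [← h2]; exact isOpen_interior
  refine discreteTopology_of_isOpen_singleton_zero ?_
  have h3 : (fun y : L => y + x) ⁻¹' {x} = {0} := by
    ext y; simp
  rw [← h3]
  exact hxo.preimage (by fun_prop)

/-- If `W + 2πℤ^ι` is closed, any vector outside `W` is detected by an integral functional that
annihilates `W`. -/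
theorem exists_int_functional {ι : Type*} [Fintype ι] [DecidableEq ι] (W : Submodule ℝ (ι → ℝ))
    (hW : IsClosed {x : ι → ℝ | ∃ w ∈ W, ∃ k : ι → ℤ, x = w + fun i => 2 * Real.pi * k i})
    {z : ι → ℝ} (hz : z ∉ W) :
    ∃ k : ι → ℤ, (∀ w ∈ W, ∑ i, (k i : ℝ) * w i = 0) ∧ ∑ i, (k i : ℝ) * z i ≠ 0 := by
  have hWc : IsClosed (W : Set (ι → ℝ)) := W.closed_of_finiteDimensional
  let e : ι → ((ι → ℝ) ⧸ W) := fun i => W.mkQ (Pi.single i (2 * Real.pi))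
  -- The image of `2πℤ^ι` in the quotient by `W`. Its preimage is the set assumed closed, so it is
  -- closed; being countable it is discrete, and it spans, hence it is a lattice.
  let L : Submodule ℤ ((ι → ℝ) ⧸ W) := Submodule.span ℤ (Set.range e)
  have hmem : ∀ y, y ∈ L ↔ ∃ k : ι → ℤ, y = W.mkQ fun i => 2 * Real.pi * k i := by
    intro y
    rw [Submodule.mem_span_range_iff_exists_fun]
    have : ∀ c : ι → ℤ, ∑ i, c i • e i = W.mkQ fun i => 2 * Real.pi * c i := by
      intro c
      simp only [e]
      rw [← Finset.sum_congr rfl fun i _ => map_zsmul W.mkQ (c i) _, ← map_sum]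
      congr 1
      ext j
      simp [Finset.sum_apply, Pi.single_apply, mul_comm]
    simp only [this, eq_comm]
  have hcl : IsClosed (L : Set ((ι → ℝ) ⧸ W)) := by
    rw [← (Submodule.isQuotientMap_mkQ W).isClosed_preimage]
    convert hW using 1
    ext x
    simp only [Set.mem_preimage, SetLike.mem_coe, hmem, Set.mem_ofPred_eq]
    constructor
    · rintro ⟨k, hk⟩
      rw [← sub_eq_zero, ← map_sub, ← LinearMap.mem_ker, Submodule.ker_mkQ] at hk
      exact ⟨_, hk, k, by abel⟩
    · rintro ⟨w, hw, k, rfl⟩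
      refine ⟨k, ?_⟩
      rw [map_add]
      simp [hw]
  have hcount : (L : Set ((ι → ℝ) ⧸ W)).Countable := by
    have : (L : Set ((ι → ℝ) ⧸ W)) ⊆ Set.range fun k : ι → ℤ => W.mkQ fun i => 2 * Real.pi * k i := by
      intro y hy
      obtain ⟨k, hk⟩ := (hmem y).1 hy
      exact ⟨k, hk.symm⟩
    exact (Set.countable_range _).mono this
  have hdisc : DiscreteTopology L :=
    discreteTopology_of_countable_of_isClosed L.toAddSubgroup hcount hcl
  have hlat : IsZLattice ℝ L := by
    constructor
    rw [Submodule.span_span_of_tower]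
    rw [eq_top_iff]
    rintro y -
    obtain ⟨x, rfl⟩ := W.mkQ_surjective y
    rw [Submodule.mem_span_range_iff_exists_fun]
    refine ⟨fun i => x i / (2 * Real.pi), ?_⟩
    simp only [e, ← map_smul, ← map_sum]
    congr 1
    ext j
    simp [Finset.sum_apply, Pi.single_apply]
  have : Module.Free ℤ L := ZLattice.module_free ℝ L
  have : Module.Finite ℤ L := ZLattice.module_finite ℝ L
  let b0 := Module.Free.chooseBasis ℤ L
  let b := b0.ofZLatticeBasis ℝ L
  have hz' : W.mkQ z ≠ 0 := by simpa using hz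
  -- A coordinate with respect to a lattice basis is integral on the vectors `e i`; pulled back and
  -- multiplied by `2π`, it becomes an integral functional killing `W`.
  obtain ⟨j, hj⟩ : ∃ j, b.repr (W.mkQ z) j ≠ 0 := by
    by_contra! h
    exact hz' (b.repr.map_eq_zero_iff.1 (Finsupp.ext h))
  have hrep : ∀ x : ι → ℝ, b.repr (W.mkQ x) j = ∑ i, (b0.repr ⟨e i, Submodule.subset_span ⟨i, rfl⟩⟩ j : ℝ) * x i / (2 * Real.pi) := by
    intro x
    have hx : W.mkQ x = ∑ i, (x i / (2 * Real.pi)) • e i := by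
      simp only [e, ← map_smul, ← map_sum]
      congr 1
      ext j
      simp [Finset.sum_apply, Pi.single_apply]
    rw [hx, map_sum, Finsupp.finsetSum_apply]
    refine Finset.sum_congr rfl fun i _ => ?_
    have := b0.ofZLatticeBasis_repr_apply ℝ L ⟨e i, Submodule.subset_span ⟨i, rfl⟩⟩ j
    rw [map_smul, Finsupp.smul_apply]
    simp only [b]
    rw [this]
    simp; ring
  have hpi : (2 * Real.pi) ≠ 0 := by positivity
  refine ⟨fun i => b0.repr ⟨e i, Submodule.subset_span ⟨i, rfl⟩⟩ j, fun w hw => ?_, fun h => hj ?_⟩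
  · have h1 := hrep w
    have h2 : W.mkQ w = 0 := by simpa using hw
    rw [h2, ← Finset.sum_div] at h1
    rw [map_zero, Finsupp.zero_apply, eq_comm, div_eq_zero_iff] at h1
    exact h1.resolve_right hpi
  · rw [hrep, ← Finset.sum_div, h, zero_div]

end Lattice

/-! ### A line fixed by all isometries of a Lorentzian form and an auxiliary norm -/

section FixedLine

/-- Let `q` be a quadratic function which is negative on the kernel of a functional `ℓ` and
positive somewhere, and `N` a norm. The lines on which `N ^ 2 / q` is minimal are unique, hence
preserved by the linear maps that preserve `q` and `N`. -/
theorem exists_fixed_line {𝕜 E : Type*} [RCLike 𝕜] [NormedAddCommGroup E] [NormedSpace 𝕜 E]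
    [ProperSpace E] (ℓ : E →ₗ[𝕜] 𝕜) (q N : E → ℝ) (hq : Continuous q) (hN : Continuous N)
    (hqs : ∀ (c : 𝕜) x, q (c • x) = ‖c‖ ^ 2 * q x)
    (hqp : ∀ x y, q (x + y) + q (x - y) = 2 * (q x + q y))
    (hql : ∀ x, ℓ x = 0 → x ≠ 0 → q x < 0) (hpos : ∃ x, 0 < q x)
    (hNs : ∀ (c : 𝕜) x, N (c • x) = ‖c‖ * N x) (hNa : ∀ x y, N (x + y) ≤ N x + N y)
    (hNn : ∀ x, ‖x‖ ≤ N x) :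
    ∃ v, 0 < q v ∧ ∀ g : E → E, (∀ x, q (g x) = q x) → (∀ x, N (g x) = N x) →
      ∃ c : 𝕜, g v = c • v := by
  have hq0 : q 0 = 0 := by simpa using hqs 0 0
  have hN0 : ∀ x, 0 ≤ N x := fun x => (norm_nonneg x).trans (hNn x)
  have hs : IsClosed {x | 1 ≤ q x} := isClosed_le continuous_const hq
  have hsc : ∀ x, 0 < q x → ∃ c : ℝ, 0 < c ∧ c ^ 2 * q x = 1 := by
    intro x hx
    refine ⟨(Real.sqrt (q x))⁻¹, by positivity, ?_⟩
    rw [inv_pow, Real.sq_sqrt hx.le, inv_mul_cancel₀ hx.ne']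
  have hqr : ∀ (c : ℝ), 0 < c → ∀ x, q ((c : 𝕜) • x) = c ^ 2 * q x := by
    intro c hc x
    rw [hqs, RCLike.norm_ofReal, abs_of_pos hc]
  have hNr : ∀ (c : ℝ), 0 < c → ∀ x, N ((c : 𝕜) • x) = c * N x := by
    intro c hc x
    rw [hNs, RCLike.norm_ofReal, abs_of_pos hc]
  obtain ⟨x₁, hx₁⟩ := hpos
  obtain ⟨c₁, hc₁, hc₁'⟩ := hsc x₁ hx₁
  have hx₀ : ((c₁ : 𝕜) • x₁) ∈ {x | 1 ≤ q x} := by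
    simp only [Set.mem_ofPred_eq]; rw [hqr _ hc₁, hc₁']
  -- `N` dominates the norm, so it is coercive and attains its minimum on the closed set `{1 ≤ q}`.
  obtain ⟨v, hv1, hv2⟩ := hN.continuousOn.exists_isMinOn' hs hx₀ (by
    rw [Filter.eventually_inf_principal]
    filter_upwards [(isCompact_closedBall (0 : E) (N ((c₁ : 𝕜) • x₁))).compl_mem_cocompact]
      with x hx _
    simp only [Set.mem_compl_iff, Metric.mem_closedBall, dist_zero_right, not_le] at hx
    exact hx.le.trans (hNn x))
  set r := N v with hr
  have hqv : 0 < q v := lt_of_lt_of_le one_pos hv1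
  have hr0 : 0 < r := by
    have hv0 : v ≠ 0 := by rintro rfl; rw [hq0] at hqv; exact lt_irrefl _ hqv
    exact (norm_pos_iff.2 hv0).trans_le (hNn v)
  -- the minimality in homogeneous form
  have hmin : ∀ x, 0 < q x → r ^ 2 * q x ≤ N x ^ 2 := by
    intro x hx
    obtain ⟨c, hc, hc'⟩ := hsc x hx
    have h1 : r ≤ N ((c : 𝕜) • x) := hv2 (by
      simp only [Set.mem_ofPred_eq]; rw [hqr _ hc, hc'])
    rw [hNr _ hc] at h1
    have h2 : r ^ 2 ≤ c ^ 2 * N x ^ 2 := by rw [← mul_pow]; gcongr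
    calc r ^ 2 * q x ≤ c ^ 2 * N x ^ 2 * q x := by gcongr
      _ = (c ^ 2 * q x) * N x ^ 2 := by ring
      _ = N x ^ 2 := by rw [hc', one_mul]
  have hqv1 : q v = 1 := by
    refine le_antisymm ?_ hv1
    have := hmin v hqv
    rw [← hr] at this
    by_contra! h
    nlinarith [pow_pos hr0 2]
  have hl : ∀ x, 0 < q x → ℓ x ≠ 0 := by
    intro x hx h
    have : x ≠ 0 := by rintro rfl; rw [hq0] at hx; exact lt_irrefl _ hx
    exact absurd (hql x h this) (not_lt.2 hx.le)
  -- uniqueness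
  have huniq : ∀ x y, 0 < q x → 0 < q y → N x ^ 2 = r ^ 2 * q x → N y ^ 2 = r ^ 2 * q y →
      ℓ x = ℓ y → x = y := by
    intro x y hx hy hNx hNy hxy
    by_contra hne
    -- As `x - y` lies in the kernel of `ℓ`, the parallelogram law gives `q (x + y) > 2 (q x + q
    -- y)`, whereas convexity gives `N (x + y) ^ 2 ≤ 2 r ^ 2 (q x + q y)`. Then `x + y` would have a
    -- ratio below the minimum.
    have h1 : q (x - y) < 0 := hql _ (by simp [hxy]) (sub_ne_zero.2 hne)
    have h2 := hqp x y
    have h3 : 0 < q (x + y) := by linarith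
    have h4 := hmin _ h3
    have h5 : N (x + y) ^ 2 ≤ (N x + N y) ^ 2 := by
      have := hNa x y; have := hN0 (x + y); gcongr
    have h6 : (N x + N y) ^ 2 ≤ 2 * (N x ^ 2 + N y ^ 2) := by nlinarith [sq_nonneg (N x - N y)]
    rw [hNx, hNy] at h6
    nlinarith [pow_pos hr0 2]
  refine ⟨v, hqv, fun g hgq hgN => ⟨ℓ (g v) / ℓ v, ?_⟩⟩
  have hlv := hl v hqv
  have hlg : ℓ (g v) ≠ 0 := hl _ (by rwa [hgq])
  have hc0 : ‖ℓ (g v) / ℓ v‖ ≠ 0 := norm_ne_zero_iff.2 (div_ne_zero hlg hlv)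
  -- Both vectors attain the minimal ratio and have the same value under `ℓ`; linearity of `g` plays
  -- no role.
  refine huniq _ _ (by rwa [hgq]) ?_ ?_ ?_ ?_
  · rw [hqs]; positivity
  · rw [hgN, hgq, hqv1, hr, mul_one]
  · rw [hqs, hNs, mul_pow, hqv1]; ring
  · rw [map_smul, smul_eq_mul, div_mul_cancel₀ _ hlv]

end FixedLine

/-! ### Conjugate subgroups define isomorphic homogeneous manifolds -/

section Conj

variable {ι : Type*} [Fintype ι] [DecidableEq ι]

theorem IsSmoothOnGroup.comp_mul_right {G : Subgroup (GL ι ℂ)} {f : G → ℝ}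
    (hf : IsSmoothOnGroup G f) (k : G) : IsSmoothOnGroup G fun x => f (x * k) := by
  intro x
  obtain ⟨F, hF, hFx⟩ := hf (x * k)
  refine ⟨fun A => F fun i j => ∑ l, A i l * ((k : GL ι ℂ) : Matrix ι ι ℂ) l j, ?_, ?_⟩
  · exact hF.comp (by fun_prop)
  · have : Filter.Tendsto (fun y : G => y * k) (𝓝 x) (𝓝 (x * k)) :=
      (continuous_mul_const k).continuousAt
    filter_upwards [this.eventually hFx] with y hy
    rw [hy]
    rfl

/-- Right translation by `g⁻¹` carries the coset `xH` to `x g⁻¹ (g H g⁻¹)`; it commutes with the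
left action and preserves smoothness. -/
theorem homSpaceIsomorphic_conj {G : Subgroup (GL ι ℂ)} {g : GL ι ℂ} (hg : g ∈ G)
    (H : Subgroup (GL ι ℂ)) : HomSpaceIsomorphic G H (conjSubgroup g H) := by
  let k : G := ⟨g, hg⟩
  let φ : HomSpace G H ≃ HomSpace G (conjSubgroup g H) :=
    Quotient.congr (Equiv.mulRight k⁻¹) (fun a b => by
      change QuotientGroup.leftRel _ a b ↔ QuotientGroup.leftRel _ (a * k⁻¹) (b * k⁻¹)
      rw [QuotientGroup.leftRel_apply, QuotientGroup.leftRel_apply, Subgroup.mem_subgroupOf,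
        Subgroup.mem_subgroupOf, mem_conjSubgroup]
      simp [k, mul_assoc])
  have hφ : ∀ x : G, φ (QuotientGroup.mk x) = QuotientGroup.mk (x * k⁻¹) := fun _ => rfl
  refine ⟨φ, ?_, ?_⟩
  · intro a p
    induction p using QuotientGroup.induction_on with
    | H x =>
      rw [hφ]
      change φ (QuotientGroup.mk (a * x)) = QuotientGroup.mk (a * (x * k⁻¹))
      rw [hφ, mul_assoc]
  · intro f
    constructor
    · intro h
      exact IsSmoothOnGroup.comp_mul_right h k⁻¹
    · intro h
      have := IsSmoothOnGroup.comp_mul_right h k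
      simp only [Function.comp_apply, hφ, mul_inv_cancel_right] at this
      exact this

end Conj

/-! ### Closedness of analytic subgroups -/

section Closed

variable {ι : Type*} [Fintype ι] [DecidableEq ι]

open scoped Pointwise in
-- The exhausting sets consist of products of `m` exponentials of elements of `V` with entries
-- bounded by `j`. They prepare the Baire argument for compactness of analytic subgroups.
theorem exists_compact_exhaustion_analyticSubgroup (V : Submodule ℝ (Matrix ι ι ℂ)) :
    ∃ C : ℕ × ℕ → Set (GL ι ℂ), (∀ j, IsCompact (C j)) ∧
      (∀ j, C j ⊆ analyticSubgroup V) ∧ ∀ x ∈ analyticSubgroup V, ∃ j, x ∈ C j := by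
  let B : ℕ → Set (Matrix ι ι ℂ) := fun j => {X | X ∈ V ∧ ∀ k l, ‖X k l‖ ≤ j}
  have hBc : ∀ j, IsCompact (B j) := by
    intro j
    have h1 : IsCompact (Set.univ.pi fun _ : ι => Set.univ.pi fun _ : ι =>
        Metric.closedBall (0 : ℂ) j) :=
      isCompact_univ_pi fun _ => isCompact_univ_pi fun _ => isCompact_closedBall _ _
    have h2 : IsClosed (V : Set (Matrix ι ι ℂ)) := V.closed_of_finiteDimensional
    have h3 : IsCompact (V ∩ Set.univ.pi fun _ : ι => Set.univ.pi fun _ : ι =>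
        Metric.closedBall (0 : ℂ) j : Set (Matrix ι ι ℂ)) := h1.inter_left h2
    convert h3 using 1
    ext X
    exact ⟨fun h => ⟨h.1, fun k _ l _ => by simpa using h.2 k l⟩,
      fun h => ⟨h.1, fun k l => by simpa using h.2 k trivial l trivial⟩⟩
  have hBm : ∀ {i j}, i ≤ j → B i ⊆ B j := fun hij X hX =>
    ⟨hX.1, fun k l => (hX.2 k l).trans (by exact_mod_cast hij)⟩
  have hBn : ∀ j, (expGL '' B j)⁻¹ = expGL '' B j := by
    have key : ∀ j, (expGL '' B j)⁻¹ ⊆ expGL '' B j := by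
      rintro j x ⟨X, hX, hx⟩
      refine ⟨-X, ⟨V.neg_mem hX.1, by simpa using hX.2⟩, ?_⟩
      rw [expGL_neg, hx, inv_inv]
    intro j
    refine (key j).antisymm ?_
    rw [← Set.inv_subset_inv, inv_inv]
    exact key j
  refine ⟨fun p => (expGL '' B p.1) ^ p.2, ?_, ?_, ?_⟩
  · rintro ⟨j, m⟩
    simp only
    induction m with
    | zero => rw [pow_zero]; exact isCompact_singleton
    | succ k ih => rw [pow_succ]; exact ih.mul ((hBc j).image continuous_expGL)
  · rintro ⟨j, m⟩
    simp only
    have h0 : expGL '' B j ⊆ analyticSubgroup V := by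
      rintro _ ⟨X, hX, rfl⟩
      exact expGL_mem_analyticSubgroup hX.1
    induction m with
    | zero => rw [pow_zero]; exact Set.singleton_subset_iff.2 (one_mem _)
    | succ k ih =>
      rw [pow_succ]
      rintro _ ⟨a, ha, b, hb, rfl⟩
      exact mul_mem (ih ha) (h0 hb)
  · intro x hx
    induction hx using Subgroup.closure_induction with
    | mem x hx =>
      obtain ⟨X, hX, rfl⟩ := hx
      obtain ⟨j, hj⟩ := exists_nat_ge (∑ k, ∑ l, ‖X k l‖)
      refine ⟨(j, 1), ?_⟩
      simp only [pow_one]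
      refine ⟨X, ⟨hX, fun k l => le_trans ?_ hj⟩, rfl⟩
      calc ‖X k l‖ ≤ ∑ l, ‖X k l‖ :=
            Finset.single_le_sum (f := fun l => ‖X k l‖) (fun _ _ => norm_nonneg _)
              (Finset.mem_univ l)
        _ ≤ _ := Finset.single_le_sum (f := fun k => ∑ l, ‖X k l‖)
              (fun _ _ => Finset.sum_nonneg fun _ _ => norm_nonneg _) (Finset.mem_univ k)
    | one => exact ⟨(0, 0), by simp⟩
    | mul x y _ _ hx hy =>
      obtain ⟨⟨i, m⟩, hx⟩ := hx
      obtain ⟨⟨j, k⟩, hy⟩ := hy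
      refine ⟨(max i j, m + k), ?_⟩
      simp only [pow_add] at *
      exact Set.mul_mem_mul (Set.pow_subset_pow_left (Set.image_mono (hBm (le_max_left _ _))) hx)
        (Set.pow_subset_pow_left (Set.image_mono (hBm (le_max_right _ _))) hy)
    | inv x _ hx =>
      obtain ⟨⟨i, m⟩, hx⟩ := hx
      refine ⟨(i, m), ?_⟩
      simp only at *
      rw [← hBn, inv_pow, Set.mem_inv, inv_inv]
      exact hx

/-- An analytic subgroup of countable index in a compact group is compact. -/
theorem isCompact_analyticSubgroup {V : Submodule ℝ (Matrix ι ι ℂ)} {S : Subgroup (GL ι ℂ)}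
    (hS : IsCompact (S : Set (GL ι ℂ))) (hle : analyticSubgroup V ≤ S) (c : GL ι ℂ)
    (hc : ∀ s ∈ S, ∃ k : ℤ, ∃ a ∈ analyticSubgroup V, s = c ^ k * a) :
    IsCompact (analyticSubgroup V : Set (GL ι ℂ)) := by
  obtain ⟨C, hC, hCV, hVC⟩ := exists_compact_exhaustion_analyticSubgroup V
  have : CompactSpace S := isCompact_iff_compactSpace.1 hS
  -- The translates of the exhausting sets by powers of `c` are countably many closed sets covering
  -- the compact group `S`. By Baire one has interior, so the analytic subgroup is open in `S`,
  -- hence closed, hence compact.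
  obtain ⟨⟨k, j⟩, s, hs⟩ := nonempty_interior_of_iUnion_of_closed (X := S)
    (f := fun p : ℤ × (ℕ × ℕ) => {s : S | (c ^ p.1)⁻¹ * (s : GL ι ℂ) ∈ C p.2})
    (fun p => (hC p.2).isClosed.preimage (by fun_prop)) (by
      ext s
      simp only [Set.mem_iUnion, Set.mem_univ, iff_true]
      obtain ⟨k, a, ha, hs⟩ := hc s s.2
      obtain ⟨j, hj⟩ := hVC a ha
      exact ⟨(k, j), by simpa [hs] using hj⟩)
  have hopen : IsOpen (((analyticSubgroup V).subgroupOf S : Subgroup S) : Set S) := by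
    refine Subgroup.isOpen_of_mem_nhds _ (g := 1) ?_
    have h1 : (fun x : S => s * x) ⁻¹' interior {s : S | (c ^ k)⁻¹ * (s : GL ι ℂ) ∈ C j} ∈
        𝓝 (1 : S) := (isOpen_interior.preimage (by fun_prop)).mem_nhds (by simpa using hs)
    filter_upwards [h1] with x hx
    have h2 : (c ^ k)⁻¹ * ((s * x : S) : GL ι ℂ) ∈ analyticSubgroup V :=
      hCV (k, j).2 (interior_subset (Set.mem_preimage.1 hx) :)
    have h3 : (c ^ k)⁻¹ * (s : GL ι ℂ) ∈ analyticSubgroup V := hCV (k, j).2 (interior_subset hs :)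
    have h4 := mul_mem (inv_mem h3) h2
    simp only [Subgroup.coe_mul] at h4
    rw [SetLike.mem_coe, Subgroup.mem_subgroupOf]
    convert h4 using 1
    group
  have hcl := Subgroup.isClosed_of_isOpen _ hopen
  have := (hcl.isCompact).image continuous_subtype_val
  convert this using 1
  ext x
  simp only [SetLike.mem_coe, Set.mem_image, Subgroup.mem_subgroupOf, Subtype.exists,
    exists_and_left, exists_prop, exists_eq_right_right]
  exact ⟨fun h => ⟨h, hle h⟩, fun h => h.1⟩

theorem mem_sup_of_commute {G : Type*} [Group G] {A B : Subgroup G}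
    (h : ∀ a ∈ A, ∀ b ∈ B, Commute a b) {x : G} :
    x ∈ A ⊔ B ↔ ∃ a ∈ A, ∃ b ∈ B, x = a * b := by
  have := MonoidHom.noncommCoprod_range A.subtype B.subtype fun a b => h a a.2 b b.2
  rw [Subgroup.range_subtype, Subgroup.range_subtype] at this
  rw [← this]
  constructor
  · rintro ⟨⟨a, b⟩, rfl⟩
    exact ⟨a, a.2, b, b.2, rfl⟩
  · rintro ⟨a, ha, b, hb, rfl⟩
    exact ⟨⟨⟨a, ha⟩, ⟨b, hb⟩⟩, rfl⟩

theorem isCompact_sup_of_commute {A B : Subgroup (GL ι ℂ)}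
    (h : ∀ a ∈ A, ∀ b ∈ B, Commute a b) (hA : IsCompact (A : Set (GL ι ℂ)))
    (hB : IsCompact (B : Set (GL ι ℂ))) : IsCompact ((A ⊔ B : Subgroup _) : Set (GL ι ℂ)) := by
  convert (hA.prod hB).image continuous_mul using 1
  ext x
  rw [SetLike.mem_coe, mem_sup_of_commute h]
  constructor
  · rintro ⟨a, ha, b, hb, rfl⟩
    exact ⟨(a, b), ⟨ha, hb⟩, rfl⟩
  · rintro ⟨⟨a, b⟩, ⟨ha, hb⟩, rfl⟩
    exact ⟨a, ha, b, hb, rfl⟩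

theorem analyticSubgroup_sup {V W : Submodule ℝ (Matrix ι ι ℂ)}
    (h : ∀ X ∈ V, ∀ Y ∈ W, Commute X Y) :
    analyticSubgroup (V ⊔ W) = analyticSubgroup V ⊔ analyticSubgroup W := by
  refine le_antisymm (analyticSubgroup_le fun X hX => ?_)
    (sup_le (analyticSubgroup_mono le_sup_left) (analyticSubgroup_mono le_sup_right))
  obtain ⟨Y, hY, Z, hZ, rfl⟩ := Submodule.mem_sup.1 hX
  rw [expGL_add (h Y hY Z hZ)]
  exact mul_mem (Subgroup.mem_sup_left (expGL_mem_analyticSubgroup hY))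
    (Subgroup.mem_sup_right (expGL_mem_analyticSubgroup hZ))

end Closed

/-! ### The Frobenius form and orthogonal projections -/

section Frobenius

/-- Orthogonal projections for a positive definite symmetric form. -/
theorem LinearMap.BilinForm.exists_projection {M : Type*} [AddCommGroup M] [Module ℝ M]
    [FiniteDimensional ℝ M] (Q : LinearMap.BilinForm ℝ M) (hs : ∀ x y, Q x y = Q y x)
    (hp : ∀ x, x ≠ 0 → 0 < Q x x) (V : Submodule ℝ M) :
    ∃ P : M →ₗ[ℝ] M, (∀ x, P x ∈ V) ∧ ∀ x, ∀ v ∈ V, Q (x - P x) v = 0 := by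
  have hrefl : Q.IsRefl := fun x y h => by rw [hs]; exact h
  have hnd : (Q.restrict V).Nondegenerate := by
    have key : ∀ x : V, (∀ y : V, Q x y = 0) → x = 0 := by
      intro x hx
      by_contra hne
      have := hp x (by simpa using hne)
      rw [hx x] at this
      exact lt_irrefl _ this
    exact ⟨fun x hx => key x hx, fun x hx => key x fun y => by rw [hs]; exact hx y⟩
  have hc := LinearMap.BilinForm.isCompl_orthogonal_of_restrict_nondegenerate hrefl hnd
  refine ⟨V.subtype ∘ₗ V.projectionOnto _ hc, fun x => ?_, fun x v hv => ?_⟩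
  · simp
  · have h1 : x - V.projectionOnto _ hc x ∈ Q.orthogonal V := by
      have h2 : x - V.projectionOnto _ hc x ∈ LinearMap.ker (V.projectionOnto _ hc) := by
        rw [LinearMap.mem_ker, map_sub, Submodule.projectionOnto_apply_left, sub_self]
      rwa [Submodule.ker_projectionOnto] at h2
    rw [hs]
    exact h1 v hv

variable {ι : Type*} [Fintype ι] [DecidableEq ι]

/-- The real part of the Frobenius scalar product `tr (Xᴴ Y)`. -/
noncomputable def frobForm : LinearMap.BilinForm ℝ (Matrix ι ι ℂ) :=
  LinearMap.mk₂ ℝ (fun X Y => (Xᴴ * Y).trace.re)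
    (fun X Y Z => by simp [Matrix.add_mul]) (fun c X Y => by simp)
    (fun X Y Z => by simp [Matrix.mul_add]) (fun c X Y => by simp)

theorem frobForm_apply (X Y : Matrix ι ι ℂ) : frobForm X Y = (Xᴴ * Y).trace.re := rfl

theorem frobForm_comm (X Y : Matrix ι ι ℂ) : frobForm X Y = frobForm Y X := by
  rw [frobForm_apply, frobForm_apply, ← Complex.conj_re, starRingEnd_apply,
    ← Matrix.trace_conjTranspose, Matrix.conjTranspose_mul, Matrix.conjTranspose_conjTranspose]

theorem frobForm_self (X : Matrix ι ι ℂ) : frobForm X X = ∑ i, ∑ j, ‖X i j‖ ^ 2 := by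
  rw [frobForm_apply, Matrix.trace, Complex.re_sum, Finset.sum_comm]
  refine Finset.sum_congr rfl fun j _ => ?_
  rw [Matrix.diag_apply, Matrix.mul_apply, Complex.re_sum]
  refine Finset.sum_congr rfl fun i _ => ?_
  rw [Matrix.conjTranspose_apply, Complex.star_def, ← Complex.normSq_eq_conj_mul_self,
    Complex.ofReal_re, Complex.normSq_eq_norm_sq]

theorem frobForm_pos (X : Matrix ι ι ℂ) (hX : X ≠ 0) : 0 < frobForm X X := by
  rw [frobForm_self]
  obtain ⟨i, j, hij⟩ : ∃ i j, X i j ≠ 0 := by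
    by_contra! h
    exact hX (Matrix.ext h)
  refine Finset.sum_pos' (fun _ _ => Finset.sum_nonneg fun _ _ => by positivity)
    ⟨i, Finset.mem_univ _, Finset.sum_pos' (fun _ _ => by positivity)
    ⟨j, Finset.mem_univ _, by positivity⟩⟩

theorem frobForm_adMat {g : GL ι ℂ} (hg : (g : Matrix ι ι ℂ)ᴴ * (g : Matrix ι ι ℂ) = 1)
    (X Y : Matrix ι ι ℂ) : frobForm (adMat g X) (adMat g Y) = frobForm X Y := by
  have hi : ((g⁻¹ : GL ι ℂ) : Matrix ι ι ℂ) = (g : Matrix ι ι ℂ)ᴴ := by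
    have h1 : (g : Matrix ι ι ℂ) * ((g⁻¹ : GL ι ℂ) : Matrix ι ι ℂ) = 1 := g.mul_inv
    calc ((g⁻¹ : GL ι ℂ) : Matrix ι ι ℂ)
        = ((g : Matrix ι ι ℂ)ᴴ * g) * ((g⁻¹ : GL ι ℂ) : Matrix ι ι ℂ) := by rw [hg, one_mul]
      _ = _ := by rw [mul_assoc, h1, mul_one]
  simp only [frobForm_apply, adMat_apply, hi, Matrix.conjTranspose_mul,
    Matrix.conjTranspose_conjTranspose]
  congr 1
  calc ((g : Matrix ι ι ℂ) * (Xᴴ * (g : Matrix ι ι ℂ)ᴴ) * (g * Y * (g : Matrix ι ι ℂ)ᴴ)).trace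
      = (g * (Xᴴ * ((g : Matrix ι ι ℂ)ᴴ * g) * Y) * (g : Matrix ι ι ℂ)ᴴ).trace := by
        simp only [Matrix.mul_assoc]
    _ = (Xᴴ * Y).trace := by
        rw [hg, Matrix.mul_one, Matrix.trace_mul_comm, ← Matrix.mul_assoc, hg, Matrix.one_mul]

end Frobenius

/-! ### Admissibility and fixed vectors -/

section Admissible

variable {ι : Type*} [Fintype ι] [DecidableEq ι]

/-- `H` preserves both `lieAlg H` and `Q`, hence the orthogonal complement. The difference of the
two sides lies in `lieAlg H` and is orthogonal to it. -/
theorem projection_adMat {H : Subgroup (GL ι ℂ)} {Q : LinearMap.BilinForm ℝ (Matrix ι ι ℂ)}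
    (hp : ∀ X, X ≠ 0 → 0 < Q X X)
    (hinv : ∀ h ∈ H, ∀ X Y, Q (adMat h X) (adMat h Y) = Q X Y)
    {P : Matrix ι ι ℂ →ₗ[ℝ] Matrix ι ι ℂ} (hP : ∀ X, P X ∈ lieAlg H)
    (hPo : ∀ X, ∀ v ∈ lieAlg H, Q (X - P X) v = 0) {h : GL ι ℂ} (hh : h ∈ H)
    (X : Matrix ι ι ℂ) : P (adMat h X) = adMat h (P X) := by
  by_contra hne
  have hd : P (adMat h X) - adMat h (P X) ∈ lieAlg H :=
    Submodule.sub_mem _ (hP _) (adMat_mem_of_mem hh (hP X))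
  have h1 := hPo (adMat h X) _ hd
  have h2 : Q (adMat h X - adMat h (P X)) (P (adMat h X) - adMat h (P X)) = 0 := by
    have := hPo X _ (adMat_mem_of_mem (H.inv_mem hh) hd)
    rwa [← hinv h hh, adMat_adMat_inv, map_sub (adMat h)] at this
  have h3 := hp _ (sub_ne_zero.2 hne)
  have h4 : P (adMat h X) - adMat h (P X) =
      (adMat h X - adMat h (P X)) - (adMat h X - P (adMat h X)) := by abel
  have h5 : Q (P (adMat h X) - adMat h (P X)) (P (adMat h X) - adMat h (P X)) = 0 := by
    conv_lhs => enter [1]; rw [h4, map_sub]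
    rw [LinearMap.sub_apply, h1, h2, sub_zero]
  exact h3.ne' h5

/-- A vector of the orthogonal complement of the Lie algebra that is fixed by `H`. -/
theorem exists_fixed_orthogonal {G H : Subgroup (GL ι ℂ)} (hHG : H ≤ G)
    {Q : LinearMap.BilinForm ℝ (Matrix ι ι ℂ)} (hs : ∀ X Y, Q X Y = Q Y X)
    (hp : ∀ X, X ≠ 0 → 0 < Q X X)
    (hinv : ∀ h ∈ H, ∀ X Y, Q (adMat h X) (adMat h Y) = Q X Y) {X : Matrix ι ι ℂ}
    (hXG : X ∈ lieAlg G) (hXH : X ∉ lieAlg H) (hfix : ∀ h ∈ H, adMat h X = X) :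
    ∃ X₀ ∈ lieAlg G, X₀ ≠ 0 ∧ X - X₀ ∈ lieAlg H ∧ (∀ Y ∈ lieAlg H, Q X₀ Y = 0) ∧
      ∀ h ∈ H, adMat h X₀ = X₀ := by
  obtain ⟨P, hP, hPo⟩ := Q.exists_projection hs hp (lieAlg H)
  refine ⟨X - P X, Submodule.sub_mem _ hXG (lieAlg_mono hHG (hP X)), fun h => hXH ?_, ?_,
    hPo X, fun h hh => ?_⟩
  · rw [sub_eq_zero.1 h]; exact hP X
  · simpa using hP X
  · rw [map_sub, hfix h hh, ← projection_adMat hp hinv hP hPo hh, hfix h hh]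

/-- Take the scalar product that `Q` induces on `𝔤/𝔥` and reverse its sign along a fixed vector `X₀`
orthogonal to `𝔥`. In left-invariant coordinates the resulting invariant metric is constant in `x`.
A general `Q` is allowed because `H` need not consist of unitary matrices. -/
theorem isAdmissible_of_fixed {G H : Subgroup (GL ι ℂ)} (hHG : H ≤ G)
    (hc : IsCompact (H : Set (GL ι ℂ))) (hconn : IsConnectedLieSubgroup H)
    {Q : LinearMap.BilinForm ℝ (Matrix ι ι ℂ)} (hs : ∀ X Y, Q X Y = Q Y X)
    (hp : ∀ X, X ≠ 0 → 0 < Q X X)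
    (hinv : ∀ h ∈ H, ∀ X Y, Q (adMat h X) (adMat h Y) = Q X Y) {X : Matrix ι ι ℂ}
    (hXG : X ∈ lieAlg G) (hXH : X ∉ lieAlg H) (hfix : ∀ h ∈ H, adMat h X = X) :
    IsAdmissible G H := by
  obtain ⟨P, hP, hPo⟩ := Q.exists_projection hs hp (lieAlg H)
  obtain ⟨X₀, hX₀G, hX₀, -, hX₀H, hX₀f⟩ :=
    exists_fixed_orthogonal hHG hs hp hinv hXG hXH hfix
  have hpos := hp X₀ hX₀
  let R : Matrix ι ι ℂ →ₗ[ℝ] Matrix ι ι ℂ := LinearMap.id - P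
  have hRa : ∀ Y, R Y = Y - P Y := fun _ => rfl
  have hR0 : ∀ Y ∈ lieAlg H, R Y = 0 := by
    intro Y hY
    by_contra hne
    have h1 : R Y ∈ lieAlg H := Submodule.sub_mem _ hY (hP Y)
    have h2 := hPo Y _ h1
    exact absurd (hp _ hne) (by rw [hRa] at *; rw [h2]; exact lt_irrefl _)
  have hRn : ∀ Y, Y ∉ lieAlg H → R Y ≠ 0 := by
    intro Y hY h
    rw [hRa, sub_eq_zero] at h
    exact hY (h ▸ hP Y)
  have hRX : Q (R X₀) (R X₀) = Q X₀ X₀ := by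
    have h1 : Q X₀ (P X₀) = 0 := hX₀H _ (hP _)
    have h2 : P X₀ = 0 := by
      by_contra hne
      have h3 := hPo X₀ _ (hP X₀)
      rw [map_sub, LinearMap.sub_apply, h1] at h3
      have := hp _ hne
      linarith
    rw [hRa, h2, sub_zero]
  have hRh : ∀ h ∈ H, ∀ Y, R (adMat h Y) = adMat h (R Y) := by
    intro h hh Y
    rw [hRa, hRa, projection_adMat hp hinv hP hPo hh, map_sub]
  -- The factor `2` yields `B X₀ X₀ = -Q X₀ X₀` and keeps the `B`-orthogonal of `X₀` equal to its
  -- `Q`-orthogonal, where `B` and the projected `Q` agree.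
  let c := 2 / Q X₀ X₀
  let B : LinearMap.BilinForm ℝ (Matrix ι ι ℂ) := LinearMap.mk₂ ℝ
    (fun Y Z => Q (R Y) (R Z) - c * (Q X₀ Y * Q X₀ Z))
    (fun Y Y' Z => by simp only [map_add, LinearMap.add_apply]; ring)
    (fun a Y Z => by simp only [map_smul, LinearMap.smul_apply, smul_eq_mul]; ring)
    (fun Y Z Z' => by simp only [map_add]; ring)
    (fun a Y Z => by simp only [map_smul, smul_eq_mul]; ring)
  have hB : ∀ Y Z, B Y Z = Q (R Y) (R Z) - c * (Q X₀ Y * Q X₀ Z) := fun _ _ => rfl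
  refine ⟨hHG, hc, hconn, ⟨fun _ => B.restrict (lieAlg G), fun Y Z x => ⟨fun _ => B Y Z,
    contDiff_const, Filter.Eventually.of_forall fun _ => rfl⟩, ?_, ?_, ?_, ?_⟩, ?_⟩
  · intro _ Y Z
    change B Y Z = B Z Y
    rw [hB, hB, hs (R (Y : Matrix ι ι ℂ)), mul_comm (Q X₀ Y)]
  · intro _ Y hY Z
    change B Y Z = 0
    rw [hB, hR0 _ hY, hX₀H _ hY]
    simp
  · intro _ h hh Y Z
    change B (adMat ((h⁻¹ : G) : GL ι ℂ) Y) (adMat ((h⁻¹ : G) : GL ι ℂ) Z) = B Y Z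
    have hh' : ((h⁻¹ : G) : GL ι ℂ) ∈ H := H.inv_mem hh
    have h1 : ∀ W, Q X₀ (adMat ((h⁻¹ : G) : GL ι ℂ) W) = Q X₀ W := by
      intro W
      conv_lhs => rw [← hX₀f _ hh']
      rw [hinv _ hh']
    rw [hB, hB, hRh _ hh', hRh _ hh', hinv _ hh', h1, h1]
  · intro _
    refine ⟨⟨X₀, hX₀G⟩, ?_, ?_⟩
    · change B X₀ X₀ < 0
      rw [hB, hRX]
      have : c * (Q X₀ X₀ * Q X₀ X₀) = 2 * Q X₀ X₀ := by simp only [c]; field_simp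
      rw [this]; linarith
    · intro w hw hwH
      change B X₀ w = 0 at hw
      change 0 < B w w
      have h1 : Q (R X₀) (R w) = Q X₀ w := by
        have e1 : Q (P X₀) (R w) = 0 := by rw [hs]; exact hPo w _ (hP _)
        have e2 : Q X₀ (P w) = 0 := hX₀H _ (hP _)
        rw [hRa X₀, map_sub, LinearMap.sub_apply, e1, hRa, map_sub, e2, sub_zero, sub_zero]
      rw [hB, h1] at hw
      have h2 : c * (Q X₀ X₀ * Q X₀ w) = 2 * Q X₀ w := by simp only [c]; field_simp
      have h3 : Q X₀ w = 0 := by rw [h2] at hw; linarith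
      rw [hB, h3]
      have := hp _ (hRn _ hwH)
      simpa using this
  · intro _ _; rfl

theorem LinearMap.BilinForm.continuous_self {F : Type*} [NormedAddCommGroup F] [NormedSpace ℝ F]
    [FiniteDimensional ℝ F] (B : LinearMap.BilinForm ℝ F) : Continuous fun x => B x x := by
  have h1 : Continuous ((LinearMap.toContinuousLinearMap (𝕜 := ℝ) (E := F) (F' := ℝ)).toLinearMap ∘ₗ
      B) := LinearMap.continuous_of_finiteDimensional _
  exact h1.clm_apply continuous_id

/-- This is `exists_fixed_line` for the quadratic function `-B`, the functional `B v` and the norm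
of `Q`: common isometries of `B` and `Q` preserve one timelike line. -/
theorem LinearMap.BilinForm.exists_timelike_line {F : Type*} [AddCommGroup F]
    [Module ℝ F] [FiniteDimensional ℝ F] (B Q : LinearMap.BilinForm ℝ F)
    (hQs : ∀ x y, Q x y = Q y x) (hQp : ∀ x, x ≠ 0 → 0 < Q x x) {v : F}
    (hv : B v v < 0) (hvl : ∀ w, B v w = 0 → w ≠ 0 → 0 < B w w) :
    ∃ x, B x x < 0 ∧ ∀ g : F → F, (∀ y, B (g y) (g y) = B y y) → (∀ y, Q (g y) (g y) = Q y y) →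
      ∃ c : ℝ, g x = c • x := by
  let core : InnerProductSpace.Core ℝ F :=
    { inner := fun x y => Q x y
      conj_inner_symm := fun x y => by simp [hQs x y]
      re_inner_nonneg := fun x => by
        by_cases h : x = 0
        · simp [h]
        · exact (hQp x h).le
      add_left := fun x y z => by simp
      smul_left := fun x y r => by simp
      definite := fun x h => by
        by_contra hx
        exact (hQp x hx).ne' h }
  let : NormedAddCommGroup F := core.toNormedAddCommGroup
  let : InnerProductSpace ℝ F := InnerProductSpace.ofCore core.toCore
  have hnorm : ∀ x : F, ‖x‖ ^ 2 = Q x x := fun x => (real_inner_self_eq_norm_sq x).symm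
  have : ProperSpace F := FiniteDimensional.proper_real F
  obtain ⟨x, hx, hxf⟩ := exists_fixed_line (𝕜 := ℝ) (B v) (fun x => -B x x) (fun x => ‖x‖)
    B.continuous_self.neg continuous_norm
    (fun c x => by simp; ring) (fun x y => by simp; ring)
    (fun x h1 h2 => by simpa using hvl x h1 h2) ⟨v, by simpa using hv⟩
    (fun c x => norm_smul c x) norm_add_le (fun _ => le_rfl)
  refine ⟨x, by simpa using hx, fun g h1 h2 => hxf g (fun y => by rw [h1]) fun y => ?_⟩
  rw [← sq_eq_sq₀ (norm_nonneg _) (norm_nonneg _), hnorm, hnorm, h2]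

/-- For a group of unitary matrices, an invariant Lorentzian metric yields a fixed vector. -/
theorem IsAdmissible.exists_fixed {G H : Subgroup (GL ι ℂ)} (hH : IsAdmissible G H)
    (hU : ∀ h ∈ H, (h : Matrix ι ι ℂ)ᴴ * (h : Matrix ι ι ℂ) = 1) :
    ∃ X ∈ lieAlg G, X ∉ lieAlg H ∧ ∀ h ∈ H, adMat h X = X := by
  obtain ⟨hHG, -, hconn, m, hm⟩ := hH
  obtain ⟨P, hP, hPo⟩ := frobForm.exists_projection frobForm_comm frobForm_pos (lieAlg H)
  set B : LinearMap.BilinForm ℝ (lieAlg G) := m.form 1 with hBdef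
  have hBinv : ∀ h : G, (h : GL ι ℂ) ∈ H → ∀ X Y,
      B (adGroup G h X) (adGroup G h Y) = B X Y := by
    intro h hh X Y
    have := m.right_inv 1 h⁻¹ (H.inv_mem hh) X Y
    have h1 : m.form (1 * h⁻¹) = m.form 1 := by
      have := hm h⁻¹ 1
      simpa using this
    rw [h1, inv_inv] at this
    exact this
  -- The Frobenius complement of `𝔥` in `𝔤` models `𝔤/𝔥`: the metric is nondegenerate there, and `H`
  -- acts by isometries of both forms.
  let E : Submodule ℝ (lieAlg G) :=
    { carrier := {X | ∀ Y ∈ lieAlg H, frobForm (X : Matrix ι ι ℂ) Y = 0}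
      zero_mem' := by simp
      add_mem' := fun {a b} ha hb Y hY => by simp [ha Y hY, hb Y hY]
      smul_mem' := fun c a ha Y hY => by simp [ha Y hY] }
  have hE : ∀ X : lieAlg G, X ∈ E ↔ ∀ Y ∈ lieAlg H, frobForm (X : Matrix ι ι ℂ) Y = 0 :=
    fun X => Iff.rfl
  obtain ⟨v, hv, hvl⟩ := m.lorentzian 1
  have hadE : ∀ h : G, (h : GL ι ℂ) ∈ H → ∀ X ∈ E, adGroup G h X ∈ E := by
    intro h hh X hX
    rw [hE] at hX ⊢
    intro Y hY
    have h1 := hX _ (adMat_mem_of_mem (H.inv_mem hh) hY)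
    rw [← frobForm_adMat (hU _ hh), adMat_adMat_inv] at h1
    exact h1
  have hPv : P v ∈ lieAlg G := lieAlg_mono hHG (hP _)
  have e1 : ∀ Z, B ⟨P v, hPv⟩ Z = 0 := m.vertical 1 _ (hP _)
  have e2 : ∀ Z, B Z ⟨P v, hPv⟩ = 0 := fun Z => by rw [hBdef, m.symm]; exact e1 Z
  have hv₀E : v - ⟨P v, hPv⟩ ∈ E := by
    rw [hE]
    intro Y hY
    exact hPo v Y hY
  obtain ⟨v₀, hv₀d⟩ : ∃ v₀ : E, (v₀ : lieAlg G) = v - ⟨P v, hPv⟩ := ⟨⟨_, hv₀E⟩, rfl⟩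
  have hv₀ : ∀ Z, B v₀ Z = B v Z := fun Z => by
    rw [hv₀d, map_sub, LinearMap.sub_apply, e1, sub_zero]
  have hv₀' : B v₀ v₀ < 0 := by
    rw [hv₀, hv₀d, map_sub, e2, sub_zero]
    exact hv
  obtain ⟨X, hX, hXf⟩ := (B.restrict E).exists_timelike_line
    ((frobForm.restrict (lieAlg G)).restrict E) (fun x y => frobForm_comm _ _)
    (fun x hx => frobForm_pos _ fun h => hx (Subtype.ext (Subtype.ext h))) (v := v₀) hv₀' (fun w hw hw0 => by
    refine hvl w ((hv₀ w).symm.trans hw) fun h => ?_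
    have h1 := (hE _).1 w.2 _ h
    refine absurd (frobForm_pos ((w : lieAlg G) : Matrix ι ι ℂ) fun h2 => hw0 ?_)
      (by rw [h1]; exact lt_irrefl _)
    exact Subtype.ext (Subtype.ext h2))
  replace hX : B X X < 0 := hX
  have hfix : ∀ h : G, (h : GL ι ℂ) ∈ H → ∃ c : ℝ, c ^ 2 = 1 ∧
      adMat (h : GL ι ℂ) (X : lieAlg G) = c • ((X : lieAlg G) : Matrix ι ι ℂ) := by
    intro h hh
    obtain ⟨c, hc⟩ := hXf (fun Y => ⟨adGroup G h Y, hadE h hh _ Y.2⟩)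
      (fun Y => hBinv h hh Y Y) (fun Y => frobForm_adMat (hU _ hh) _ _)
    have hc' : adGroup G h X = c • (X : lieAlg G) := congrArg Subtype.val hc
    refine ⟨c, ?_, congrArg Subtype.val hc'⟩
    have h1 := hBinv h hh X X
    rw [hc'] at h1
    simp only [map_smul, LinearMap.smul_apply, smul_eq_mul] at h1
    have h2 : B X X ≠ 0 := by exact hX.ne
    have h3 : (c ^ 2 - 1) * B X X = 0 := by linarith
    have := (mul_eq_zero.1 h3).resolve_right h2
    linarith
  refine ⟨X, (X : lieAlg G).2, fun h => ?_, fun h hh => ?_⟩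
  · have : B X X = 0 := m.vertical 1 _ h _
    exact hX.ne this
  · rw [adMat_eq_self_iff, ← mem_commutantGroup]
    refine hconn.le_of_lieAlg_le (fun Y hY => ?_) hh
    rw [mem_commutantGroup, ← adMat_eq_self_iff]
    -- An element of `H` acts on the timelike line by a sign. An exponential is the square of `exp
    -- (Y / 2)`, so it acts trivially, and exponentials generate `H`.
    have h1 := hconn.1 Y hY (1 / 2)
    obtain ⟨c, hc, hc'⟩ := hfix ⟨_, hHG h1⟩ h1
    simp only at hc'
    have h2 : expGL Y = expGL ((1 / 2 : ℝ) • Y) * expGL ((1 / 2 : ℝ) • Y) := by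
      rw [← expGL_add_smul]; norm_num
    rw [h2, adMat_mul, hc', map_smul, hc', smul_smul, ← sq, hc, one_smul]

end Admissible

/-! ### Logarithms of unitary matrices -/

section Log

variable {ι : Type*} [Fintype ι] [DecidableEq ι]

open scoped Matrix.Norms.L2Operator in
-- Functional calculus with the principal logarithm. The spectrum is finite, so the branch cut does
-- no harm, and the functional calculus preserves commutation.
theorem Matrix.exists_skew_log {g : Matrix ι ι ℂ} (hg : gᴴ * g = 1) :
    ∃ Y : Matrix ι ι ℂ, Yᴴ = -Y ∧ NormedSpace.exp Y = g ∧
      ∀ A, Commute g A → Commute Y A := by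
  have hu : g ∈ unitary (Matrix ι ι ℂ) := Matrix.mem_unitaryGroup_iff'.2 hg
  have hn : IsStarNormal g := ⟨by
    rw [Commute, SemiconjBy, (Unitary.mem_iff.1 hu).1, (Unitary.mem_iff.1 hu).2]⟩
  have hfin : (spectrum ℂ g).Finite := Matrix.finite_spectrum g
  have hco : ∀ f : ℂ → ℂ, ContinuousOn f (spectrum ℂ g) := fun f => hfin.continuousOn f
  have hnorm : ∀ z ∈ spectrum ℂ g, ‖z‖ = 1 := fun z hz => by
    simpa using spectrum.subset_circle_of_unitary hu hz
  have hne : ∀ z ∈ spectrum ℂ g, z ≠ 0 := fun z hz h => by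
    have := hnorm z hz
    simp [h] at this
  refine ⟨cfc Complex.log g, ?_, ?_, fun A hA => ?_⟩
  · have h1 := hco Complex.log
    rw [← Matrix.star_eq_conjTranspose, ← cfc_star, ← cfc_neg]
    refine cfc_congr fun z hz => ?_
    apply Complex.ext <;> simp [Complex.log_re, hnorm z hz]
  · have h1 := hco Complex.log
    rw [← CFC.complex_exp_eq_normedSpace_exp, ← cfc_comp' Complex.exp Complex.log g]
    conv_rhs => rw [← cfc_id ℂ g]
    exact cfc_congr fun z hz => Complex.exp_log (hne z hz)
  · refine hA.cfc ?_ _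
    have h1 : g * gᴴ = 1 := mul_eq_one_comm.1 hg
    rw [Matrix.star_eq_conjTranspose, Commute, SemiconjBy]
    calc gᴴ * A = gᴴ * A * (g * gᴴ) := by rw [h1, mul_one]
      _ = gᴴ * (A * g) * gᴴ := by simp only [mul_assoc]
      _ = gᴴ * (g * A) * gᴴ := by rw [hA.eq]
      _ = (gᴴ * g) * A * gᴴ := by simp only [mul_assoc]
      _ = A * gᴴ := by rw [hg, one_mul]

end Log

/-! ### One-parameter groups -/

section OneParameter

variable {ι : Type*} [Fintype ι] [DecidableEq ι]

theorem mem_analyticSubgroup_span {X : Matrix ι ι ℂ} {x : GL ι ℂ} :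
    x ∈ analyticSubgroup (Submodule.span ℝ {X}) ↔ ∃ t : ℝ, x = expGL (t • X) := by
  constructor
  · intro hx
    induction hx using Subgroup.closure_induction with
    | mem x hx =>
      obtain ⟨Y, hY, rfl⟩ := hx
      obtain ⟨t, rfl⟩ := Submodule.mem_span_singleton.1 hY
      exact ⟨t, rfl⟩
    | one => exact ⟨0, by simp⟩
    | mul x y _ _ hx hy =>
      obtain ⟨s, rfl⟩ := hx
      obtain ⟨t, rfl⟩ := hy
      exact ⟨s + t, (expGL_add_smul s t X).symm⟩
    | inv x _ hx =>
      obtain ⟨s, rfl⟩ := hx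
      exact ⟨-s, by rw [neg_smul, expGL_neg]⟩
  · rintro ⟨t, rfl⟩
    exact expGL_mem_analyticSubgroup
      (Submodule.smul_mem _ _ (Submodule.mem_span_singleton_self X))

theorem isCompact_analyticSubgroup_span {X : Matrix ι ι ℂ} {T : ℝ} (hT : T ≠ 0)
    (hX : expGL (T • X) = 1) :
    IsCompact (analyticSubgroup (Submodule.span ℝ {X}) : Set (GL ι ℂ)) := by
  have hc : Continuous fun t : ℝ => expGL ((t * T) • X) :=
    continuous_expGL.comp (by fun_prop)
  convert (isCompact_Icc (a := (0 : ℝ)) (b := 1)).image hc using 1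
  ext x
  rw [SetLike.mem_coe, mem_analyticSubgroup_span]
  constructor
  · rintro ⟨t, rfl⟩
    refine ⟨Int.fract (t / T), ⟨Int.fract_nonneg _, (Int.fract_lt_one _).le⟩, ?_⟩
    have h1 : t = (Int.fract (t / T)) * T + (⌊t / T⌋ : ℝ) * T := by
      rw [← add_mul, add_comm, Int.floor_add_fract, div_mul_cancel₀ _ hT]
    simp only
    conv_rhs => rw [h1]
    rw [expGL_add_smul, mul_smul (⌊t / T⌋ : ℝ), expGL_int_smul, hX, one_zpow, mul_one]
  · rintro ⟨t, -, rfl⟩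
    exact ⟨_, rfl⟩

theorem Matrix.commute_diagonal_iff {A : Matrix ι ι ℂ} {d : ι → ℂ} :
    Commute A (Matrix.diagonal d) ↔ ∀ i j, A i j ≠ 0 → d i = d j := by
  rw [Commute, SemiconjBy, ← Matrix.ext_iff]
  simp only [Matrix.mul_diagonal, Matrix.diagonal_mul]
  refine forall₂_congr fun i j => ?_
  constructor
  · intro h hA
    rw [mul_comm] at h
    exact (mul_right_cancel₀ hA h).symm
  · intro h
    by_cases hA : A i j = 0
    · simp [hA]
    · rw [h hA, mul_comm]

theorem isCompact_unitaryGL : IsCompact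
    {g : GL ι ℂ | (g : Matrix ι ι ℂ)ᴴ * (g : Matrix ι ι ℂ) = 1} := by
  have hc : IsCompact {A : Matrix ι ι ℂ | Aᴴ * A = 1} := by
    have h1 : IsCompact (Set.univ.pi fun _ : ι => Set.univ.pi fun _ : ι =>
        Metric.closedBall (0 : ℂ) 1) :=
      isCompact_univ_pi fun _ => isCompact_univ_pi fun _ => isCompact_closedBall _ _
    have h2 : IsClosed {A : Matrix ι ι ℂ | Aᴴ * A = 1} :=
      isClosed_eq (by fun_prop) continuous_const
    refine h1.of_isClosed_subset h2 fun A hA i _ j _ => ?_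
    have h3 : A ∈ Matrix.unitaryGroup ι ℂ := Matrix.mem_unitaryGroup_iff'.2 hA
    simpa using entry_norm_bound_of_unitary h3 i j
  have hcs : CompactSpace {A : Matrix ι ι ℂ | Aᴴ * A = 1} := isCompact_iff_compactSpace.1 hc
  -- The topology of `GL` also controls the inverse; for unitary matrices this is the conjugate
  -- transpose, which is continuous.
  let f : {A : Matrix ι ι ℂ | Aᴴ * A = 1} → GL ι ℂ := fun A =>
    ⟨A, (A : Matrix ι ι ℂ)ᴴ, mul_eq_one_comm.1 A.2, A.2⟩
  have hf : Continuous f := by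
    rw [Units.continuous_iff]
    exact ⟨continuous_subtype_val, continuous_subtype_val.matrix_conjTranspose⟩
  convert isCompact_range hf using 1
  ext g
  constructor
  · intro hg
    exact ⟨⟨g, hg⟩, Units.ext rfl⟩
  · rintro ⟨A, rfl⟩
    exact A.2

theorem isClosed_commutantGroup (A : Matrix ι ι ℂ) :
    IsClosed (commutantGroup A : Set (GL ι ℂ)) :=
  isClosed_eq (f := fun g : GL ι ℂ => (g : Matrix ι ι ℂ) * A) (g := fun g => A * g)
    (Units.continuous_val.mul continuous_const) (continuous_const.mul Units.continuous_val)

theorem isClosed_specialUnitaryOf (J : Matrix ι ι ℂ) :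
    IsClosed (specialUnitaryOf J : Set (GL ι ℂ)) := by
  have h1 : Continuous fun g : GL ι ℂ => (g : Matrix ι ι ℂ) := Units.continuous_val
  exact (isClosed_eq ((h1.matrix_conjTranspose.mul continuous_const).mul h1)
    continuous_const).inter (isClosed_eq h1.matrix_det continuous_const)

theorem trace_eq_zero_of_det_exp {X : Matrix ι ι ℂ} (hX : Xᴴ = -X)
    (h : ∀ t : ℝ, (NormedSpace.exp (t • X)).det = 1) : X.trace = 0 := by
  refine Complex.eq_zero_of_exp_smul fun t => ?_
  have h1 : (t • X)ᴴ = -(t • X) := by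
    rw [Matrix.conjTranspose_smul, hX]; simp
  have h2 := h t
  rw [Matrix.det_exp_of_skew h1, Matrix.trace_smul] at h2
  simpa using h2

theorem exp_unitary_of_skew {X : Matrix ι ι ℂ} (hX : Xᴴ = -X) :
    (NormedSpace.exp X)ᴴ * NormedSpace.exp X = 1 := by
  rw [← Matrix.exp_conjTranspose, hX, ← Matrix.exp_add_of_commute _ _ (Commute.neg_left (Commute.refl X))]
  simp

theorem smul_skew {κ : Type*} {X : Matrix κ κ ℂ} (hX : Xᴴ = -X) (t : ℝ) : (t • X)ᴴ = -(t • X) := by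
  rw [Matrix.conjTranspose_smul, hX]; simp

theorem skew_of_exp_unitary {X : Matrix ι ι ℂ}
    (h : ∀ t : ℝ, (NormedSpace.exp (t • X))ᴴ * NormedSpace.exp (t • X) = 1) : Xᴴ = -X := by
  have := Matrix.skew_of_exp (J := 1) (X := X) (by simpa using h)
  rw [mul_one, one_mul] at this
  exact eq_neg_of_add_eq_zero_left this

end OneParameter

/-! ### The maximal compact subgroup of `SU_{1,n}` -/

section Unitary

variable {n : ℕ}

theorem mem_SUn {g : GL (Fin n) ℂ} : g ∈ SUn n ↔
    (g : Matrix (Fin n) (Fin n) ℂ)ᴴ * (g : Matrix (Fin n) (Fin n) ℂ) = 1 ∧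
      (g : Matrix (Fin n) (Fin n) ℂ).det = 1 := by
  change _ * _ * _ = _ ∧ _ ↔ _
  rw [mul_one]

/-- The real vector space of traceless skew-Hermitian matrices. -/
def suSpace (ι : Type*) [Fintype ι] : Submodule ℝ (Matrix ι ι ℂ) where
  carrier := {X | Xᴴ = -X ∧ X.trace = 0}
  zero_mem' := by simp
  add_mem' := by
    rintro X Y ⟨h1, h2⟩ ⟨h3, h4⟩
    exact ⟨by rw [Matrix.conjTranspose_add, h1, h3, neg_add], by rw [Matrix.trace_add, h2, h4, add_zero]⟩
  smul_mem' := by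
    rintro c X ⟨h1, h2⟩
    exact ⟨by rw [Matrix.conjTranspose_smul, h1]; simp, by rw [Matrix.trace_smul, h2, smul_zero]⟩

theorem mem_suSpace {ι : Type*} [Fintype ι] {X : Matrix ι ι ℂ} :
    X ∈ suSpace ι ↔ Xᴴ = -X ∧ X.trace = 0 := Iff.rfl

theorem lieAlg_SUn : lieAlg (SUn n) = suSpace (Fin n) := by
  refine le_antisymm (lieAlg_le_of_forall fun X hX => ?_) fun X hX => mem_lieAlg_of_forall fun t => ?_
  · have h1 : Xᴴ = -X := skew_of_exp_unitary fun t => (mem_SUn.1 (hX t)).1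
    exact ⟨h1, trace_eq_zero_of_det_exp h1 fun t => (mem_SUn.1 (hX t)).2⟩
  · rw [mem_SUn, coe_expGL]
    have h1 := (suSpace (Fin n)).smul_mem t hX
    exact ⟨exp_unitary_of_skew h1.1, by rw [Matrix.det_exp_of_skew h1.1, h1.2, Complex.exp_zero]⟩

/-- The Gram matrix `diag(-1, 1, …, 1)`. -/
def lorentzJ (n : ℕ) : Matrix (Unit ⊕ Fin n) (Unit ⊕ Fin n) ℂ :=
  Matrix.diagonal (Sum.elim (fun _ => -1) fun _ => 1)

theorem lorentzJ_eq : lorentzJ n = Matrix.fromBlocks (-1) 0 0 1 := by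
  rw [lorentzJ, ← Matrix.fromBlocks_diagonal]
  congr 1

theorem lorentzJ_mul_self : lorentzJ n * lorentzJ n = 1 := by
  rw [lorentzJ, Matrix.diagonal_mul_diagonal, ← Matrix.diagonal_one]
  congr 1
  ext (i | i) <;> simp

theorem mem_SU1n {g : GL (Unit ⊕ Fin n) ℂ} : g ∈ SU1n n ↔
    g.valᴴ * lorentzJ n * g.val = lorentzJ n ∧
      g.val.det = 1 := by
  rw [lorentzJ_eq]; rfl

/-- The maximal compact subgroup `S(U_1 × U_n)` of `SU_{1,n}`. -/
def compactUn (n : ℕ) : Subgroup (GL (Unit ⊕ Fin n) ℂ) := SU1n n ⊓ commutantGroup (lorentzJ n)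

/-- On the commutant of `lorentzJ`, whose square is `1`, preserving the indefinite form and being
unitary are the same condition. -/
theorem mem_compactUn {g : GL (Unit ⊕ Fin n) ℂ} : g ∈ compactUn n ↔
    g.valᴴ * g.val = 1 ∧ g.val.det = 1 ∧
      Commute g.val (lorentzJ n) := by
  have hJ := lorentzJ_mul_self (n := n)
  constructor
  · intro h
    obtain ⟨h1, h2⟩ := Subgroup.mem_inf.1 h
    rw [mem_SU1n] at h1
    rw [mem_commutantGroup] at h2
    refine ⟨?_, h1.2, h2⟩
    have := h1.1
    rw [mul_assoc, ← h2.eq, ← mul_assoc] at this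
    calc g.valᴴ * g.val
        = g.valᴴ * g.val * lorentzJ n * lorentzJ n := by
          rw [mul_assoc _ (lorentzJ n), hJ, mul_one]
      _ = 1 := by rw [this, hJ]
  · rintro ⟨h1, h2, h3⟩
    refine ⟨mem_SU1n.2 ⟨?_, h2⟩, h3⟩
    rw [mul_assoc, ← h3.eq, ← mul_assoc, h1, one_mul]

theorem compactUn_unitary {H : Subgroup (GL (Unit ⊕ Fin n) ℂ)} (hH : H ≤ compactUn n) :
    ∀ h ∈ H, h.valᴴ * h.val = 1 := fun _ hh =>
  (mem_compactUn.1 (hH hh)).1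

theorem isClosed_compactUn : IsClosed (compactUn n : Set (GL (Unit ⊕ Fin n) ℂ)) :=
  (isClosed_specialUnitaryOf _).inter (isClosed_commutantGroup _)

theorem isCompact_compactUn : IsCompact (compactUn n : Set (GL (Unit ⊕ Fin n) ℂ)) :=
  isCompact_unitaryGL.of_isClosed_subset isClosed_compactUn fun _ hg => (mem_compactUn.1 hg).1

theorem mem_lieAlg_compactUn {X : Matrix (Unit ⊕ Fin n) (Unit ⊕ Fin n) ℂ} :
    X ∈ lieAlg (compactUn n) ↔ Xᴴ = -X ∧ X.trace = 0 ∧ Commute X (lorentzJ n) := by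
  constructor
  · intro hX
    have h1 : lieAlg (compactUn n) ≤ suSpace _ := lieAlg_le_of_forall fun X hX => by
      have h1 : Xᴴ = -X := skew_of_exp_unitary fun t => (mem_compactUn.1 (hX t)).1
      exact ⟨h1, trace_eq_zero_of_det_exp h1 fun t => (mem_compactUn.1 (hX t)).2.1⟩
    have h2 : lieAlg (compactUn n) ≤ LinearMap.ker
        (LinearMap.mulRight ℝ (lorentzJ n) - LinearMap.mulLeft ℝ (lorentzJ n)) :=
      lieAlg_le_of_forall fun X hX => by
        have := commute_of_expGL_mem_commutantGroup fun t => (Subgroup.mem_inf.1 (hX t)).2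
        simp [this.eq]
    have h3 := h2 hX
    rw [LinearMap.mem_ker, LinearMap.sub_apply, sub_eq_zero] at h3
    exact ⟨(h1 hX).1, (h1 hX).2, h3⟩
  · rintro ⟨h1, h2, h3⟩
    refine mem_lieAlg_of_forall fun t => ?_
    rw [mem_compactUn, coe_expGL]
    refine ⟨exp_unitary_of_skew (smul_skew h1 t), ?_, (h3.smul_left t).exp_left⟩
    rw [Matrix.det_exp_of_skew (smul_skew h1 t), Matrix.trace_smul, h2, smul_zero,
      Complex.exp_zero]

theorem lieAlg_compactUn_le : lieAlg (compactUn n) ≤ lieAlg (SU1n n) := lieAlg_mono inf_le_left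

end Unitary

/-! ### Compact subgroups of `SU_{1,n}` are conjugate to subgroups of `S(U_1 × U_n)` -/

section Cartan

variable {n : ℕ}

/-- The function `|x₀|² - |x₁|² - … - |xₙ|²`. -/
noncomputable def lorentzQ (x : Unit ⊕ Fin n → ℂ) : ℝ :=
  ‖x (Sum.inl ())‖ ^ 2 - ∑ j, ‖x (Sum.inr j)‖ ^ 2

theorem star_dotProduct_lorentzJ (x : Unit ⊕ Fin n → ℂ) :
    star x ⬝ᵥ (lorentzJ n *ᵥ x) = -(lorentzQ x : ℂ) := by
  simp only [dotProduct, lorentzJ, Matrix.mulVec_diagonal, Fintype.sum_sum_type, lorentzQ,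
    Pi.star_apply, Sum.elim_inl, Sum.elim_inr, Finset.univ_unique, Finset.sum_singleton]
  push_cast
  have h : ∀ z : ℂ, star z * z = (‖z‖ : ℂ) ^ 2 := fun z => by
    rw [Complex.star_def, Complex.conj_mul']
  simp only [neg_mul, one_mul, mul_neg, h]
  exact (neg_add_eq_sub _ _).trans (neg_sub _ _).symm

theorem lorentzQ_mulVec {g : GL (Unit ⊕ Fin n) ℂ} (hg : g ∈ SU1n n) (x : Unit ⊕ Fin n → ℂ) :
    lorentzQ (g.val *ᵥ x) = lorentzQ x := by
  have h := star_dotProduct_lorentzJ (g.val *ᵥ x)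
  have h2 : star (g.val *ᵥ x) ⬝ᵥ (lorentzJ n *ᵥ (g.val *ᵥ x)) =
      star x ⬝ᵥ (((g.val)ᴴ * lorentzJ n * g.val) *ᵥ x) := by
    rw [Matrix.star_mulVec, ← Matrix.dotProduct_mulVec, Matrix.mulVec_mulVec, Matrix.mulVec_mulVec]
  rw [h2, (mem_SU1n.1 hg).1, star_dotProduct_lorentzJ] at h
  have := neg_injective h
  exact_mod_cast this.symm

/-- Apply `exists_fixed_line` to `lorentzQ`, the coordinate `x₀` and the `K`-invariant norm `sup_{k
∈ K} ‖k x‖`, which is finite and continuous because `K` is compact. -/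
theorem exists_negative_line {K : Subgroup (GL (Unit ⊕ Fin n) ℂ)} (hK : K ≤ SU1n n)
    (hKc : IsCompact (K : Set (GL (Unit ⊕ Fin n) ℂ))) :
    ∃ v : Unit ⊕ Fin n → ℂ, 0 < lorentzQ v ∧ ∀ k ∈ K, ∃ c : ℂ, k.val *ᵥ v = c • v := by
  let f : (Unit ⊕ Fin n → ℂ) → GL (Unit ⊕ Fin n) ℂ → ℝ := fun x k => ‖k.val *ᵥ x‖
  have hf : Continuous (Function.uncurry f) := by
    refine Continuous.norm (Continuous.matrix_mulVec ?_ continuous_fst)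
    exact Units.continuous_val.comp continuous_snd
  let N : (Unit ⊕ Fin n → ℂ) → ℝ := fun x => sSup (f x '' K)
  have hN : Continuous N := hKc.continuous_sSup hf
  have hbdd : ∀ x, BddAbove (f x '' K) := fun x =>
    (hKc.image (hf.comp (Continuous.prodMk_right x))).bddAbove
  have hne : ∀ x, (f x '' K).Nonempty := fun x => ⟨_, 1, K.one_mem, rfl⟩
  have hle : ∀ x, ∀ k ∈ K, ‖k.val *ᵥ x‖ ≤ N x := fun x k hk => le_csSup (hbdd x) ⟨k, hk, rfl⟩
  have hNle : ∀ x c, (∀ k ∈ K, ‖k.val *ᵥ x‖ ≤ c) → N x ≤ c := fun x c h =>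
    csSup_le (hne x) (by rintro _ ⟨k, hk, rfl⟩; exact h k hk)
  have hNs' : ∀ (c : ℂ) x, N (c • x) ≤ ‖c‖ * N x := fun c x => hNle _ _ fun k hk => by
    rw [Matrix.mulVec_smul, norm_smul]
    exact mul_le_mul_of_nonneg_left (hle x k hk) (norm_nonneg _)
  have hN0 : ∀ x, ‖x‖ ≤ N x := fun x => by simpa using hle x 1 K.one_mem
  obtain ⟨v, hv, hvf⟩ := exists_fixed_line (𝕜 := ℂ) (E := Unit ⊕ Fin n → ℂ)
    (LinearMap.proj (Sum.inl ())) lorentzQ N (by unfold lorentzQ; fun_prop) hN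
    (fun c x => by
      simp only [lorentzQ, Pi.smul_apply, smul_eq_mul, norm_mul, mul_pow, mul_sub, Finset.mul_sum])
    (fun x y => by
      have h : ∀ i, ‖(x + y) i‖ ^ 2 + ‖(x - y) i‖ ^ 2 = 2 * (‖x i‖ ^ 2 + ‖y i‖ ^ 2) := fun i => by
        simpa only [sq, Pi.add_apply, Pi.sub_apply] using parallelogram_law_with_norm ℝ (x i) (y i)
      have h2 : ∑ j, ‖(x + y) (Sum.inr j)‖ ^ 2 + ∑ j, ‖(x - y) (Sum.inr j)‖ ^ 2 =
          2 * (∑ j, ‖x (Sum.inr j)‖ ^ 2 + ∑ j, ‖y (Sum.inr j)‖ ^ 2) := by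
        rw [← Finset.sum_add_distrib, ← Finset.sum_add_distrib, Finset.mul_sum]
        exact Finset.sum_congr rfl fun j _ => h _
      simp only [lorentzQ]
      linarith [h (Sum.inl ())])
    (fun x hx hx0 => by
      have h0 : x (Sum.inl ()) = 0 := hx
      obtain ⟨i, hi⟩ := Function.ne_iff.1 hx0
      obtain (⟨⟩ | j) := i
      · exact absurd h0 hi
      · have : 0 < ∑ j, ‖x (Sum.inr j)‖ ^ 2 :=
          Finset.sum_pos' (fun _ _ => by positivity)
            ⟨j, Finset.mem_univ _, pow_pos (norm_pos_iff.2 hi) 2⟩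
        simp only [lorentzQ, h0]
        simp only [norm_zero]
        linarith)
    ⟨Pi.single (Sum.inl ()) 1, by simp [lorentzQ]⟩
    (fun c x => by
      refine le_antisymm (hNs' c x) ?_
      by_cases hc : c = 0
      · rw [hc, norm_zero, zero_mul]
        exact (norm_nonneg _).trans (hN0 _)
      · have h1 := hNs' c⁻¹ (c • x)
        rw [smul_smul, inv_mul_cancel₀ hc, one_smul, norm_inv] at h1
        have h2 : 0 < ‖c‖ := norm_pos_iff.2 hc
        calc ‖c‖ * N x ≤ ‖c‖ * (‖c‖⁻¹ * N (c • x)) := by gcongr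
          _ = N (c • x) := by field_simp)
    (fun x y => hNle _ _ fun k hk => by
      rw [Matrix.mulVec_add]
      exact (norm_add_le _ _).trans (add_le_add (hle x k hk) (hle y k hk)))
    hN0
  refine ⟨v, hv, fun k hk => hvf (fun x => k.val *ᵥ x) (lorentzQ_mulVec (hK hk)) fun x => ?_⟩
  have key : ∀ k ∈ K, ∀ x, N (k.val *ᵥ x) ≤ N x := fun k hk x => hNle _ _ fun k' hk' => by
    rw [Matrix.mulVec_mulVec, ← Units.val_mul]
    exact hle x _ (K.mul_mem hk' hk)
  refine le_antisymm (key k hk x) ?_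
  have := key k⁻¹ (K.inv_mem hk) (k.val *ᵥ x)
  rwa [Matrix.mulVec_mulVec, ← Units.val_mul, inv_mul_cancel, Units.val_one,
    Matrix.one_mulVec] at this

/-- `SU_{1,n}` acts transitively on the negative lines. -/
theorem exists_mem_SU1n_mulVec {v : Unit ⊕ Fin n → ℂ} (hv : 0 < lorentzQ v) :
    ∃ g ∈ SU1n n, ∃ c : ℂ, c ≠ 0 ∧ g.val *ᵥ (Pi.single (Sum.inl ()) 1) = c • v := by
  have hv0 : v (Sum.inl ()) ≠ 0 := by
    intro h
    have : 0 ≤ ∑ j, ‖v (Sum.inr j)‖ ^ 2 := by positivity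
    simp only [lorentzQ, h] at hv
    simp only [norm_zero] at hv
    linarith
  set a := ‖v (Sum.inl ())‖ with ha
  have ha0 : 0 < a := norm_pos_iff.2 hv0
  -- The factor `c` normalizes `v` to `lorentzQ = 1` and makes the first coordinate a positive real
  -- number `p`.
  set c : ℂ := (starRingEnd ℂ (v (Sum.inl ())) / a) / (Real.sqrt (lorentzQ v) : ℂ) with hc
  have hsq : 0 < Real.sqrt (lorentzQ v) := Real.sqrt_pos.2 hv
  have hc0 : c ≠ 0 := by
    rw [hc]
    refine div_ne_zero (div_ne_zero ?_ ?_) ?_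
    · simpa using hv0
    · exact_mod_cast ha0.ne'
    · exact_mod_cast hsq.ne'
  have hcn : ‖c‖ ^ 2 * lorentzQ v = 1 := by
    rw [hc, norm_div, norm_div, Complex.norm_conj, Complex.norm_real, Complex.norm_real,
      Real.norm_of_nonneg ha0.le, Real.norm_of_nonneg hsq.le, ← ha, div_self ha0.ne', div_pow,
      Real.sq_sqrt hv.le]
    field_simp
  set u : Unit ⊕ Fin n → ℂ := c • v with hu
  set p : ℝ := a / Real.sqrt (lorentzQ v) with hp
  have hp0 : 0 < p := div_pos ha0 hsq
  have hu0 : u (Sum.inl ()) = (p : ℂ) := by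
    have : starRingEnd ℂ (v (Sum.inl ())) * v (Sum.inl ()) = (a : ℂ) ^ 2 := Complex.conj_mul' _
    rw [hu, Pi.smul_apply, smul_eq_mul, hc, hp]
    push_cast
    rw [div_mul_eq_mul_div, div_mul_eq_mul_div, this]
    congr 1
    have : (a : ℂ) ≠ 0 := by exact_mod_cast ha0.ne'
    field_simp
  have huQ : lorentzQ u = 1 := by
    rw [← hcn, hu]
    simp only [lorentzQ, Pi.smul_apply, smul_eq_mul, norm_mul, mul_pow, mul_sub, Finset.mul_sum]
  set w : Unit ⊕ Fin n → ℂ := Pi.single (Sum.inl ()) 1 + u with hw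
  set s : ℂ := 1 / (1 + p) with hs
  have hp1 : (1 + p : ℂ) ≠ 0 := by
    have : (1 + p : ℝ) ≠ 0 := by positivity
    exact_mod_cast this
  have hwJ : star w ⬝ᵥ (lorentzJ n *ᵥ w) = -(2 + 2 * p : ℂ) := by
    rw [star_dotProduct_lorentzJ]
    have h1 : lorentzQ w = 2 + 2 * p := by
      have h2 : w (Sum.inl ()) = ((1 + p : ℝ) : ℂ) := by simp [hw, hu0]
      have h3 : ∀ j, w (Sum.inr j) = u (Sum.inr j) := fun j => by simp [hw]
      simp only [lorentzQ, h3] at huQ ⊢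
      rw [hu0, Complex.norm_real, Real.norm_of_nonneg hp0.le] at huQ
      rw [h2, Complex.norm_real, Real.norm_of_nonneg (by positivity)]
      linarith
    rw [h1]; push_cast; rfl
  have hJH : (lorentzJ n)ᴴ = lorentzJ n := by
    rw [lorentzJ, Matrix.diagonal_conjTranspose]
    congr 1
    ext (i | i) <;> simp
  have hss : star s = s := by
    rw [hs]; simp
  -- With `e` the first basis vector, `M` is `lorentzJ` followed by the pseudo-Hermitian reflection
  -- in `w = e + u`: the first sends `e` to `-e`, the second sends `-e` to `u`, since `e - u` is
  -- orthogonal to `w` (`p` is real). Both have determinant `-1`.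
  let M : Matrix (Unit ⊕ Fin n) (Unit ⊕ Fin n) ℂ := lorentzJ n + s • Matrix.vecMulVec w (star w)
  have hMH : Mᴴ = M := by
    simp only [M, Matrix.conjTranspose_add, Matrix.conjTranspose_smul, hJH, hss,
      Matrix.conjTranspose_vecMulVec, star_star]
  have hJJ := lorentzJ_mul_self (n := n)
  have hww : Matrix.vecMulVec w (star w) * lorentzJ n * Matrix.vecMulVec w (star w) =
      -(2 + 2 * p : ℂ) • Matrix.vecMulVec w (star w) := by
    rw [mul_assoc, Matrix.mul_vecMulVec, Matrix.vecMulVec_mul_vecMulVec, hwJ,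
      Matrix.vecMulVec_smul]
  have hMJ : Mᴴ * lorentzJ n * M = lorentzJ n := by
    rw [hMH]
    simp only [M, add_mul, mul_add, Matrix.smul_mul, Matrix.mul_smul, hww, hJJ, one_mul]
    rw [mul_assoc (Matrix.vecMulVec _ _), hJJ, mul_one]
    have h1 : s * (s * (2 + 2 * p)) = s + s := by rw [hs]; field_simp; ring
    rw [neg_smul, smul_neg, smul_neg, smul_smul, smul_smul, mul_assoc, h1, add_smul]
    abel
  have hdetJ : (lorentzJ n).det = -1 := by
    simp [lorentzJ, Matrix.det_diagonal, Fintype.prod_sum_type]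
  have hdet : M.det = 1 := by
    have h1 : M = lorentzJ n * (1 + Matrix.replicateCol Unit (s • (lorentzJ n *ᵥ w)) *
        Matrix.replicateRow Unit (star w)) := by
      rw [← Matrix.vecMulVec_eq, mul_add, mul_one, Matrix.mul_vecMulVec, Matrix.mulVec_smul,
        Matrix.mulVec_mulVec, hJJ, Matrix.one_mulVec, Matrix.smul_vecMulVec]
    rw [h1, Matrix.det_mul, hdetJ, Matrix.det_one_add_replicateCol_mul_replicateRow,
      dotProduct_smul, hwJ, hs, smul_eq_mul]
    field_simp
    ring_nf
  have hunit : IsUnit M := by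
    rw [Matrix.isUnit_iff_isUnit_det, hdet]; exact isUnit_one
  refine ⟨hunit.unit, mem_SU1n.2 ⟨hMJ, hdet⟩, c, hc0, ?_⟩
  change M *ᵥ _ = u
  ext i
  have h1 : ∀ i, (M *ᵥ Pi.single (Sum.inl ()) 1) i = M i (Sum.inl ()) := fun i => by simp
  rw [h1]
  simp only [M, Matrix.add_apply, Matrix.smul_apply, Matrix.vecMulVec_apply, Pi.star_apply]
  have h2 : w (Sum.inl ()) = 1 + p := by simp [hw, hu0]
  have h3 : star (1 + p : ℂ) = 1 + p := by simp
  rw [h2, h3, smul_eq_mul, mul_left_comm, hs, one_div_mul_cancel hp1, mul_one]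
  obtain (⟨⟩ | j) := i
  · simp [lorentzJ, hw]
  · simp [lorentzJ, hw]

/-- Move the negative line preserved by `K` to the first coordinate axis. Preserving this axis
clears the rest of the first column, and invariance of the form then clears the rest of the first
row. -/
theorem exists_conj_le_compactUn {K : Subgroup (GL (Unit ⊕ Fin n) ℂ)} (hK : K ≤ SU1n n)
    (hKc : IsCompact (K : Set (GL (Unit ⊕ Fin n) ℂ))) :
    ∃ g ∈ SU1n n, conjSubgroup g K ≤ compactUn n := by
  obtain ⟨v, hv, hvK⟩ := exists_negative_line hK hKc
  obtain ⟨g, hg, c, hc, hgv⟩ := exists_mem_SU1n_mulVec hv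
  set e : Unit ⊕ Fin n → ℂ := Pi.single (Sum.inl ()) 1 with he
  refine ⟨g⁻¹, inv_mem hg, fun k hk => ?_⟩
  have hkG : k ∈ SU1n n := conjSubgroup_le hK (inv_mem hg) hk
  rw [mem_conjSubgroup, inv_inv] at hk
  obtain ⟨d, hd⟩ := hvK _ hk
  have hke : k.val *ᵥ e = d • e := by
    have h1 : k.val *ᵥ e = (g⁻¹).val *ᵥ ((g * k * g⁻¹).val *ᵥ (g.val *ᵥ e)) := by
      simp only [Matrix.mulVec_mulVec, ← Units.val_mul]
      congr 2
      group
    have h2 : (g⁻¹).val *ᵥ (g.val *ᵥ e) = e := by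
      simp only [Matrix.mulVec_mulVec, ← Units.val_mul]
      simp
    rw [h1, hgv, Matrix.mulVec_smul, hd, smul_comm, ← hgv, Matrix.mulVec_smul, h2]
  have hcol : ∀ i, k.val i (Sum.inl ()) = d * e i := fun i => by
    have := congrFun hke i
    simpa [he] using this
  have hk0 : k.val (Sum.inl ()) (Sum.inl ()) = d := by rw [hcol]; simp [he]
  have hkj : ∀ j, k.val (Sum.inr j) (Sum.inl ()) = 0 := fun j => by rw [hcol]; simp [he]
  have hd0 : d ≠ 0 := by
    rintro rfl
    rw [zero_smul] at hke
    have h3 : (k⁻¹).val *ᵥ (k.val *ᵥ e) = e := by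
      simp only [Matrix.mulVec_mulVec, ← Units.val_mul]
      simp
    rw [hke, Matrix.mulVec_zero] at h3
    have := congrFun h3 (Sum.inl ())
    simp [he] at this
  have hrow : ∀ j, k.val (Sum.inl ()) (Sum.inr j) = 0 := fun j => by
    have h1 := congrFun (congrFun (mem_SU1n.1 hkG).1 (Sum.inl ())) (Sum.inr j)
    rw [lorentzJ, Matrix.mul_apply] at h1
    simp only [Matrix.mul_diagonal, Matrix.conjTranspose_apply, Fintype.sum_sum_type, hkj,
      Finset.univ_unique, Finset.sum_singleton] at h1
    simp only [star_zero, zero_mul, Finset.sum_const_zero, add_zero] at h1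
    simpa [hk0, hd0] using h1
  refine Subgroup.mem_inf.2 ⟨hkG, ?_⟩
  rw [mem_commutantGroup, lorentzJ, Matrix.commute_diagonal_iff]
  rintro (⟨⟩ | i) (⟨⟩ | j) hij
  · rfl
  · exact absurd (hrow j) hij
  · exact absurd (hkj i) hij
  · rfl

end Cartan

/-! ### Block matrices -/

section Blocks

variable {n : ℕ}

/-- The map `a ↦ diag(0, a)` as a linear map. -/
def blockLieHom (n : ℕ) :
    Matrix (Fin n) (Fin n) ℂ →ₗ[ℝ] Matrix (Unit ⊕ Fin n) (Unit ⊕ Fin n) ℂ where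
  toFun := blockLie
  map_add' X Y := by simp [blockLie, Matrix.fromBlocks_add]
  map_smul' c X := by simp [blockLie, Matrix.fromBlocks_smul]

@[simp] theorem blockLieHom_apply (Y : Matrix (Fin n) (Fin n) ℂ) :
    blockLieHom n Y = blockLie Y := rfl

theorem blockLie_injective : Function.Injective (blockLie (n := n)) := fun _ _ h =>
  (Matrix.fromBlocks_inj.1 h).2.2.2

theorem blockLie_mul (X Y : Matrix (Fin n) (Fin n) ℂ) :
    blockLie X * blockLie Y = blockLie (X * Y) := by
  simp [blockLie, Matrix.fromBlocks_multiply]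

theorem blockLie_commute {X Y : Matrix (Fin n) (Fin n) ℂ} :
    Commute (blockLie X) (blockLie Y) ↔ Commute X Y := by
  rw [Commute, SemiconjBy, blockLie_mul, blockLie_mul, blockLie_injective.eq_iff]
  rfl

theorem trace_blockLie (X : Matrix (Fin n) (Fin n) ℂ) : (blockLie X).trace = X.trace := by
  simp [blockLie, Matrix.trace, Fintype.sum_sum_type]

theorem blockEmb_val (g : GL (Fin n) ℂ) :
    (blockEmb n g).val = Matrix.fromBlocks 1 0 0 g.val := rfl

theorem continuous_blockEmb : Continuous (blockEmb n) := by
  rw [Units.continuous_iff]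
  constructor
  · exact Continuous.matrix_fromBlocks continuous_const continuous_const continuous_const
      Units.continuous_val
  · have : (fun g : GL (Fin n) ℂ => ((blockEmb n g)⁻¹).val) =
        fun g => Matrix.fromBlocks 1 0 0 (g⁻¹).val := by
      funext g
      rw [← map_inv]
      rfl
    rw [this]
    exact Continuous.matrix_fromBlocks continuous_const continuous_const continuous_const
      (Units.continuous_val.comp continuous_inv)

open scoped Matrix.Norms.Operator in
theorem expGL_blockLie (Y : Matrix (Fin n) (Fin n) ℂ) :
    expGL (blockLie Y) = blockEmb n (expGL Y) := by
  -- The map `a ↦ diag(0, a)` is not unital; a free scalar in the corner gives a continuous ring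
  -- homomorphism, which commutes with `exp`.
  let f : ℂ × Matrix (Fin n) (Fin n) ℂ →+* Matrix (Unit ⊕ Fin n) (Unit ⊕ Fin n) ℂ :=
    { toFun := fun p => Matrix.fromBlocks (p.1 • 1) 0 0 p.2
      map_one' := by simp
      map_zero' := by simp
      map_mul' := fun p q => by simp [Matrix.fromBlocks_multiply, smul_smul, mul_comm]
      map_add' := fun p q => by simp [Matrix.fromBlocks_add, add_smul] }
  have hf : Continuous f :=
    Continuous.matrix_fromBlocks (continuous_fst.smul continuous_const) continuous_const
      continuous_const continuous_snd
  have h := NormedSpace.map_exp f hf (0, Y)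
  have h1 : f (0, Y) = blockLie Y := by simp [f, blockLie]
  have h2 : f (NormedSpace.exp ((0 : ℂ), Y)) =
      Matrix.fromBlocks 1 0 0 (NormedSpace.exp Y) := by
    change Matrix.fromBlocks ((NormedSpace.exp ((0 : ℂ), Y)).1 • 1) 0 0
      (NormedSpace.exp ((0 : ℂ), Y)).2 = _
    have e1 : (NormedSpace.exp ((0 : ℂ), Y)).1 = NormedSpace.exp (0 : ℂ) := Prod.fst_exp _
    have e2 : (NormedSpace.exp ((0 : ℂ), Y)).2 = NormedSpace.exp Y := Prod.snd_exp _
    rw [e1, e2, NormedSpace.exp_zero, one_smul]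
  refine Units.ext ?_
  change NormedSpace.exp (blockLie Y) = Matrix.fromBlocks 1 0 0 (NormedSpace.exp Y)
  rw [← h2, ← h1]
  exact h.symm

theorem map_analyticSubgroup_blockEmb (V : Submodule ℝ (Matrix (Fin n) (Fin n) ℂ)) :
    (analyticSubgroup V).map (blockEmb n) = analyticSubgroup (V.map (blockLieHom n)) := by
  refine le_antisymm (Subgroup.map_le_iff_le_comap.2 (analyticSubgroup_le fun Y hY => ?_))
    (analyticSubgroup_le ?_)
  · rw [Subgroup.mem_comap, ← expGL_blockLie]
    exact expGL_mem_analyticSubgroup ⟨Y, hY, rfl⟩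
  · rintro _ ⟨Y, hY, rfl⟩
    rw [blockLieHom_apply, expGL_blockLie]
    exact ⟨_, expGL_mem_analyticSubgroup hY, rfl⟩

theorem adMat_blockEmb (g : GL (Fin n) ℂ) (Y : Matrix (Fin n) (Fin n) ℂ) :
    adMat (blockEmb n g) (blockLie Y) = blockLie (adMat g Y) := by
  rw [adMat_apply, ← map_inv, blockEmb_val, blockEmb_val, adMat_apply]
  simp [blockLie, Matrix.fromBlocks_multiply]

theorem zZero_eq : zZero n = Matrix.diagonal
    (Sum.elim (fun _ => Complex.I) fun _ => -(Complex.I / n)) := by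
  rw [← Matrix.fromBlocks_diagonal, zZero]
  congr 1 <;> exact (Matrix.smul_one_eq_diagonal _)

theorem commute_zZero {A : Matrix (Unit ⊕ Fin n) (Unit ⊕ Fin n) ℂ} (h : Commute A (lorentzJ n)) :
    Commute A (zZero n) := by
  rw [lorentzJ, Matrix.commute_diagonal_iff] at h
  rw [zZero_eq, Matrix.commute_diagonal_iff]
  intro i j hij
  have := h i j hij
  obtain (⟨⟩ | i) := i <;> obtain (⟨⟩ | j) := j
  · rfl
  · norm_num at this
  · norm_num at this
  · rfl

theorem zZero_mem_lieAlg (hn : 1 ≤ n) : zZero n ∈ lieAlg (compactUn n) := by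
  have hn0 : (n : ℂ) ≠ 0 := by exact_mod_cast (by omega : n ≠ 0)
  rw [mem_lieAlg_compactUn, zZero_eq]
  refine ⟨?_, ?_, ?_⟩
  · rw [Matrix.diagonal_conjTranspose, Matrix.diagonal_neg]
    congr 1
    ext (i | i) <;> simp [neg_div]
  · simp [Matrix.trace_diagonal]
    field_simp
    ring
  · exact Matrix.commute_diagonal _ _

theorem blockLie_mem_lieAlg_compactUn {Y : Matrix (Fin n) (Fin n) ℂ} :
    blockLie Y ∈ lieAlg (compactUn n) ↔ Y ∈ suSpace (Fin n) := by
  rw [mem_lieAlg_compactUn, mem_suSpace, trace_blockLie, lorentzJ_eq]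
  constructor
  · rintro ⟨h1, h2, -⟩
    refine ⟨?_, h2⟩
    rw [blockLie, Matrix.fromBlocks_conjTranspose, Matrix.fromBlocks_neg,
      Matrix.fromBlocks_inj] at h1
    exact h1.2.2.2
  · rintro ⟨h1, h2⟩
    refine ⟨?_, h2, ?_⟩
    · rw [blockLie, Matrix.fromBlocks_conjTranspose, Matrix.fromBlocks_neg, h1]
      simp
    · rw [Commute, SemiconjBy, blockLie, Matrix.fromBlocks_multiply, Matrix.fromBlocks_multiply]
      simp

theorem exists_zZero_add_blockLie (hn : 1 ≤ n)
    {X : Matrix (Unit ⊕ Fin n) (Unit ⊕ Fin n) ℂ} (hX : X ∈ lieAlg (compactUn n)) :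
    ∃ c : ℝ, ∃ Y ∈ suSpace (Fin n), X = c • zZero n + blockLie Y := by
  have hX' := hX
  rw [mem_lieAlg_compactUn] at hX
  obtain ⟨h1, -, h3⟩ := hX
  set c : ℝ := (X (Sum.inl ()) (Sum.inl ())).im with hc
  have h00 : X (Sum.inl ()) (Sum.inl ()) = c * Complex.I := by
    have := congrFun (congrFun h1 (Sum.inl ())) (Sum.inl ())
    rw [Matrix.conjTranspose_apply, Matrix.neg_apply] at this
    have hre := congrArg Complex.re this
    simp at hre
    apply Complex.ext
    · simp; linarith
    · simp [hc]
  rw [lorentzJ, Matrix.commute_diagonal_iff] at h3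
  have hr : ∀ j, X (Sum.inl ()) (Sum.inr j) = 0 := fun j => by
    by_contra h
    have := h3 _ _ h
    norm_num at this
  have hl : ∀ j, X (Sum.inr j) (Sum.inl ()) = 0 := fun j => by
    by_contra h
    have := h3 _ _ h
    norm_num at this
  set Y := (X - c • zZero n).toBlocks₂₂ with hY
  have hXY : X - c • zZero n = blockLie Y := by
    rw [← Matrix.fromBlocks_toBlocks (X - c • zZero n), blockLie, ← hY]
    congr 1
    · ext i j
      simp [Matrix.toBlocks₁₁, zZero, h00]
    · ext i j
      simp [Matrix.toBlocks₁₂, zZero, hr]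
    · ext i j
      simp [Matrix.toBlocks₂₁, zZero, hl]
  refine ⟨c, Y, ?_, ?_⟩
  · rw [← blockLie_mem_lieAlg_compactUn, ← hXY]
    exact Submodule.sub_mem _ hX' (Submodule.smul_mem _ _ (zZero_mem_lieAlg hn))
  · rw [← hXY]; abel

theorem lorentzJ_commute_blockLie (Y : Matrix (Fin n) (Fin n) ℂ) :
    Commute (blockLie Y) (lorentzJ n) := by
  rw [lorentzJ_eq, Commute, SemiconjBy, blockLie, Matrix.fromBlocks_multiply,
    Matrix.fromBlocks_multiply]
  simp

theorem blockEmb_mem_compactUn {g : GL (Fin n) ℂ} : blockEmb n g ∈ compactUn n ↔ g ∈ SUn n := by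
  rw [mem_compactUn, mem_SUn, blockEmb_val, Matrix.fromBlocks_conjTranspose,
    Matrix.fromBlocks_multiply, ← Matrix.fromBlocks_one, Matrix.fromBlocks_inj]
  have h : Commute (Matrix.fromBlocks 1 0 0 g.val) (lorentzJ n) := by
    rw [lorentzJ_eq, Commute, SemiconjBy, Matrix.fromBlocks_multiply,
      Matrix.fromBlocks_multiply]
    simp
  simp [h, Matrix.det_fromBlocks_zero₂₁]

theorem frobForm_zZero_blockLie {Y : Matrix (Fin n) (Fin n) ℂ} (hY : Y.trace = 0) :
    frobForm (blockLie Y) (zZero n) = 0 := by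
  rw [frobForm_comm, frobForm_apply, zZero, blockLie, Matrix.fromBlocks_conjTranspose,
    Matrix.fromBlocks_multiply, Matrix.trace, Fintype.sum_sum_type]
  have h : ∑ i, Y i i = 0 := hY
  simp [Matrix.conjTranspose_smul, ← Finset.mul_sum, h]

theorem exp_smul_zZero (t : ℝ) : (expGL (t • zZero n)).val = Matrix.diagonal
    (Sum.elim (fun _ => Complex.exp (t * Complex.I)) fun _ => Complex.exp (-(t * Complex.I / n))) := by
  rw [coe_expGL, zZero_eq, ← Matrix.diagonal_smul, Matrix.exp_diagonal]
  congr 1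
  ext (i | i)
  · rw [Pi.coe_exp, Complex.exp_eq_exp_ℂ]; simp
  · rw [Pi.coe_exp, Complex.exp_eq_exp_ℂ]
    congr 1
    simp only [Pi.smul_apply, Sum.elim_inr, Complex.real_smul]
    ring

/-- The scalar matrix `exp (-2πi/n)`. -/
noncomputable def rootScalar (n : ℕ) : GL (Fin n) ℂ :=
  expGL (Matrix.diagonal fun _ => -(2 * Real.pi * Complex.I / n))

theorem rootScalar_zpow (k : ℤ) : (rootScalar n ^ k).val =
    Matrix.diagonal fun _ => Complex.exp (-((2 * Real.pi * k : ℝ) * Complex.I / n)) := by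
  rw [rootScalar, ← expGL_int_smul, coe_expGL, ← Matrix.diagonal_smul, Matrix.exp_diagonal]
  congr 1
  ext i
  rw [Pi.coe_exp, Complex.exp_eq_exp_ℂ]
  congr 1
  simp only [Pi.smul_apply, Complex.real_smul]
  push_cast
  ring

theorem commute_rootScalar (k : ℤ) (a : GL (Fin n) ℂ) : Commute (rootScalar n ^ k) a := by
  refine Units.ext ?_
  rw [Units.val_mul, Units.val_mul, rootScalar_zpow]
  ext i j
  simp [Matrix.diagonal_mul, Matrix.mul_diagonal, mul_comm]

theorem rootScalar_pow (hn : 1 ≤ n) : rootScalar n ^ n = 1 := by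
  have hn0 : (n : ℂ) ≠ 0 := by exact_mod_cast (by omega : n ≠ 0)
  refine Units.ext ?_
  rw [← zpow_natCast, rootScalar_zpow, Units.val_one, ← Matrix.diagonal_one]
  congr 1
  ext i
  have : -(((2 * Real.pi * ((n : ℕ) : ℤ) : ℝ) : ℂ) * Complex.I / n) =
      -(2 * Real.pi * Complex.I) := by
    push_cast
    field_simp
  rw [this, Complex.exp_neg, Complex.exp_two_pi_mul_I, inv_one]

theorem torusT_zero : torusT (0 : Matrix (Fin n) (Fin n) ℂ) =
    analyticSubgroup (Submodule.span ℝ {zZero n}) := by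
  rw [torusT, ← blockLieHom_apply, map_zero, add_zero]

theorem commute_zZero_blockLie (Y : Matrix (Fin n) (Fin n) ℂ) : Commute (zZero n) (blockLie Y) :=
  (commute_zZero (lorentzJ_commute_blockLie Y)).symm

theorem commute_torusT_zero {H : Subgroup (GL (Fin n) ℂ)} :
    ∀ a ∈ torusT (0 : Matrix (Fin n) (Fin n) ℂ), ∀ b ∈ H.map (blockEmb n), Commute a b := by
  intro a ha b hb
  rw [torusT_zero, mem_analyticSubgroup_span] at ha
  obtain ⟨t, rfl⟩ := ha
  obtain ⟨g, -, rfl⟩ := hb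
  refine Units.ext ?_
  rw [Units.val_mul, Units.val_mul, coe_expGL]
  have h : Commute (blockEmb n g).val (zZero n) := by
    refine commute_zZero ?_
    rw [blockEmb_val, lorentzJ_eq, Commute, SemiconjBy, Matrix.fromBlocks_multiply,
      Matrix.fromBlocks_multiply]
    simp
  exact ((h.smul_right t).exp_right).symm

/-- `exp (t z₀)` has corner entry `1` only for `t ∈ 2πℤ`, and then its lower block is a power of
`rootScalar n`. So adjoining `T¹₀` enlarges the `SU_n`-part only by `n`-th roots of unity. -/
theorem exists_zpow_mul_of_blockEmb_mem {H : Subgroup (GL (Fin n) ℂ)} {s : GL (Fin n) ℂ}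
    (hs : blockEmb n s ∈ torusT (0 : Matrix (Fin n) (Fin n) ℂ) ⊔ H.map (blockEmb n)) :
    ∃ k : ℤ, ∃ a ∈ H, s = rootScalar n ^ k * a := by
  obtain ⟨_, ht, _, ⟨a, ha, rfl⟩, hs⟩ := (mem_sup_of_commute commute_torusT_zero).1 hs
  rw [torusT_zero, mem_analyticSubgroup_span] at ht
  obtain ⟨t, rfl⟩ := ht
  have h := congrArg Units.val hs
  rw [Units.val_mul, exp_smul_zZero, blockEmb_val, blockEmb_val] at h
  have h0 := congrFun (congrFun h (Sum.inl ())) (Sum.inl ())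
  rw [Matrix.diagonal_mul] at h0
  simp only [Matrix.fromBlocks_apply₁₁, Matrix.one_apply_eq, Sum.elim_inl, mul_one] at h0
  obtain ⟨k, hk⟩ := Complex.exp_eq_one_iff.1 h0.symm
  refine ⟨k, a, ha, Units.ext ?_⟩
  rw [Units.val_mul, rootScalar_zpow]
  ext i j
  have hij := congrFun (congrFun h (Sum.inr i)) (Sum.inr j)
  rw [Matrix.diagonal_mul] at hij
  simp only [Matrix.fromBlocks_apply₂₂, Sum.elim_inr] at hij
  rw [Matrix.diagonal_mul, hij, hk]
  push_cast
  ring_nf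

theorem isCompact_torusT_zero (hn : 1 ≤ n) :
    IsCompact (torusT (0 : Matrix (Fin n) (Fin n) ℂ) : Set (GL (Unit ⊕ Fin n) ℂ)) := by
  have hn0 : (n : ℂ) ≠ 0 := by exact_mod_cast (by omega : n ≠ 0)
  have hn1 : (n : ℝ) ≠ 0 := by exact_mod_cast (by omega : n ≠ 0)
  rw [torusT_zero]
  refine isCompact_analyticSubgroup_span (T := n * (2 * Real.pi)) (by positivity) (Units.ext ?_)
  rw [exp_smul_zZero, Units.val_one, ← Matrix.diagonal_one]
  congr 1
  ext (i | i)
  · simp only [Sum.elim_inl]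
    rw [Complex.exp_eq_one_iff]
    exact ⟨n, by push_cast; ring⟩
  · simp only [Sum.elim_inr]
    rw [Complex.exp_eq_one_iff]
    exact ⟨-1, by push_cast; field_simp⟩

end Blocks

/-! ### Subgroups containing the centre of `S(U_1 × U_n)` -/

section Centre

variable {n : ℕ}

/-- A compact connected subgroup of `S(U_1 × U_n)` that contains every larger one with a fixed
vector outside its Lie algebra. -/
structure IsMaximalFixing (L : Subgroup (GL (Unit ⊕ Fin n) ℂ)) : Prop where
  le : L ≤ compactUn n
  compact : IsCompact (L : Set (GL (Unit ⊕ Fin n) ℂ))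
  connected : IsConnectedLieSubgroup L
  maximal : ∀ M : Subgroup (GL (Unit ⊕ Fin n) ℂ), L ≤ M → M ≤ compactUn n →
    IsCompact (M : Set (GL (Unit ⊕ Fin n) ℂ)) → IsConnectedLieSubgroup M →
    (∃ X ∈ lieAlg (SU1n n), X ∉ lieAlg M ∧ ∀ h ∈ M, adMat h X = X) → M ≤ L

theorem isCompact_comap_blockEmb {L : Subgroup (GL (Unit ⊕ Fin n) ℂ)}
    (hL : IsCompact (L : Set (GL (Unit ⊕ Fin n) ℂ))) (hLU : L ≤ compactUn n) :
    IsCompact (L.comap (blockEmb n) : Set (GL (Fin n) ℂ)) :=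
  isCompact_unitaryGL.of_isClosed_subset (hL.isClosed.preimage continuous_blockEmb)
    fun _ hg => (mem_SUn.1 (blockEmb_mem_compactUn.1 (hLU hg))).1

theorem torusT_zero_le (hn : 1 ≤ n) :
    torusT (0 : Matrix (Fin n) (Fin n) ℂ) ≤ compactUn n := by
  rw [torusT_zero]
  refine analyticSubgroup_le fun X hX => ?_
  obtain ⟨t, rfl⟩ := Submodule.mem_span_singleton.1 hX
  have h := (lieAlg (compactUn n)).smul_mem t (zZero_mem_lieAlg hn)
  rw [mem_lieAlg_compactUn] at h
  rw [mem_compactUn, coe_expGL]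
  exact ⟨exp_unitary_of_skew h.1,
    by rw [Matrix.det_exp_of_skew h.1, h.2.1, Complex.exp_zero], h.2.2.exp_left⟩

theorem smul_zZero_add_blockLie_inj {c d : ℝ} {Y Z : Matrix (Fin n) (Fin n) ℂ}
    (h : c • zZero n + blockLie Y = d • zZero n + blockLie Z) : c = d ∧ Y = Z := by
  have h0 := congrFun (congrFun h (Sum.inl ())) (Sum.inl ())
  simp [zZero, blockLie] at h0
  subst h0
  exact ⟨rfl, blockLie_injective (add_left_cancel h)⟩

theorem torusT_sup_map_eq {H : Subgroup (GL (Fin n) ℂ)} (hH : IsConnectedLieSubgroup H) :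
    torusT (0 : Matrix (Fin n) (Fin n) ℂ) ⊔ H.map (blockEmb n) =
      analyticSubgroup (Submodule.span ℝ {zZero n} ⊔ (lieAlg H).map (blockLieHom n)) := by
  rw [analyticSubgroup_sup, ← map_analyticSubgroup_blockEmb, ← hH.2, torusT_zero]
  rintro X hX _ ⟨Y, -, rfl⟩
  obtain ⟨t, rfl⟩ := Submodule.mem_span_singleton.1 hX
  exact (commute_zZero_blockLie Y).smul_left t

theorem mem_span_sup_map {V : Submodule ℝ (Matrix (Fin n) (Fin n) ℂ)}
    {X : Matrix (Unit ⊕ Fin n) (Unit ⊕ Fin n) ℂ} :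
    X ∈ Submodule.span ℝ {zZero n} ⊔ V.map (blockLieHom n) ↔
      ∃ c : ℝ, ∃ Y ∈ V, X = c • zZero n + blockLie Y := by
  rw [Submodule.mem_sup]
  constructor
  · rintro ⟨_, h1, _, ⟨Y, hY, rfl⟩, rfl⟩
    obtain ⟨t, rfl⟩ := Submodule.mem_span_singleton.1 h1
    exact ⟨t, Y, hY, rfl⟩
  · rintro ⟨c, Y, hY, rfl⟩
    exact ⟨_, Submodule.smul_mem _ c (Submodule.mem_span_singleton_self _), _, ⟨Y, hY, rfl⟩, rfl⟩

/-- The Lie algebra of `T¹₀ · H`. -/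
theorem lieAlg_torusT_sup (hn : 1 ≤ n) {H : Subgroup (GL (Fin n) ℂ)} (hHU : H ≤ SUn n)
    {X : Matrix (Unit ⊕ Fin n) (Unit ⊕ Fin n) ℂ}
    (hX : ∀ t : ℝ, expGL (t • X) ∈
      torusT (0 : Matrix (Fin n) (Fin n) ℂ) ⊔ H.map (blockEmb n)) :
    X ∈ Submodule.span ℝ {zZero n} ⊔ (lieAlg H).map (blockLieHom n) := by
  have hle : torusT (0 : Matrix (Fin n) (Fin n) ℂ) ⊔ H.map (blockEmb n) ≤ compactUn n :=
    sup_le (torusT_zero_le hn) (Subgroup.map_le_iff_le_comap.2 fun h hh =>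
      blockEmb_mem_compactUn.2 (hHU hh))
  obtain ⟨c, Y, -, rfl⟩ := exists_zZero_add_blockLie hn
    (mem_lieAlg_of_forall fun t => hle (hX t))
  refine mem_span_sup_map.2 ⟨c, Y, mem_lieAlg_of_forall fun t => ?_, rfl⟩
  have hn1 : (n : ℝ) ≠ 0 := by exact_mod_cast (by omega : n ≠ 0)
  -- With `t / n` in place of `t`, the root of unity that may appear disappears on taking the `n`-th
  -- power.
  have h1 := hX (t / n)
  have h2 : (t / n) • (c • zZero n + blockLie Y) =
      ((t / n) * c) • zZero n + blockLie ((t / n) • Y) := by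
    rw [smul_add, smul_smul, ← blockLieHom_apply, ← map_smul]
    rfl
  rw [h2, expGL_add ((commute_zZero_blockLie _).smul_left _), expGL_blockLie] at h1
  have h3 : expGL (((t / n) * c) • zZero n) ∈ torusT (0 : Matrix (Fin n) (Fin n) ℂ) := by
    rw [torusT_zero, mem_analyticSubgroup_span]
    exact ⟨_, rfl⟩
  have h4 := (Subgroup.mul_mem_cancel_left _ (Subgroup.mem_sup_left h3)).1 h1
  obtain ⟨k, a, ha, hka⟩ := exists_zpow_mul_of_blockEmb_mem h4
  have h5 : t • Y = (n : ℝ) • ((t / n) • Y) := by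
    rw [smul_smul, mul_div_cancel₀ _ hn1]
  rw [h5, expGL_nat_smul, hka, (commute_rootScalar k a).mul_pow, ← zpow_natCast, ← zpow_mul,
    mul_comm k, zpow_mul, zpow_natCast, rootScalar_pow hn, one_zpow, one_mul]
  exact pow_mem ha n

/-- `H` is generated by the part of `lieAlg L` in `𝔰𝔲_n`. If `H₁` is admissible and contains `H`,
then `T¹₀ · H₁` contains `L` and fixes a vector of `𝔰𝔲_n` outside its Lie algebra, so maximality of
`L` returns it to `L`. -/
theorem IsMaximalFixing.exists_isMaximalAdmissible (hn : 1 ≤ n)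
    {L : Subgroup (GL (Unit ⊕ Fin n) ℂ)} (hL : IsMaximalFixing L) (hz : zZero n ∈ lieAlg L)
    {X : Matrix (Unit ⊕ Fin n) (Unit ⊕ Fin n) ℂ} (hX : X ∈ lieAlg (compactUn n))
    (hXL : X ∉ lieAlg L) (hXf : ∀ h ∈ L, adMat h X = X) :
    ∃ H : Subgroup (GL (Fin n) ℂ), IsMaximalAdmissible (SUn n) H ∧
      L = torusT (0 : Matrix (Fin n) (Fin n) ℂ) ⊔ H.map (blockEmb n) := by
  set V : Submodule ℝ (Matrix (Fin n) (Fin n) ℂ) := (lieAlg L).comap (blockLieHom n) with hV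
  have hVmem : ∀ Y, Y ∈ V ↔ blockLie Y ∈ lieAlg L := fun Y => Iff.rfl
  set H := analyticSubgroup V with hHdef
  have hHS : H ≤ L.comap (blockEmb n) := analyticSubgroup_le fun Y hY => by
    rw [Subgroup.mem_comap, ← expGL_blockLie]
    exact hL.connected.expGL_mem ((hVmem Y).1 hY)
  have hSU : L.comap (blockEmb n) ≤ SUn n := fun g hg =>
    blockEmb_mem_compactUn.1 (hL.le hg)
  have hlie : ∀ Y, (∀ t : ℝ, expGL (t • Y) ∈ H) → Y ∈ V := fun Y hY => by
    refine (hVmem Y).2 (mem_lieAlg_of_forall fun t => ?_)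
    have h1 := hHS (hY t)
    rw [Subgroup.mem_comap, ← expGL_blockLie, ← blockLieHom_apply, map_smul] at h1
    exact h1
  have hHconn : IsConnectedLieSubgroup H := isConnectedLieSubgroup_analyticSubgroup hlie
  have hHlie : lieAlg H = V := lieAlg_analyticSubgroup hlie
  have hLV : lieAlg L = Submodule.span ℝ {zZero n} ⊔ V.map (blockLieHom n) := by
    refine le_antisymm (fun Z hZ => ?_) (sup_le ?_ ?_)
    · obtain ⟨c, Y, -, rfl⟩ := exists_zZero_add_blockLie hn (lieAlg_mono hL.le hZ)
      refine mem_span_sup_map.2 ⟨c, Y, ?_, rfl⟩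
      rw [hVmem]
      simpa using Submodule.sub_mem _ hZ (Submodule.smul_mem _ c hz)
    · rw [Submodule.span_le, Set.singleton_subset_iff]
      exact hz
    · rintro _ ⟨Y, hY, rfl⟩
      exact hY
  have hLeq : L = torusT (0 : Matrix (Fin n) (Fin n) ℂ) ⊔ H.map (blockEmb n) := by
    rw [torusT_sup_map_eq hHconn, hHlie, ← hLV]
    exact hL.connected.2
  -- `L.comap (blockEmb n)` is compact and differs from `H` only by powers of the scalar root of
  -- unity.
  have hHc : IsCompact (H : Set (GL (Fin n) ℂ)) := by
    refine isCompact_analyticSubgroup (isCompact_comap_blockEmb hL.compact hL.le) hHS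
      (rootScalar n) fun s hs => ?_
    rw [Subgroup.mem_comap] at hs
    rw [hLeq] at hs
    exact exists_zpow_mul_of_blockEmb_mem hs
  have hHU := hHS.trans hSU
  have hunit : ∀ h ∈ SUn n, ∀ Y Z, frobForm (adMat h Y) (adMat h Z) = frobForm Y Z :=
    fun h hh Y Z => frobForm_adMat (mem_SUn.1 hh).1 Y Z
  refine ⟨H, ⟨?_, fun H₁ hH₁ hle => ?_⟩, hLeq⟩
  · obtain ⟨X₀, hX₀, hX₀0, -, hX₀L, hX₀f⟩ := exists_fixed_orthogonal hL.le frobForm_comm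
      frobForm_pos (fun h hh Y Z => frobForm_adMat (compactUn_unitary hL.le h hh) Y Z) hX hXL hXf
    obtain ⟨c, Y, hY, rfl⟩ := exists_zZero_add_blockLie hn hX₀
    have hz0 : zZero n ≠ 0 := by
      intro h
      have := congrFun (congrFun h (Sum.inl ())) (Sum.inl ())
      simp [zZero] at this
    -- Orthogonality to `z₀ ∈ lieAlg L` kills the central component, so the fixed vector lies in
    -- `𝔰𝔲_n`.
    have hc : c = 0 := by
      have h1 := hX₀L _ hz
      rw [map_add, map_smul, LinearMap.add_apply, LinearMap.smul_apply,
        frobForm_zZero_blockLie hY.2, add_zero, smul_eq_mul] at h1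
      exact (mul_eq_zero.1 h1).resolve_right (frobForm_pos _ hz0).ne'
    subst hc
    rw [zero_smul, zero_add] at hX₀0 hX₀L hX₀f
    refine isAdmissible_of_fixed hHU hHc hHconn frobForm_comm frobForm_pos
      (fun h hh => hunit h (hHU hh)) (X := Y) (by rwa [lieAlg_SUn]) ?_ fun h hh => ?_
    · rw [hHlie, hVmem]
      intro h
      exact (frobForm_pos _ hX₀0).ne' (hX₀L _ h)
    · have h1 := hX₀f _ (hHS hh)
      rw [adMat_blockEmb] at h1
      exact blockLie_injective h1
  · obtain ⟨X₁, hX₁, hX₁H, hX₁f⟩ := hH₁.exists_fixed fun h hh => (mem_SUn.1 (hH₁.1 hh)).1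
    obtain ⟨hH₁U, hH₁c, hH₁conn, -⟩ := hH₁
    have hlieM := fun Z => lieAlg_torusT_sup (X := Z) hn hH₁U
    have hMeq := torusT_sup_map_eq hH₁conn
    set M := torusT (0 : Matrix (Fin n) (Fin n) ℂ) ⊔ H₁.map (blockEmb n) with hM
    have hMlie : lieAlg M = Submodule.span ℝ {zZero n} ⊔ (lieAlg H₁).map (blockLieHom n) := by
      conv_lhs => rw [hMeq]
      refine lieAlg_analyticSubgroup fun Z hZ => ?_
      rw [← hMeq] at hZ
      exact hlieM Z hZ
    have hML : M ≤ L := by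
      refine hL.maximal M ?_ ?_ ?_ ?_ ⟨blockLie X₁, ?_, ?_, ?_⟩
      · rw [hLeq]
        exact sup_le_sup_left (Subgroup.map_mono hle) _
      · exact sup_le (torusT_zero_le hn) (Subgroup.map_le_iff_le_comap.2 fun h hh =>
          blockEmb_mem_compactUn.2 (hH₁U hh))
      · exact isCompact_sup_of_commute commute_torusT_zero (isCompact_torusT_zero hn)
          (hH₁c.image continuous_blockEmb)
      · rw [hMeq]
        refine isConnectedLieSubgroup_analyticSubgroup fun Z hZ => ?_
        rw [← hMeq] at hZ
        exact hlieM Z hZ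
      · exact lieAlg_compactUn_le (blockLie_mem_lieAlg_compactUn.2 (by rwa [← lieAlg_SUn]))
      · rw [hMlie, mem_span_sup_map]
        rintro ⟨c, Z, hZ, h⟩
        have h1 : (0 : ℝ) • zZero n + blockLie X₁ = c • zZero n + blockLie Z := by
          rw [zero_smul, zero_add, h]
        rw [← (smul_zZero_add_blockLie_inj h1).2] at hZ
        exact hX₁H hZ
      · have h1 : M ≤ commutantGroup (blockLie X₁) := by
          refine sup_le ?_ (Subgroup.map_le_iff_le_comap.2 fun h hh => ?_)
          · rw [torusT_zero]
            refine analyticSubgroup_le fun Z hZ => ?_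
            obtain ⟨t, rfl⟩ := Submodule.mem_span_singleton.1 hZ
            exact expGL_mem_commutantGroup ((commute_zZero_blockLie _).smul_left t)
          · rw [Subgroup.mem_comap, mem_commutantGroup, ← adMat_eq_self_iff, adMat_blockEmb,
              hX₁f h hh]
        intro h hh
        rw [adMat_eq_self_iff]
        exact h1 hh
    refine hH₁conn.le_of_lieAlg_le fun Y hY => expGL_mem_analyticSubgroup ?_
    rw [hVmem]
    refine lieAlg_mono hML ?_
    rw [hMlie, mem_span_sup_map]
    exact ⟨0, Y, hY, by simp⟩

end Centre

/-! ### Determinants on the eigenspaces of a diagonal matrix -/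

section BlockDet

variable {ι : Type*} [Fintype ι] [DecidableEq ι]

open scoped Matrix.Norms.Operator in
theorem Matrix.exp_mul_eq_self {Z P : Matrix ι ι ℂ} (h : Z * P = 0) :
    NormedSpace.exp Z * P = P := by
  have h1 : ∀ t : ℝ, HasDerivAt (fun t : ℝ => NormedSpace.exp (t • Z) * P) 0 t := fun t => by
    have := (hasDerivAt_exp_smul_const (𝕂 := ℝ) Z t).mul_const P
    rw [mul_assoc, h, mul_zero] at this
    exact this
  have h2 := is_const_of_deriv_eq_zero (fun t => (h1 t).differentiableAt) (fun t => (h1 t).deriv) 1 0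
  simpa using h2

/-- The determinant of `g` on the range of a projection that commutes with `g`. -/
noncomputable def blockDet (P g : Matrix ι ι ℂ) : ℂ := (g * P + (1 - P)).det

theorem blockDet_one (P : Matrix ι ι ℂ) : blockDet P 1 = 1 := by
  simp [blockDet]

theorem blockDet_mul {P g h : Matrix ι ι ℂ} (hP : P * P = P) (hh : Commute h P) :
    blockDet P (g * h) = blockDet P g * blockDet P h := by
  rw [blockDet, blockDet, blockDet, ← Matrix.det_mul]
  congr 1
  have e1 : g * P * (h * P) = g * h * P := by
    rw [hh.eq, mul_assoc, ← mul_assoc P P, hP, ← hh.eq, mul_assoc]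
  have e2 : P * (h * P) = h * P := by rw [hh.eq, ← mul_assoc, hP]
  have e3 : g * P * P = g * P := by rw [mul_assoc, hP]
  simp only [mul_add, add_mul, mul_sub, sub_mul, mul_one, one_mul, e1, e2, e3, hP]
  abel

/-- `Y` splits into the commuting parts `Y P` and `Y (1 - P)`; replacing the action of `exp Y` off
the range of `P` by the identity leaves `exp (Y P)`. -/
theorem blockDet_exp {P Y : Matrix ι ι ℂ} (hP : P * P = P) (hPH : Pᴴ = P) (hY : Yᴴ = -Y)
    (hYP : Commute Y P) : blockDet P (NormedSpace.exp Y) = Complex.exp (Y * P).trace := by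
  have h1 : (Y * P)ᴴ = -(Y * P) := by
    rw [Matrix.conjTranspose_mul, hY, hPH, mul_neg, hYP.eq]
  rw [← Matrix.det_exp_of_skew h1, blockDet]
  congr 1
  have e1 : NormedSpace.exp (Y * P) * (1 - P) = 1 - P :=
    Matrix.exp_mul_eq_self (by rw [mul_sub, mul_one, mul_assoc, hP, sub_self])
  have e2 : NormedSpace.exp (Y * (1 - P)) * P = P :=
    Matrix.exp_mul_eq_self (by rw [mul_assoc, sub_mul, one_mul, hP, sub_self, mul_zero])
  have hc : Commute (Y * P) (Y * (1 - P)) := by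
    rw [mul_sub, mul_one]
    exact ((Commute.refl Y).mul_left hYP.symm).sub_right (Commute.refl _)
  have e3 : NormedSpace.exp Y = NormedSpace.exp (Y * P) * NormedSpace.exp (Y * (1 - P)) := by
    rw [← Matrix.exp_add_of_commute _ _ hc, ← mul_add, add_sub_cancel, mul_one]
  calc NormedSpace.exp Y * P + (1 - P)
      = NormedSpace.exp (Y * P) * P + NormedSpace.exp (Y * P) * (1 - P) := by
        rw [e1, e3, mul_assoc, e2]
    _ = NormedSpace.exp (Y * P) := by rw [← mul_add, add_sub_cancel, mul_one]

theorem continuous_blockDet (P : Matrix ι ι ℂ) : Continuous (blockDet P) :=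
  ((continuous_id.mul continuous_const).add continuous_const).matrix_det

/-- The projection onto the coordinates at which `x` takes the value `v`. -/
def levelProj {β : Type*} [DecidableEq β] (x : ι → β) (v : β) : Matrix ι ι ℂ :=
  Matrix.diagonal fun m => if x m = v then 1 else 0

variable {β : Type*} [DecidableEq β]

theorem levelProj_mul_self (x : ι → β) (v : β) : levelProj x v * levelProj x v = levelProj x v := by
  simp [levelProj]

theorem levelProj_conjTranspose {κ : Type*} [DecidableEq κ] (x : κ → β) (v : β) :
    (levelProj x v)ᴴ = levelProj x v := by
  rw [levelProj, Matrix.diagonal_conjTranspose]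
  congr 1
  ext m
  by_cases h : x m = v <;> simp [h]

theorem commute_levelProj {x : ι → β} (v : β) {A : Matrix ι ι ℂ}
    (h : ∀ i j, A i j ≠ 0 → x i = x j) : Commute A (levelProj x v) :=
  Matrix.commute_diagonal_iff.2 fun i j hij => by rw [h i j hij]

theorem trace_mul_diagonal (Y : Matrix ι ι ℂ) (d : ι → ℂ) :
    (Y * Matrix.diagonal d).trace = ∑ m, Y m m * d m := by
  simp [Matrix.trace, Matrix.mul_diagonal]

theorem skew_apply_self {κ : Type*} {Y : Matrix κ κ ℂ} (hY : Yᴴ = -Y) (m : κ) :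
    Y m m = ((Y m m).im : ℂ) * Complex.I := by
  have := congrArg Complex.re (congrFun (congrFun hY m) m)
  rw [Matrix.conjTranspose_apply, Matrix.neg_apply] at this
  simp at this
  apply Complex.ext
  · simp; linarith
  · simp

/-- The imaginary parts of the traces of a matrix on the level spaces of `x`. -/
noncomputable def levelTrace (x : ι → β) : Matrix ι ι ℂ →ₗ[ℝ] (ι → ℝ) where
  toFun Y l := ∑ m, if x m = x l then (Y m m).im else 0
  map_add' Y Z := by
    ext l
    simp only [Matrix.add_apply, Complex.add_im, Pi.add_apply, ← Finset.sum_add_distrib]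
    exact Finset.sum_congr rfl fun m _ => by split_ifs <;> simp
  map_smul' c Y := by
    ext l
    simp [Finset.mul_sum]

theorem levelTrace_apply {κ : Type*} [Fintype κ] (x : κ → β) (Y : Matrix κ κ ℂ) (l : κ) :
    levelTrace x Y l = ∑ m, if x m = x l then (Y m m).im else 0 := rfl

theorem trace_mul_levelProj (x : ι → β) {Y : Matrix ι ι ℂ} (hY : Yᴴ = -Y) (l : ι) :
    (Y * levelProj x (x l)).trace = (levelTrace x Y l : ℂ) * Complex.I := by
  rw [levelProj, trace_mul_diagonal, levelTrace_apply]
  push_cast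
  rw [Finset.sum_mul]
  refine Finset.sum_congr rfl fun m _ => ?_
  split_ifs
  · rw [mul_one]; exact skew_apply_self hY m
  · simp

theorem sum_mul_levelTrace {κ : Type*} [Fintype κ] (x : κ → β) (Y : Matrix κ κ ℂ) (k : κ → ℝ) :
    ∑ l, k l * levelTrace x Y l = ∑ m, (∑ l, if x m = x l then k l else 0) * (Y m m).im := by
  simp only [levelTrace_apply, Finset.mul_sum, Finset.sum_mul]
  rw [Finset.sum_comm]
  refine Finset.sum_congr rfl fun m _ => Finset.sum_congr rfl fun l _ => ?_
  split_ifs <;> simp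

/-- The traces of the Lie algebra of a compact group on the level spaces form a rational
subspace. -/
theorem isClosed_levelTrace {L : Subgroup (GL ι ℂ)} (hc : IsCompact (L : Set (GL ι ℂ)))
    (hconn : IsConnectedLieSubgroup L) (hskew : ∀ Y ∈ lieAlg L, Yᴴ = -Y) (x : ι → β)
    (hx : ∀ h ∈ L, ∀ i j, h.val i j ≠ 0 → x i = x j) :
    IsClosed {θ : ι → ℝ | ∃ w ∈ (lieAlg L).map (levelTrace x), ∃ k : ι → ℤ,
      θ = w + fun i => 2 * Real.pi * k i} := by
  -- Determinants on the level spaces define a continuous homomorphism from `L` to a torus, repeated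
  -- over the indices of each level; on exponentials it is `e ∘ levelTrace x`. The set in question
  -- is the preimage under `e` of the compact image of `L`.
  let φ : GL ι ℂ → ι → ℂ := fun g l => blockDet (levelProj x (x l)) g.val
  have hφ : Continuous φ := continuous_pi fun l => (continuous_blockDet _).comp Units.continuous_val
  let e : (ι → ℝ) → ι → ℂ := fun θ l => Complex.exp (θ l * Complex.I)
  have he : Continuous e := by fun_prop
  have hcomm : ∀ h ∈ L, ∀ l, Commute h.val (levelProj x (x l)) := fun h hh l =>
    commute_levelProj _ (hx h hh)
  have hmul : ∀ g, ∀ h ∈ L, φ (g * h) = φ g * φ h := fun g h hh => by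
    ext l
    exact blockDet_mul (levelProj_mul_self _ _) (hcomm h hh l)
  have hexp : ∀ Y ∈ lieAlg L, φ (expGL Y) = e (levelTrace x Y) := fun Y hY => by
    ext l
    have h1 : Commute Y (levelProj x (x l)) :=
      commute_of_expGL_mem_commutantGroup fun t =>
        mem_commutantGroup.2 (hcomm _ (hconn.1 Y hY t) l)
    change blockDet _ (NormedSpace.exp Y) = _
    rw [blockDet_exp (levelProj_mul_self _ _) (levelProj_conjTranspose _ _) (hskew Y hY) h1,
      trace_mul_levelProj x (hskew Y hY)]
  have headd : ∀ v w, e (v + w) = e v * e w := fun v w => by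
    ext l
    simp [e, add_mul, Complex.exp_add]
  have hone : φ 1 = 1 := by
    ext l
    exact blockDet_one _
  have hall : ∀ h ∈ L, ∃ w ∈ (lieAlg L).map (levelTrace x), φ h = e w := by
    have key : ∀ h ∈ analyticSubgroup (lieAlg L), h ∈ L ∧
        ∃ w ∈ (lieAlg L).map (levelTrace x), φ h = e w := by
      intro h hh
      induction hh using Subgroup.closure_induction with
      | mem h hh =>
        obtain ⟨Y, hY, rfl⟩ := hh
        exact ⟨hconn.expGL_mem hY, _, ⟨Y, hY, rfl⟩, hexp Y hY⟩
      | one =>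
        refine ⟨L.one_mem, 0, Submodule.zero_mem _, ?_⟩
        rw [hone]
        ext l
        simp [e]
      | mul g h _ _ hg hh =>
        obtain ⟨hgL, v, hv, hgv⟩ := hg
        obtain ⟨hhL, w, hw, hhw⟩ := hh
        exact ⟨L.mul_mem hgL hhL, v + w, Submodule.add_mem _ hv hw, by
          rw [hmul _ _ hhL, hgv, hhw, headd]⟩
      | inv g _ hg =>
        obtain ⟨hgL, v, hv, hgv⟩ := hg
        refine ⟨L.inv_mem hgL, -v, Submodule.neg_mem _ hv, ?_⟩
        have h1 := hmul g⁻¹ g hgL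
        rw [inv_mul_cancel, hone, hgv] at h1
        have h2 := headd (-v) v
        have h3 : e (-v + v) = 1 := by
          ext l
          simp [e]
        rw [h3, h1] at h2
        ext l
        exact mul_right_cancel₀ (Complex.exp_ne_zero (v l * Complex.I)) (congrFun h2 l)
    intro h hh
    rw [hconn.2] at hh
    exact (key h hh).2
  convert ((hc.image hφ).isClosed).preimage he using 1
  ext θ
  constructor
  · rintro ⟨w, ⟨Y, hY, rfl⟩, k, rfl⟩
    refine ⟨expGL Y, hconn.expGL_mem hY, ?_⟩
    rw [hexp Y hY, headd]
    have : e (fun i => 2 * Real.pi * k i) = 1 := by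
      ext l
      simp only [e, Pi.one_apply]
      rw [Complex.exp_eq_one_iff]
      exact ⟨k l, by push_cast; ring⟩
    rw [this, mul_one]
  · rintro ⟨h, hh, hhe⟩
    obtain ⟨w, hw, hhw⟩ := hall h hh
    rw [hhw] at hhe
    have h1 : ∀ l, ∃ k : ℤ, θ l = w l + 2 * Real.pi * k := fun l => by
      obtain ⟨k, hk⟩ := Complex.exp_eq_exp_iff_exists_int.1 (congrFun hhe l).symm
      refine ⟨k, ?_⟩
      have h2 : (θ l : ℂ) = w l + 2 * Real.pi * k := by
        apply mul_right_cancel₀ Complex.I_ne_zero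
        rw [hk]; ring
      exact_mod_cast h2
    choose k hk using h1
    exact ⟨w, hw, k, funext hk⟩

end BlockDet

/-! ### ### Integral fixed vectors -/

section Rational

variable {n : ℕ}

/-- A fixed vector which is diagonal can be replaced by an integral one. -/
theorem exists_integral_fixed (hn : 1 ≤ n) {L : Subgroup (GL (Unit ⊕ Fin n) ℂ)}
    (hLU : L ≤ compactUn n) (hc : IsCompact (L : Set (GL (Unit ⊕ Fin n) ℂ)))
    (hconn : IsConnectedLieSubgroup L) {x : Unit ⊕ Fin n → ℝ}
    (hx : ∀ h ∈ L, Commute h.val (Matrix.diagonal fun m => Complex.I * x m))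
    (hxL : ∀ Y ∈ lieAlg L, frobForm (Matrix.diagonal fun m => Complex.I * (x m : ℂ)) Y = 0)
    (hxz : frobForm (Matrix.diagonal fun m => Complex.I * (x m : ℂ)) (zZero n) ≠ 0) :
    ∃ y : Unit ⊕ Fin n → ℤ, ∑ m, y m = 0 ∧ y (Sum.inl ()) ≠ 0 ∧
      (∀ h ∈ L, Commute h.val (Matrix.diagonal fun m => (y m : ℂ))) ∧
      ∀ Y ∈ lieAlg L, ∑ m, Y m m * y m = 0 := by
  classical
  have hskew : ∀ Y ∈ lieAlg L, Yᴴ = -Y := fun Y hY =>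
    (mem_lieAlg_compactUn.1 (lieAlg_mono hLU hY)).1
  have hx' : ∀ h ∈ L, ∀ i j, h.val i j ≠ 0 → x i = x j := fun h hh i j hij => by
    have := Matrix.commute_diagonal_iff.1 (hx h hh) i j hij
    have h2 := mul_left_cancel₀ Complex.I_ne_zero this
    exact_mod_cast h2
  -- The pairing with `x` factors through the level traces. Each level is counted once per index in
  -- it, hence the division by its cardinality.
  have hfrob : ∀ Y, frobForm (Matrix.diagonal fun m => Complex.I * (x m : ℂ)) Y =
      ∑ l, (x l / (∑ m, if x m = x l then (1 : ℝ) else 0)) * levelTrace x Y l := by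
    intro Y
    rw [sum_mul_levelTrace, frobForm_apply, Matrix.diagonal_conjTranspose, Matrix.trace,
      Complex.re_sum]
    refine Finset.sum_congr rfl fun m _ => ?_
    rw [Matrix.diag_apply, Matrix.diagonal_mul]
    have h1 : (∑ l, if x m = x l then x l / (∑ m, if x m = x l then (1 : ℝ) else 0) else 0) =
        x m := by
      have h2 : ∀ l, (if x m = x l then x l / (∑ m, if x m = x l then (1 : ℝ) else 0) else 0) =
          (x m / (∑ k, if x k = x m then (1 : ℝ) else 0)) * (if x l = x m then 1 else 0) := by
        intro l
        by_cases h : x m = x l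
        · rw [if_pos h, if_pos h.symm, mul_one, h]
        · rw [if_neg h, if_neg (Ne.symm h), mul_zero]
      rw [Finset.sum_congr rfl fun l _ => h2 l, ← Finset.mul_sum, div_mul_cancel₀]
      have : (0 : ℝ) < ∑ k, if x k = x m then (1 : ℝ) else 0 :=
        Finset.sum_pos' (fun k _ => by split_ifs <;> norm_num)
          ⟨m, Finset.mem_univ _, by simp⟩
      exact this.ne'
    rw [h1]
    simp
  -- The pairing with `x` depends only on level traces, vanishes on `lieAlg L` and not on `z₀`, so
  -- it separates them.
  have hz : levelTrace x (zZero n) ∉ (lieAlg L).map (levelTrace x) := by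
    rintro ⟨Y, hY, hYz⟩
    apply hxz
    rw [hfrob, ← hYz, ← hfrob, hxL Y hY]
  obtain ⟨k, hk, hkz⟩ := exists_int_functional _ (isClosed_levelTrace hc hconn hskew x hx') hz
  -- The transpose of the integral functional `k`: a diagonal vector constant on the levels of `x`,
  -- hence commuting with `L`.
  set y' : Unit ⊕ Fin n → ℤ := fun m => ∑ l, if x m = x l then k l else 0 with hy'
  have hsum : ∀ Y : Matrix (Unit ⊕ Fin n) (Unit ⊕ Fin n) ℂ,
      ∑ l, (k l : ℝ) * levelTrace x Y l = ∑ m, (y' m : ℝ) * (Y m m).im := fun Y => by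
    rw [sum_mul_levelTrace]
    refine Finset.sum_congr rfl fun m _ => ?_
    simp only [hy']
    push_cast
    rfl
  -- Subtracting the mean makes the vector traceless; `n + 1`, the number of coordinates, clears the
  -- denominator. Pairings with traceless matrices are only scaled.
  refine ⟨fun m => (n + 1) * y' m - ∑ l, y' l, ?_, ?_, fun h hh => ?_, fun Y hY => ?_⟩
  · rw [Finset.sum_sub_distrib, ← Finset.mul_sum]
    simp
    ring
  -- The pairing of `y'` with `z₀` is the first coordinate of the traceless vector divided by `n`.
  · rw [hsum] at hkz
    intro h
    apply hkz
    have hn1 : (n : ℝ) ≠ 0 := by exact_mod_cast (by omega : n ≠ 0)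
    simp only [Fintype.sum_sum_type, Finset.univ_unique, Finset.sum_singleton] at h
    have h' : ((n : ℝ) + 1) * y' (Sum.inl ()) -
        (y' (Sum.inl ()) + ∑ j : Fin n, (y' (Sum.inr j) : ℝ)) = 0 := by exact_mod_cast h
    rw [zZero_eq]
    simp only [Fintype.sum_sum_type, Finset.univ_unique, Finset.sum_singleton,
      Matrix.diagonal_apply_eq, Sum.elim_inl, Sum.elim_inr]
    rw [← Finset.sum_mul]
    have h3 : (-(Complex.I / (n : ℂ))).im = -(1 / n) := by
      have : Complex.I / (n : ℂ) = ((1 / n : ℝ) : ℂ) * Complex.I := by push_cast; ring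
      rw [this]; simp
    rw [h3, Complex.I_im]
    field_simp
    have h4 : (default : Unit) = () := rfl
    rw [h4]
    linarith
  · rw [Matrix.commute_diagonal_iff]
    intro i j hij
    have := hx' h hh i j hij
    simp only [hy', this]
  · have h1 := hk _ ⟨Y, hY, rfl⟩
    rw [hsum] at h1
    have h2 : ∑ m, Y m m * (y' m : ℂ) = 0 := by
      have : ∀ m, Y m m * (y' m : ℂ) = (((y' m : ℝ) * (Y m m).im : ℝ) : ℂ) * Complex.I := by
        intro m
        conv_lhs => rw [skew_apply_self (hskew Y hY) m]
        push_cast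
        ring
      rw [Finset.sum_congr rfl fun m _ => this m, ← Finset.sum_mul, ← Complex.ofReal_sum, h1]
      simp
    have h3 : ∑ m, Y m m = 0 := (mem_lieAlg_compactUn.1 (lieAlg_mono hLU hY)).2.1
    have h4 : ∀ m, Y m m * (((n + 1) * y' m - ∑ l, y' l : ℤ) : ℂ) =
        (n + 1) * (Y m m * (y' m : ℂ)) - Y m m * ((∑ l, y' l : ℤ) : ℂ) := fun m => by
      push_cast
      ring
    rw [Finset.sum_congr rfl fun m _ => h4 m, Finset.sum_sub_distrib, ← Finset.mul_sum, h2,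
      ← Finset.sum_mul, h3]
    simp

end Rational

/-! ### The centralizer of an integral vector and its orthogonal complement -/

section OrthCentralizer

variable {n : ℕ}

/-- The part of the Lie algebra of `S(U_1 × U_n)` which commutes with and is orthogonal to a
diagonal matrix. -/
def orthCentralizer (d : Unit ⊕ Fin n → ℂ) :
    Submodule ℝ (Matrix (Unit ⊕ Fin n) (Unit ⊕ Fin n) ℂ) where
  carrier := {Y | Y ∈ lieAlg (compactUn n) ∧ Commute Y (Matrix.diagonal d) ∧
    ∑ m, Y m m * d m = 0}
  zero_mem' := by simp
  add_mem' := by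
    rintro X Y ⟨h1, h2, h3⟩ ⟨k1, k2, k3⟩
    refine ⟨Submodule.add_mem _ h1 k1, h2.add_left k2, ?_⟩
    simp only [Matrix.add_apply, add_mul, Finset.sum_add_distrib, h3, k3, add_zero]
  smul_mem' := by
    rintro c X ⟨h1, h2, h3⟩
    refine ⟨Submodule.smul_mem _ c h1, h2.smul_left c, ?_⟩
    simp only [Matrix.smul_apply, smul_mul_assoc, ← Finset.smul_sum, h3, smul_zero]

theorem mem_orthCentralizer {d : Unit ⊕ Fin n → ℂ}
    {Y : Matrix (Unit ⊕ Fin n) (Unit ⊕ Fin n) ℂ} :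
    Y ∈ orthCentralizer d ↔ Y ∈ lieAlg (compactUn n) ∧ Commute Y (Matrix.diagonal d) ∧
      ∑ m, Y m m * d m = 0 := Iff.rfl

/-- The compact group of matrices commuting with `diag u` whose determinants on the eigenspaces,
weighted by the eigenvalues, have product one. -/
noncomputable def levelGroup (u : Unit ⊕ Fin n → ℕ) : Subgroup (GL (Unit ⊕ Fin n) ℂ) where
  carrier := {g | g ∈ compactUn n ∧ (∀ i j, g.val i j ≠ 0 → u i = u j) ∧
    ∏ v ∈ Finset.univ.image u, blockDet (levelProj u v) g.val ^ v = 1}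
  one_mem' := by
    refine ⟨one_mem _, fun i j hij => ?_, ?_⟩
    · by_contra h
      exact hij (Matrix.one_apply_ne fun h' => h (by rw [h']))
    · simp [blockDet_one]
  mul_mem' := by
    rintro g h ⟨g1, g2, g3⟩ ⟨h1, h2, h3⟩
    refine ⟨mul_mem g1 h1, fun i j hij => ?_, ?_⟩
    · rw [Units.val_mul, Matrix.mul_apply] at hij
      obtain ⟨l, -, hl⟩ := Finset.exists_ne_zero_of_sum_ne_zero hij
      exact (g2 i l (left_ne_zero_of_mul hl)).trans (h2 l j (right_ne_zero_of_mul hl))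
    · simp only [Units.val_mul, blockDet_mul (levelProj_mul_self u _) (commute_levelProj _ h2),
        mul_pow, Finset.prod_mul_distrib, g3, h3, mul_one]
  inv_mem' := by
    rintro g ⟨g1, g2, g3⟩
    have hg : ∀ i j, (g⁻¹).val i j ≠ 0 → u i = u j := by
      have h1 : Commute g.val (Matrix.diagonal fun m => (u m : ℂ)) :=
        Matrix.commute_diagonal_iff.2 fun i j hij => by rw [g2 i j hij]
      have h2 := Matrix.commute_diagonal_iff.1 h1.units_inv_left
      exact fun i j hij => by exact_mod_cast h2 i j hij
    refine ⟨inv_mem g1, hg, ?_⟩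
    have h1 : ∏ v ∈ Finset.univ.image u, blockDet (levelProj u v) (g⁻¹ * g).val ^ v = 1 := by
      simp [blockDet_one]
    simp only [Units.val_mul, blockDet_mul (levelProj_mul_self u _) (commute_levelProj _ g2),
        mul_pow, Finset.prod_mul_distrib, g3, mul_one] at h1
    exact h1

theorem mem_levelGroup {u : Unit ⊕ Fin n → ℕ} {g : GL (Unit ⊕ Fin n) ℂ} :
    g ∈ levelGroup u ↔ g ∈ compactUn n ∧ (∀ i j, g.val i j ≠ 0 → u i = u j) ∧
    ∏ v ∈ Finset.univ.image u, blockDet (levelProj u v) g.val ^ v = 1 := Iff.rfl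

theorem isCompact_levelGroup (u : Unit ⊕ Fin n → ℕ) :
    IsCompact (levelGroup u : Set (GL (Unit ⊕ Fin n) ℂ)) := by
  have h1 : Continuous fun g : GL (Unit ⊕ Fin n) ℂ => g.val := Units.continuous_val
  have h2 : IsClosed {g : GL (Unit ⊕ Fin n) ℂ |
      ∏ v ∈ Finset.univ.image u, blockDet (levelProj u v) g.val ^ v = 1} :=
    isClosed_eq (continuous_finsetProd _ fun v _ => ((continuous_blockDet _).comp h1).pow v)
      continuous_const
  convert (isCompact_compactUn (n := n)).inter_right
    ((isClosed_commutantGroup (Matrix.diagonal fun m => (u m : ℂ))).inter h2) using 1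
  ext g
  have h3 : g ∈ commutantGroup (Matrix.diagonal fun m => (u m : ℂ)) ↔
      ∀ i j, g.val i j ≠ 0 → u i = u j := by
    rw [mem_commutantGroup, Matrix.commute_diagonal_iff]
    norm_cast
  rw [SetLike.mem_coe, mem_levelGroup, ← h3]
  rfl

/-- The weighted determinant is the character integrating `Y ↦ tr (Y diag u)`; its kernel is the
group version of orthogonality to `diag u`. -/
theorem prod_blockDet_exp {u : Unit ⊕ Fin n → ℕ} {Y : Matrix (Unit ⊕ Fin n) (Unit ⊕ Fin n) ℂ}
    (hY : Yᴴ = -Y) (hu : ∀ i j, Y i j ≠ 0 → u i = u j) :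
    ∏ v ∈ Finset.univ.image u, blockDet (levelProj u v) (NormedSpace.exp Y) ^ v =
      Complex.exp (∑ m, Y m m * u m) := by
  have h1 : ∀ v, blockDet (levelProj u v) (NormedSpace.exp Y) ^ v =
      Complex.exp (∑ m, if u m = v then Y m m * v else 0) := fun v => by
    rw [blockDet_exp (levelProj_mul_self _ _) (levelProj_conjTranspose _ _) hY
      (commute_levelProj _ hu), ← Complex.exp_nat_mul, levelProj, trace_mul_diagonal,
      Finset.mul_sum]
    congr 1
    refine Finset.sum_congr rfl fun m _ => ?_
    split_ifs <;> ring
  rw [Finset.prod_congr rfl fun v _ => h1 v, ← Complex.exp_sum, Finset.sum_comm]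
  congr 1
  refine Finset.sum_congr rfl fun m _ => ?_
  rw [Finset.sum_ite_eq, if_pos (Finset.mem_image_of_mem _ (Finset.mem_univ _))]

/-- Every element of `S(U_1 × U_n)` has a logarithm in its Lie algebra. -/
theorem exists_log_mem_lieAlg {g : GL (Unit ⊕ Fin n) ℂ} (hg : g ∈ compactUn n) :
    ∃ Y ∈ lieAlg (compactUn n), expGL Y = g ∧
      ∀ d : Unit ⊕ Fin n → ℂ, Commute g.val (Matrix.diagonal d) →
        Commute Y (Matrix.diagonal d) := by
  obtain ⟨h1, h2, h3⟩ := mem_compactUn.1 hg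
  obtain ⟨Y, hY, hYg, hYc⟩ := Matrix.exists_skew_log h1
  have hYJ := hYc _ h3
  have htr : Complex.exp Y.trace = 1 := by rw [← Matrix.det_exp_of_skew hY, hYg, h2]
  obtain ⟨k, hk⟩ := Complex.exp_eq_one_iff.1 htr
  -- The trace of the logarithm is some `2πik`. Subtracting it in the corner entry makes the trace
  -- zero without changing the exponential.
  set E : Matrix (Unit ⊕ Fin n) (Unit ⊕ Fin n) ℂ :=
    Matrix.diagonal (Sum.elim (fun _ => -(k * (2 * Real.pi * Complex.I))) fun _ => 0) with hE
  have hYE : Commute Y E := by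
    rw [hE, Matrix.commute_diagonal_iff]
    rw [lorentzJ, Matrix.commute_diagonal_iff] at hYJ
    intro i j hij
    have := hYJ i j hij
    obtain (⟨⟩ | i) := i <;> obtain (⟨⟩ | j) := j
    · rfl
    · norm_num at this
    · norm_num at this
    · rfl
  have hEx : NormedSpace.exp E = 1 := by
    rw [hE, Matrix.exp_diagonal, ← Matrix.diagonal_one]
    congr 1
    ext (i | i)
    · rw [Pi.coe_exp, ← Complex.exp_eq_exp_ℂ, Sum.elim_inl, Complex.exp_neg,
        Complex.exp_int_mul_two_pi_mul_I, inv_one]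
    · rw [Pi.coe_exp, ← Complex.exp_eq_exp_ℂ, Sum.elim_inr, Complex.exp_zero]
  refine ⟨Y + E, mem_lieAlg_compactUn.2 ⟨?_, ?_, ?_⟩, Units.ext ?_, fun d hd => ?_⟩
  · rw [Matrix.conjTranspose_add, hY, hE, Matrix.diagonal_conjTranspose, neg_add,
      Matrix.diagonal_neg]
    congr 2
    ext (i | i) <;> simp
  · rw [Matrix.trace_add, hk, hE, Matrix.trace_diagonal]
    simp
  · exact hYJ.add_left (Matrix.commute_diagonal _ _)
  · rw [coe_expGL, Matrix.exp_add_of_commute _ _ hYE, hEx, mul_one, hYg]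
  · exact (hYc _ hd).add_left (Matrix.commute_diagonal _ _)

theorem diagonal_int_mem_lieAlg {y : Unit ⊕ Fin n → ℤ} (hy : ∑ m, y m = 0) :
    (Matrix.diagonal fun m => Complex.I * (y m : ℂ)) ∈ lieAlg (compactUn n) := by
  refine mem_lieAlg_compactUn.2 ⟨?_, ?_, Matrix.commute_diagonal _ _⟩
  · rw [Matrix.diagonal_conjTranspose, Matrix.diagonal_neg]
    congr 1
    ext m
    simp
  · rw [Matrix.trace_diagonal, ← Finset.mul_sum, ← Int.cast_sum, hy]
    simp

theorem sum_sq_pos {ι : Type*} [Fintype ι] {y : ι → ℤ} {i : ι} (hi : y i ≠ 0) :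
    0 < ∑ m, (y m : ℝ) ^ 2 :=
  Finset.sum_pos' (fun _ _ => by positivity) ⟨i, Finset.mem_univ _, by positivity⟩

theorem sum_diagonal_mul_int (y : Unit ⊕ Fin n → ℤ) :
    ∑ m, (Matrix.diagonal fun m => Complex.I * (y m : ℂ)) m m * (y m : ℂ) =
      ((∑ m, (y m : ℝ) ^ 2 : ℝ) : ℂ) * Complex.I := by
  push_cast
  rw [Finset.sum_mul]
  refine Finset.sum_congr rfl fun m _ => ?_
  rw [Matrix.diagonal_apply_eq]
  ring

/-- Integrality of `y` makes orthogonality the kernel of a character, so the ambient `levelGroup` is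
compact. Up to powers of one element it equals the analytic subgroup, which is therefore compact;
differentiating the character identifies the one-parameter groups. -/
theorem orthCentralizer_analytic {y : Unit ⊕ Fin n → ℤ} (hy : ∑ m, y m = 0)
    {i : Unit ⊕ Fin n} (hi : y i ≠ 0) :
    IsCompact (analyticSubgroup (orthCentralizer fun m => (y m : ℂ)) :
      Set (GL (Unit ⊕ Fin n) ℂ)) ∧
    ∀ X, (∀ t : ℝ, expGL (t • X) ∈ analyticSubgroup (orthCentralizer fun m => (y m : ℂ))) →
      X ∈ orthCentralizer fun m => (y m : ℂ) := by
  set V := orthCentralizer fun m => (y m : ℂ) with hV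
  -- The shift turns the weights into natural exponents. It changes neither the eigenspaces nor the
  -- pairing with traceless matrices.
  set C : ℕ := ∑ m, (y m).natAbs with hC
  have hnn : ∀ m, 0 ≤ y m + C := fun m => by
    have : (y m).natAbs ≤ C := Finset.single_le_sum (f := fun m => (y m).natAbs)
      (fun _ _ => Nat.zero_le _) (Finset.mem_univ m)
    omega
  set u : Unit ⊕ Fin n → ℕ := fun m => (y m + C).toNat with hu
  have huy : ∀ m, (u m : ℤ) = y m + C := fun m => Int.toNat_of_nonneg (hnn m)
  have huc : ∀ m, (u m : ℂ) = y m + C := fun m => by exact_mod_cast huy m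
  have hiff : ∀ i j, u i = u j ↔ (y i : ℂ) = y j := fun i j => by
    rw [Int.cast_inj]
    have h1 := huy i
    have h2 := huy j
    omega
  have hsum : ∀ Y ∈ lieAlg (compactUn n), ∑ m, Y m m * (u m : ℂ) = ∑ m, Y m m * (y m : ℂ) := by
    intro Y hY
    have h0 : ∑ m, Y m m = 0 := (mem_lieAlg_compactUn.1 hY).2.1
    simp only [huc, mul_add, Finset.sum_add_distrib, ← Finset.sum_mul, h0, zero_mul, add_zero]
  have hcomm : ∀ Y : Matrix (Unit ⊕ Fin n) (Unit ⊕ Fin n) ℂ,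
      Commute Y (Matrix.diagonal fun m => (y m : ℂ)) ↔ ∀ i j, Y i j ≠ 0 → u i = u j := fun Y => by
    rw [Matrix.commute_diagonal_iff]
    simp only [hiff]
  have hle : analyticSubgroup V ≤ levelGroup u := by
    refine analyticSubgroup_le fun Y hY => ?_
    obtain ⟨h1, h2, h3⟩ := mem_orthCentralizer.1 hY
    have h1' := mem_lieAlg_compactUn.1 h1
    have h4 := expGL_mem_commutantGroup h2
    rw [mem_commutantGroup, hcomm] at h4
    rw [hcomm] at h2
    refine mem_levelGroup.2 ⟨?_, h4, ?_⟩
    · exact mem_compactUn.2 ⟨exp_unitary_of_skew h1'.1, by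
        rw [coe_expGL, Matrix.det_exp_of_skew h1'.1, h1'.2.1, Complex.exp_zero], h1'.2.2.exp_left⟩
    · rw [coe_expGL, prod_blockDet_exp h1'.1 h2, hsum Y h1, h3, Complex.exp_zero]
  set q : ℝ := ∑ m, (y m : ℝ) ^ 2 with hq
  have hq0 : q ≠ 0 := (sum_sq_pos hi).ne'
  set D : Matrix (Unit ⊕ Fin n) (Unit ⊕ Fin n) ℂ :=
    Matrix.diagonal fun m => Complex.I * (y m : ℂ) with hD
  constructor
  · refine isCompact_analyticSubgroup (isCompact_levelGroup u) hle
      (expGL ((2 * Real.pi / q) • D)) fun s hs => ?_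
    obtain ⟨s1, s2, s3⟩ := mem_levelGroup.1 hs
    obtain ⟨Y, hY, hYs, hYc⟩ := exists_log_mem_lieAlg s1
    have hYD := hYc _ ((hcomm _).2 s2)
    rw [← hYs, coe_expGL, prod_blockDet_exp (mem_lieAlg_compactUn.1 hY).1 ((hcomm _).1 hYD),
      hsum Y hY] at s3
    obtain ⟨j, hj⟩ := Complex.exp_eq_one_iff.1 s3
    have hYD' : Commute D Y := by
      refine (Matrix.commute_diagonal_iff.2 fun a b hab => ?_).symm
      rw [(hiff a b).1 ((hcomm Y).1 hYD a b hab)]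
    -- The logarithm `Y` pairs with `y` to `2πij`, and `D` pairs to `iq`; subtracting `j (2π / q) D`
    -- makes it orthogonal.
    refine ⟨j, expGL (Y - ((j : ℝ) * (2 * Real.pi / q)) • D), expGL_mem_analyticSubgroup ?_, ?_⟩
    · refine mem_orthCentralizer.2 ⟨Submodule.sub_mem _ hY
        (Submodule.smul_mem _ _ (diagonal_int_mem_lieAlg hy)), ?_, ?_⟩
      · exact hYD.sub_left ((Matrix.commute_diagonal _ _).smul_left _)
      · simp only [Matrix.sub_apply, Matrix.smul_apply, sub_mul, Finset.sum_sub_distrib, hj,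
          smul_mul_assoc, ← Finset.smul_sum]
        rw [hD, sum_diagonal_mul_int, ← hq, Complex.real_smul]
        have : (q : ℂ) ≠ 0 := by exact_mod_cast hq0
        push_cast
        field_simp
        ring
    · rw [← expGL_int_smul, smul_smul, ← expGL_add, add_sub_cancel, hYs]
      exact (hYD'.sub_right ((Commute.refl D).smul_right _)).smul_left _
  · intro X hX
    have h1 : X ∈ lieAlg (compactUn n) :=
      mem_lieAlg_of_forall fun t => (mem_levelGroup.1 (hle (hX t))).1
    have h2 : Commute X (Matrix.diagonal fun m => (y m : ℂ)) :=
      commute_of_expGL_mem_commutantGroup fun t =>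
        mem_commutantGroup.2 ((hcomm _).2 (mem_levelGroup.1 (hle (hX t))).2.1)
    refine mem_orthCentralizer.2 ⟨h1, h2, Complex.eq_zero_of_exp_smul fun t => ?_⟩
    have h3 := (mem_levelGroup.1 (hle (hX t))).2.2
    have h4 := Submodule.smul_mem _ t h1
    rw [coe_expGL, prod_blockDet_exp (mem_lieAlg_compactUn.1 h4).1
      ((hcomm _).1 (h2.smul_left t)), hsum _ h4] at h3
    simp only [Matrix.smul_apply, smul_mul_assoc, ← Finset.smul_sum] at h3
    rwa [Complex.real_smul] at h3

/-- The vector `i y` is fixed by the larger group and is not orthogonal to itself, so it lies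
outside that group's Lie algebra and maximality of `L` applies. -/
theorem IsMaximalFixing.eq_orthCentralizer {L : Subgroup (GL (Unit ⊕ Fin n) ℂ)}
    (hL : IsMaximalFixing L) {y : Unit ⊕ Fin n → ℤ} (hy : ∑ m, y m = 0)
    {i : Unit ⊕ Fin n} (hi : y i ≠ 0)
    (hyL : ∀ h ∈ L, Commute h.val (Matrix.diagonal fun m => (y m : ℂ)))
    (hyo : ∀ Y ∈ lieAlg L, ∑ m, Y m m * (y m : ℂ) = 0) :
    L = analyticSubgroup (orthCentralizer fun m => (y m : ℂ)) := by
  obtain ⟨hc, hlie⟩ := orthCentralizer_analytic hy hi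
  have hLM : L ≤ analyticSubgroup (orthCentralizer fun m => (y m : ℂ)) :=
    hL.connected.le_of_lieAlg_le fun Y hY => expGL_mem_analyticSubgroup
      (mem_orthCentralizer.2 ⟨lieAlg_mono hL.le hY, commute_of_expGL_mem_commutantGroup fun t =>
        mem_commutantGroup.2 (hyL _ (hL.connected.1 Y hY t)), hyo Y hY⟩)
  refine le_antisymm hLM (hL.maximal _ hLM ?_ hc (isConnectedLieSubgroup_analyticSubgroup hlie)
    ⟨_, lieAlg_compactUn_le (diagonal_int_mem_lieAlg hy), ?_, fun h hh => ?_⟩)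
  · refine analyticSubgroup_le fun Y hY => ?_
    have h1 := mem_lieAlg_compactUn.1 (mem_orthCentralizer.1 hY).1
    exact mem_compactUn.2 ⟨exp_unitary_of_skew h1.1, by
        rw [coe_expGL, Matrix.det_exp_of_skew h1.1, h1.2.1, Complex.exp_zero], h1.2.2.exp_left⟩
  · rw [lieAlg_analyticSubgroup hlie]
    intro h
    have h1 := (mem_orthCentralizer.1 h).2.2
    rw [sum_diagonal_mul_int, mul_eq_zero] at h1
    have h2 := (sum_sq_pos hi).ne'
    rcases h1 with h1 | h1
    · exact h2 (by exact_mod_cast h1)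
    · exact Complex.I_ne_zero h1
  · rw [adMat_eq_self_iff, ← mem_commutantGroup]
    refine (analyticSubgroup_le fun Y hY => expGL_mem_commutantGroup ?_) hh
    rw [Matrix.commute_diagonal_iff]
    intro i j hij
    rw [Matrix.commute_diagonal_iff.1 (mem_orthCentralizer.1 hY).2.1 i j hij]

end OrthCentralizer

/-! ### The groups attached to integral vectors -/

section Types

variable {n : ℕ}

theorem rootScalar_mem_analyticSubgroup (hn : 1 ≤ n) :
    rootScalar n ∈ analyticSubgroup (suSpace (Fin n)) := by
  have hn0 : (n : ℂ) ≠ 0 := by exact_mod_cast (by omega : n ≠ 0)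
  let j₀ : Fin n := ⟨0, hn⟩
  -- Adding `2πi` to one entry makes the exponent traceless and leaves its exponential unchanged.
  have h : rootScalar n = expGL (Matrix.diagonal fun j : Fin n =>
      -(2 * Real.pi * Complex.I / n) + if j = j₀ then 2 * Real.pi * Complex.I else 0) := by
    refine Units.ext ?_
    rw [rootScalar, coe_expGL, coe_expGL, Matrix.exp_diagonal, Matrix.exp_diagonal]
    congr 1
    ext j
    rw [Pi.coe_exp, Pi.coe_exp, ← Complex.exp_eq_exp_ℂ, Complex.exp_add]
    split_ifs <;> simp
  rw [h]
  refine expGL_mem_analyticSubgroup ⟨?_, ?_⟩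
  · rw [Matrix.diagonal_conjTranspose, Matrix.diagonal_neg]
    congr 1
    ext j
    by_cases hj : j = j₀ <;> simp [hj] <;> ring
  · rw [Matrix.trace_diagonal, Finset.sum_add_distrib]
    simp
    field_simp
    ring

/-- A logarithm of `diag(1, g)` in the Lie algebra of `S(U_1 × U_n)` may have a `z₀`-component; what
this contributes is a power of `rootScalar n`, itself an exponential from `𝔰𝔲_n`. -/
theorem analyticSubgroup_suSpace (hn : 1 ≤ n) : analyticSubgroup (suSpace (Fin n)) = SUn n := by
  refine le_antisymm (analyticSubgroup_le fun Y hY => ?_) fun g hg => ?_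
  · rw [← lieAlg_SUn] at hY
    rw [lieAlg_SUn] at hY
    exact mem_SUn.2 ⟨exp_unitary_of_skew hY.1, by
      rw [coe_expGL, Matrix.det_exp_of_skew hY.1, hY.2, Complex.exp_zero]⟩
  · obtain ⟨X, hX, hXg, -⟩ := exists_log_mem_lieAlg (blockEmb_mem_compactUn.2 hg)
    obtain ⟨c, Y, hY, rfl⟩ := exists_zZero_add_blockLie hn hX
    rw [expGL_add ((commute_zZero_blockLie Y).smul_left c), expGL_blockLie] at hXg
    have h1 : blockEmb n g ∈ torusT (0 : Matrix (Fin n) (Fin n) ℂ) ⊔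
        (analyticSubgroup (suSpace (Fin n))).map (blockEmb n) := by
      rw [← hXg]
      refine mul_mem (Subgroup.mem_sup_left ?_) (Subgroup.mem_sup_right
        ⟨_, expGL_mem_analyticSubgroup hY, rfl⟩)
      rw [torusT_zero, mem_analyticSubgroup_span]
      exact ⟨c, rfl⟩
    obtain ⟨k, a, ha, rfl⟩ := exists_zpow_mul_of_blockEmb_mem h1
    exact mul_mem (zpow_mem (rootScalar_mem_analyticSubgroup hn) k) ha

/-- Since `y` is traceless, `z₀` pairs with it to `i (y₀ + y₀ / n)`, whence the factor `(n + 1) /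
n`. -/
theorem sum_smul_zZero_add_blockLie (hn : 1 ≤ n) {y : Unit ⊕ Fin n → ℤ} (hy : ∑ m, y m = 0)
    (c : ℝ) (Y : Matrix (Fin n) (Fin n) ℂ) :
    ∑ m, (c • zZero n + blockLie Y) m m * (y m : ℂ) =
      c * Complex.I * y (Sum.inl ()) * ((n + 1) / n) + ∑ j, Y j j * (y (Sum.inr j) : ℂ) := by
  have hn0 : (n : ℂ) ≠ 0 := by exact_mod_cast (by omega : n ≠ 0)
  have h1 : (∑ j, (y (Sum.inr j) : ℂ)) = -y (Sum.inl ()) := by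
    simp only [Fintype.sum_sum_type, Finset.univ_unique, Finset.sum_singleton] at hy
    have : ((y (Sum.inl ()) : ℂ)) + ∑ j, (y (Sum.inr j) : ℂ) = 0 := by exact_mod_cast hy
    exact eq_neg_of_add_eq_zero_right this
  have h2 : ∀ j : Fin n, (c • zZero n + blockLie Y) (Sum.inr j) (Sum.inr j) * (y (Sum.inr j) : ℂ) =
      -(c * Complex.I / n) * (y (Sum.inr j) : ℂ) + Y j j * (y (Sum.inr j) : ℂ) := fun j => by
    simp [zZero, blockLie]
    ring
  have h3 : (c • zZero n + blockLie Y) (Sum.inl ()) (Sum.inl ()) = c * Complex.I := by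
    simp [zZero, blockLie]
  rw [Fintype.sum_sum_type, Finset.sum_congr rfl fun j _ => h2 j, Finset.sum_add_distrib,
    ← Finset.mul_sum, h1, Finset.univ_unique, Finset.sum_singleton]
  change (c • zZero n + blockLie Y) (Sum.inl ()) (Sum.inl ()) * (y (Sum.inl ()) : ℂ) + _ = _
  rw [h3]
  field_simp
  ring

theorem commute_smul_zZero_add_blockLie {y : Unit ⊕ Fin n → ℤ} {c : ℝ}
    {Y : Matrix (Fin n) (Fin n) ℂ} :
    Commute (c • zZero n + blockLie Y) (Matrix.diagonal fun m => (y m : ℂ)) ↔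
      ∀ i j, Y i j ≠ 0 → y (Sum.inr i) = y (Sum.inr j) := by
  have h1 : Commute (c • zZero n) (Matrix.diagonal fun m => (y m : ℂ)) := by
    rw [zZero_eq]
    exact (Matrix.commute_diagonal _ _).smul_left _
  have h2 : Commute (c • zZero n + blockLie Y) (Matrix.diagonal fun m => (y m : ℂ)) ↔
      Commute (blockLie Y) (Matrix.diagonal fun m => (y m : ℂ)) :=
    ⟨fun h => by simpa using h.sub_left h1, fun h => h1.add_left h⟩
  rw [h2, Matrix.commute_diagonal_iff]
  constructor
  · intro h i j hij
    exact_mod_cast h (Sum.inr i) (Sum.inr j) hij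
  · rintro h (i | i) (j | j) hij
    · exact absurd rfl hij
    · exact absurd rfl hij
    · exact absurd rfl hij
    · rw [h i j hij]

/-- Here `y` is proportional to `z₀`: all of `S(U_1 × U_n)` centralizes it, and its orthogonal
complement is `𝔰𝔲_n`. -/
theorem analyticSubgroup_orthCentralizer_const (hn : 1 ≤ n) {y : Unit ⊕ Fin n → ℤ}
    (hy : ∑ m, y m = 0) (hy0 : y (Sum.inl ()) ≠ 0)
    (hc : ∀ j, n * y (Sum.inr j) + y (Sum.inl ()) = 0) :
    analyticSubgroup (orthCentralizer fun m => (y m : ℂ)) = (SUn n).map (blockEmb n) := by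
  have hn0 : (n : ℂ) ≠ 0 := by exact_mod_cast (by omega : n ≠ 0)
  have hn1 : (n : ℂ) + 1 ≠ 0 := by exact_mod_cast n.succ_ne_zero
  rw [← analyticSubgroup_suSpace hn, map_analyticSubgroup_blockEmb]
  congr 1
  have hyj : ∀ j, (y (Sum.inr j) : ℂ) = -(y (Sum.inl ()) / n) := fun j => by
    have : (n : ℂ) * y (Sum.inr j) + y (Sum.inl ()) = 0 := by exact_mod_cast hc j
    field_simp
    linear_combination this
  have hY0 : ∀ Y ∈ suSpace (Fin n), ∑ j, Y j j * (y (Sum.inr j) : ℂ) = 0 := fun Y hY => by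
    have h1 : ∑ j, Y j j = 0 := hY.2
    simp only [hyj]
    rw [← Finset.sum_mul, h1, zero_mul]
  ext X
  constructor
  · intro hX
    obtain ⟨h1, h2, h3⟩ := mem_orthCentralizer.1 hX
    obtain ⟨c, Y, hY, rfl⟩ := exists_zZero_add_blockLie hn h1
    rw [sum_smul_zZero_add_blockLie hn hy, hY0 Y hY, add_zero] at h3
    have hy0' : (y (Sum.inl ()) : ℂ) ≠ 0 := by exact_mod_cast hy0
    have hc0 : c = 0 := by
      simpa [hy0', hn0, hn1, Complex.I_ne_zero] using h3
    exact ⟨Y, hY, by rw [hc0]; simp⟩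
  · rintro ⟨Y, hY, rfl⟩
    have h0 : blockLieHom n Y = (0 : ℝ) • zZero n + blockLie Y := by simp
    refine mem_orthCentralizer.2 ⟨blockLie_mem_lieAlg_compactUn.2 hY, ?_, ?_⟩
    · rw [h0, commute_smul_zZero_add_blockLie]
      intro i j _
      have h1 := hc i
      have h2 := hc j
      have h3 : (n : ℤ) ≠ 0 := by exact_mod_cast (by omega : n ≠ 0)
      exact mul_left_cancel₀ h3 (by linarith)
    · rw [h0, sum_smul_zZero_add_blockLie hn hy, hY0 Y hY]
      simp

/-- The vector `γ` is `n` times the `𝔰𝔲_n`-part of `y`, and `a` is a multiple of `i γ`. For matrices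
in `𝔰𝔲_n`, commuting with and being orthogonal to `y` or to `a` are the same conditions; outside
`𝔰𝔲_n` one further direction, `z₀ + a`, remains. -/
theorem analyticSubgroup_orthCentralizer_torus (hn : 1 ≤ n) {y : Unit ⊕ Fin n → ℤ}
    (hy : ∑ m, y m = 0) (hy0 : y (Sum.inl ()) ≠ 0) {j₀ : Fin n}
    (hj₀ : n * y (Sum.inr j₀) + y (Sum.inl ()) ≠ 0) :
    ∃ a ∈ lieAlg (SUn n), a ≠ 0 ∧ IsClosed (torusT a : Set (GL (Unit ⊕ Fin n) ℂ)) ∧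
      analyticSubgroup (orthCentralizer fun m => (y m : ℂ)) =
        torusT a ⊔ (analyticSubgroup (reducedCentralizer a)).map (blockEmb n) := by
  have hn0 : (n : ℂ) ≠ 0 := by exact_mod_cast (by omega : n ≠ 0)
  have hn1 : (n : ℂ) + 1 ≠ 0 := by exact_mod_cast n.succ_ne_zero
  set γ : Fin n → ℤ := fun j => n * y (Sum.inr j) + y (Sum.inl ()) with hγ
  set Γ : ℤ := ∑ j, γ j ^ 2 with hΓ
  have hΓ0 : Γ ≠ 0 := by
    have : 0 < Γ := Finset.sum_pos' (fun _ _ => by positivity) ⟨j₀, Finset.mem_univ _, by positivity⟩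
    exact this.ne'
  have hΓc : (Γ : ℂ) ≠ 0 := by exact_mod_cast hΓ0
  have hy0' : (y (Sum.inl ()) : ℂ) ≠ 0 := by exact_mod_cast hy0
  -- Since `∑ γ = 0`, the pairing of `z₀ + a` with `y` is `(i / n) (y₀ (n + 1) + κ Γ)`; this `κ`
  -- makes it vanish.
  set κ : ℝ := -(y (Sum.inl ()) * (n + 1) / Γ) with hκ
  have hκc : (κ : ℂ) = -(y (Sum.inl ()) * (n + 1) / Γ) := by rw [hκ]; push_cast; rfl
  have hκ0 : (κ : ℂ) ≠ 0 := by
    rw [hκc]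
    exact neg_ne_zero.2 (div_ne_zero (mul_ne_zero hy0' hn1) hΓc)
  set a : Matrix (Fin n) (Fin n) ℂ := Matrix.diagonal fun j => Complex.I * (κ * γ j) with ha
  have hsumy : (∑ j, y (Sum.inr j)) = -y (Sum.inl ()) := by
    simp only [Fintype.sum_sum_type, Finset.univ_unique, Finset.sum_singleton] at hy
    exact eq_neg_of_add_eq_zero_right hy
  have hsumγ : ∑ j, γ j = 0 := by
    simp only [hγ, Finset.sum_add_distrib, ← Finset.mul_sum, hsumy]
    simp
  have hasu : a ∈ suSpace (Fin n) := by
    refine ⟨?_, ?_⟩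
    · rw [ha, Matrix.diagonal_conjTranspose, Matrix.diagonal_neg]
      congr 1
      ext j
      simp
    · rw [ha, Matrix.trace_diagonal, ← Finset.mul_sum, ← Finset.mul_sum, ← Int.cast_sum, hsumγ]
      simp
  -- orthogonality to `a` in terms of `y`
  have htr : ∀ Y ∈ suSpace (Fin n), (a * Y).trace =
      Complex.I * κ * n * ∑ j, Y j j * (y (Sum.inr j) : ℂ) := fun Y hY => by
    have h0 : ∑ j, Y j j = 0 := hY.2
    have h1 : ∀ j, (a * Y) j j = Complex.I * κ * n * (Y j j * (y (Sum.inr j) : ℂ)) +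
        Y j j * (Complex.I * κ * y (Sum.inl ())) := fun j => by
      rw [ha, Matrix.diagonal_mul]
      simp only [hγ]
      push_cast
      ring
    simp only [Matrix.trace, Matrix.diag_apply, h1, Finset.sum_add_distrib, ← Finset.mul_sum,
      ← Finset.sum_mul, h0, zero_mul, add_zero]
  have htraa : (a * a).trace = -(κ ^ 2 * Γ : ℂ) := by
    rw [ha, Matrix.diagonal_mul_diagonal, Matrix.trace_diagonal, hΓ]
    push_cast
    rw [Finset.mul_sum, ← Finset.sum_neg_distrib]
    refine Finset.sum_congr rfl fun j _ => ?_
    linear_combination (κ ^ 2 * γ j ^ 2 : ℂ) * Complex.I_sq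
  have hcomm : ∀ Y : Matrix (Fin n) (Fin n) ℂ, Commute Y a ↔
      ∀ i j, Y i j ≠ 0 → y (Sum.inr i) = y (Sum.inr j) := fun Y => by
    rw [ha, Matrix.commute_diagonal_iff]
    refine forall₂_congr fun i j => imp_congr_right fun _ => ?_
    constructor
    · intro h
      have h1 := mul_left_cancel₀ hκ0 (mul_left_cancel₀ Complex.I_ne_zero h)
      have h2 : γ i = γ j := by exact_mod_cast h1
      have h3 : (n : ℤ) ≠ 0 := by exact_mod_cast (by omega : n ≠ 0)
      exact mul_left_cancel₀ h3 (add_right_cancel h2)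
    · intro h
      simp only [hγ, h]
  have hred : ∀ Y, Y ∈ reducedCentralizer a ↔
      Y ∈ suSpace (Fin n) ∧ Commute Y a ∧ (a * Y).trace = 0 := fun Y => by
    rw [← lieAlg_SUn]
    refine and_congr_right fun _ => and_congr_left fun _ => ?_
    exact eq_comm
  have hza : zZero n + blockLie a = (1 : ℝ) • zZero n + blockLie a := by rw [one_smul]
  have hay : ∑ j, a j j * (y (Sum.inr j) : ℂ) = -(Complex.I * y (Sum.inl ()) * ((n + 1) / n)) := by
    have h1 := htr a hasu
    rw [htraa, hκc] at h1
    field_simp at h1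
    have h2 : Complex.I * Complex.I = -1 := Complex.I_mul_I
    field_simp
    generalize ∑ j, a j j * (y (Sum.inr j) : ℂ) = z at *
    linear_combination (-Complex.I) * h1 + n * z * h2
  refine ⟨a, by rwa [lieAlg_SUn], fun h => ?_, ?_, ?_⟩
  · have h1 := congrFun (congrFun h j₀) j₀
    rw [ha, Matrix.diagonal_apply_eq, Matrix.zero_apply] at h1
    have h2 : (γ j₀ : ℂ) ≠ 0 := by exact_mod_cast hj₀
    exact mul_ne_zero Complex.I_ne_zero (mul_ne_zero hκ0 h2) h1
  -- All eigenvalues of `z₀ + a` are rational multiples of `i`: `n` clears the denominator in `z₀`,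
  -- `Γ` the one in `κ`.
  · refine (isCompact_analyticSubgroup_span (T := 2 * Real.pi * (n * Γ)) ?_
      (Units.ext ?_)).isClosed
    · have hn2 : (n : ℝ) ≠ 0 := by exact_mod_cast (by omega : n ≠ 0)
      have hΓr : (Γ : ℝ) ≠ 0 := by exact_mod_cast hΓ0
      positivity
    · have h1 : zZero n + blockLie a = Matrix.diagonal
          (Sum.elim (fun _ => Complex.I) fun j => -(Complex.I / n) + Complex.I * (κ * γ j)) := by
        rw [← Matrix.fromBlocks_diagonal, zZero, blockLie, Matrix.fromBlocks_add,
          Matrix.smul_one_eq_diagonal, Matrix.smul_one_eq_diagonal, ha, Matrix.diagonal_add]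
        simp
      rw [h1, coe_expGL, ← Matrix.diagonal_smul, Matrix.exp_diagonal, Units.val_one,
        ← Matrix.diagonal_one]
      congr 1
      ext (i | j)
      · rw [Pi.coe_exp, ← Complex.exp_eq_exp_ℂ, Pi.smul_apply, Sum.elim_inl,
          Complex.exp_eq_one_iff]
        refine ⟨n * Γ, ?_⟩
        rw [Complex.real_smul]
        push_cast
        ring
      · rw [Pi.coe_exp, ← Complex.exp_eq_exp_ℂ, Pi.smul_apply, Sum.elim_inr,
          Complex.exp_eq_one_iff]
        refine ⟨-Γ - n * (y (Sum.inl ()) * (n + 1)) * γ j, ?_⟩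
        rw [Complex.real_smul, hκc]
        push_cast
        field_simp
        ring
  · rw [torusT, map_analyticSubgroup_blockEmb, ← analyticSubgroup_sup]
    · congr 1
      ext X
      rw [Submodule.mem_sup]
      constructor
      · intro hX
        obtain ⟨h1, h2, h3⟩ := mem_orthCentralizer.1 hX
        obtain ⟨c, Y, hY, rfl⟩ := exists_zZero_add_blockLie hn h1
        rw [commute_smul_zZero_add_blockLie, ← hcomm] at h2
        rw [sum_smul_zZero_add_blockLie hn hy] at h3
        -- Removing `c (z₀ + a)`, which is itself orthogonal to `y`, leaves an element of `𝔰𝔲_n` in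
        -- the reduced centralizer.
        refine ⟨c • (zZero n + blockLie a), Submodule.smul_mem _ _
          (Submodule.mem_span_singleton_self _), _, ⟨Y - c • a, (hred _).2 ⟨?_, ?_, ?_⟩, rfl⟩, ?_⟩
        · exact Submodule.sub_mem _ hY (Submodule.smul_mem _ _ hasu)
        · exact h2.sub_left ((Commute.refl a).smul_left _)
        · rw [mul_sub, Matrix.mul_smul, Matrix.trace_sub, Matrix.trace_smul, htr Y hY, htr a hasu,
            hay, Complex.real_smul]
          linear_combination (Complex.I * κ * n) * h3
        · rw [map_sub, map_smul, blockLieHom_apply, blockLieHom_apply, smul_add]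
          abel
      · rintro ⟨_, hZ, _, ⟨Y, hY, rfl⟩, rfl⟩
        obtain ⟨c, rfl⟩ := Submodule.mem_span_singleton.1 hZ
        obtain ⟨h1, h2, h3⟩ := (hred Y).1 hY
        have h4 : c • (zZero n + blockLie a) + blockLieHom n Y =
            c • zZero n + blockLie (c • a + Y) := by
          rw [← blockLieHom_apply, ← blockLieHom_apply, map_add, map_smul, smul_add, add_assoc]
        rw [h4]
        refine mem_orthCentralizer.2 ⟨Submodule.add_mem _
          (Submodule.smul_mem _ _ (zZero_mem_lieAlg hn)) (blockLie_mem_lieAlg_compactUn.2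
            (Submodule.add_mem _ (Submodule.smul_mem _ _ hasu) h1)), ?_, ?_⟩
        · rw [commute_smul_zZero_add_blockLie, ← hcomm]
          exact ((Commute.refl a).smul_left _).add_left h2
        · rw [htr Y h1] at h3
          have h5 : ∑ j, Y j j * (y (Sum.inr j) : ℂ) = 0 :=
            (mul_eq_zero.1 h3).resolve_left
              (mul_ne_zero (mul_ne_zero Complex.I_ne_zero hκ0) hn0)
          have h6 : ∑ j, (c • a + Y) j j * (y (Sum.inr j) : ℂ) =
              c * ∑ j, a j j * (y (Sum.inr j) : ℂ) + ∑ j, Y j j * (y (Sum.inr j) : ℂ) := by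
            rw [Finset.mul_sum, ← Finset.sum_add_distrib]
            refine Finset.sum_congr rfl fun j _ => ?_
            rw [Matrix.add_apply, Matrix.smul_apply, Complex.real_smul]
            ring
          rw [sum_smul_zZero_add_blockLie hn hy, h6, h5, hay]
          ring
    · rintro X hX _ ⟨Y, hY, rfl⟩
      obtain ⟨t, rfl⟩ := Submodule.mem_span_singleton.1 hX
      refine Commute.smul_left ((commute_zZero_blockLie Y).add_left ?_) t
      exact blockLie_commute.2 ((hred Y).1 hY).2.1.symm

end Types

/-! ### Reduction to subgroups of `S(U_1 × U_n)` -/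

section Reduction

variable {n : ℕ}

theorem adMat_conj_fixed {ι : Type*} [Fintype ι] [DecidableEq ι] {g : GL ι ℂ}
    {H : Subgroup (GL ι ℂ)} {X : Matrix ι ι ℂ} (hX : ∀ h ∈ H, adMat h X = X) :
    ∀ h ∈ conjSubgroup g H, adMat h (adMat g X) = adMat g X := by
  intro h hh
  have h1 := hX _ (mem_conjSubgroup.1 hh)
  rw [adMat_mul, adMat_mul] at h1
  conv_rhs => rw [← h1]
  rw [adMat_adMat_inv]

/-- A competitor `M` is carried back by `g⁻¹`. The conjugate need not be unitary, but it preserves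
the Frobenius form transported by `g`, so the fixed vector makes it admissible. -/
theorem IsMaximalAdmissible.isMaximalFixing {H : Subgroup (GL (Unit ⊕ Fin n) ℂ)}
    (hH : IsMaximalAdmissible (SU1n n) H) {g : GL (Unit ⊕ Fin n) ℂ} (hg : g ∈ SU1n n)
    (hgH : conjSubgroup g H ≤ compactUn n) : IsMaximalFixing (conjSubgroup g H) := by
  refine ⟨hgH, isCompact_conjSubgroup hH.1.2.1 g, hH.1.2.2.1.conj g, ?_⟩
  rintro M hM hMU hMc hMconn ⟨X, hX, hXM, hXf⟩
  obtain ⟨Q, hQ⟩ : ∃ Q : LinearMap.BilinForm ℝ (Matrix (Unit ⊕ Fin n) (Unit ⊕ Fin n) ℂ),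
      ∀ Y Z, Q Y Z = frobForm (adMat g Y) (adMat g Z) :=
    ⟨frobForm.compl₁₂ (adMat g) (adMat g), fun _ _ => rfl⟩
  have hgi : g⁻¹ ∈ SU1n n := inv_mem hg
  have hQs : ∀ Y Z, Q Y Z = Q Z Y := fun Y Z => by rw [hQ, hQ, frobForm_comm]
  have hQp : ∀ Y, Y ≠ 0 → 0 < Q Y Y := fun Y hY => by
    rw [hQ]
    refine frobForm_pos _ fun h => hY ?_
    rw [← adMat_inv_adMat g Y, h, map_zero]
  have hQi : ∀ h ∈ conjSubgroup g⁻¹ M, ∀ Y Z, Q (adMat h Y) (adMat h Z) = Q Y Z := by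
    intro h hh Y Z
    rw [mem_conjSubgroup, inv_inv] at hh
    have h1 := frobForm_adMat (compactUn_unitary hMU _ hh) (adMat g Y) (adMat g Z)
    rw [adMat_mul, adMat_mul, adMat_inv_adMat, adMat_mul, adMat_mul, adMat_inv_adMat] at h1
    rw [hQ, hQ, h1]
  have hXM' : adMat g⁻¹ X ∉ lieAlg (conjSubgroup g⁻¹ M) := by
    rw [mem_lieAlg_conj_iff, inv_inv, adMat_adMat_inv]
    exact hXM
  have hadm : IsAdmissible (SU1n n) (conjSubgroup g⁻¹ M) :=
    isAdmissible_of_fixed (conjSubgroup_le (hMU.trans inf_le_left) hgi)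
      (isCompact_conjSubgroup hMc _) (hMconn.conj _) hQs hQp hQi
      (adMat_mem hgi hX) hXM' (adMat_conj_fixed hXf)
  have hle : H ≤ conjSubgroup g⁻¹ M := by
    have := conjSubgroup_mono (g := g⁻¹) hM
    rwa [← conjSubgroup_mul, inv_mul_cancel, conjSubgroup_one] at this
  have h2 := conjSubgroup_mono (g := g) (hH.2 hadm hle)
  rwa [← conjSubgroup_mul, mul_inv_cancel, conjSubgroup_one] at h2

/-- The whole group `K`, not only `H`, is moved into `S(U_1 × U_n)`, so that the invariant vector of
`𝔫` lands in its Lie algebra. -/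
theorem IsClassI.exists_conj {H : Subgroup (GL (Unit ⊕ Fin n) ℂ)} (hI : IsClassI (SU1n n) H) :
    ∃ g ∈ SU1n n, conjSubgroup g H ≤ compactUn n ∧ ∃ X ∈ lieAlg (compactUn n),
      X ∉ lieAlg (conjSubgroup g H) ∧ ∀ h ∈ conjSubgroup g H, adMat h X = X := by
  obtain ⟨K, ⟨⟨hKG, hKc⟩, -⟩, hHK, N, hdisj, hsup, -, X, hXN, hX0, hXf⟩ := hI
  obtain ⟨g, hg, hgK⟩ := exists_conj_le_compactUn hKG hKc
  refine ⟨g, hg, (conjSubgroup_mono hHK).trans hgK, adMat g X, ?_, ?_, adMat_conj_fixed hXf⟩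
  · refine lieAlg_mono hgK (mem_lieAlg_conj ?_)
    rw [← hsup]
    exact Submodule.mem_sup_right hXN
  · rw [mem_lieAlg_conj_iff, adMat_inv_adMat]
    exact fun h => hX0 (Submodule.disjoint_def.1 hdisj X h hXN)

theorem exists_conj_diagonal (hn : 1 ≤ n) {X : Matrix (Unit ⊕ Fin n) (Unit ⊕ Fin n) ℂ}
    (hX : X ∈ lieAlg (compactUn n)) :
    ∃ g ∈ compactUn n, ∃ x : Unit ⊕ Fin n → ℝ,
      adMat g X = Matrix.diagonal fun m => Complex.I * (x m : ℂ) := by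
  obtain ⟨c, Y, hY, rfl⟩ := exists_zZero_add_blockLie hn hX
  obtain ⟨V, hV, d, rfl⟩ := Matrix.exists_unitary_diagonal_of_skew hY.1
  have h1 : Vᴴ * V = 1 := Matrix.mem_unitaryGroup_iff'.1 hV
  have h2 : V * Vᴴ = 1 := Matrix.mem_unitaryGroup_iff.1 hV
  have hdet : star V.det * V.det = 1 := by
    rw [← Matrix.det_conjTranspose, ← Matrix.det_mul, h1, Matrix.det_one]
  have hdet' : V.det * star V.det = 1 := by rw [mul_comm, hdet]
  have hdet2 : (starRingEnd ℂ) V.det * V.det = 1 := hdet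
  have hdet3 : V.det * (starRingEnd ℂ) V.det = 1 := hdet'
  -- The lower block diagonalizes `Y`; the corner `det V` compensates the determinant of `Vᴴ`.
  let g : GL (Unit ⊕ Fin n) ℂ :=
    ⟨Matrix.fromBlocks (V.det • 1) 0 0 Vᴴ, Matrix.fromBlocks (star V.det • 1) 0 0 V,
      by rw [Matrix.fromBlocks_multiply]; simp [h1, smul_smul, hdet2],
      by rw [Matrix.fromBlocks_multiply]; simp [h2, smul_smul, hdet3]⟩
  have hgv : g.val = Matrix.fromBlocks (V.det • 1) 0 0 Vᴴ := rfl
  have hgi : (g⁻¹).val = Matrix.fromBlocks (star V.det • 1) 0 0 V := rfl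
  have hgU : g ∈ compactUn n := by
    rw [mem_compactUn, hgv]
    refine ⟨?_, ?_, ?_⟩
    · rw [Matrix.fromBlocks_conjTranspose, Matrix.fromBlocks_multiply]
      simp [h2, smul_smul, hdet3]
    · rw [Matrix.det_fromBlocks_zero₂₁, Matrix.det_conjTranspose]
      simpa using hdet'
    · rw [lorentzJ_eq, Commute, SemiconjBy, Matrix.fromBlocks_multiply,
        Matrix.fromBlocks_multiply]
      simp
  refine ⟨g, hgU, Sum.elim (fun _ => c) fun j => -(c / n) + d j, ?_⟩
  have hz : adMat g (zZero n) = zZero n :=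
    adMat_eq_self_iff.2 (commute_zZero (mem_compactUn.1 hgU).2.2)
  have hb : adMat g (blockLie (V * Matrix.diagonal (fun j => Complex.I * (d j : ℂ)) * Vᴴ)) =
      blockLie (Matrix.diagonal fun j => Complex.I * (d j : ℂ)) := by
    rw [adMat_apply, hgv, hgi, blockLie, Matrix.fromBlocks_multiply, Matrix.fromBlocks_multiply,
      blockLie]
    have h3 : Vᴴ * (V * Matrix.diagonal (fun j => Complex.I * (d j : ℂ)) * Vᴴ) * V =
        Matrix.diagonal fun j => Complex.I * (d j : ℂ) := by
      calc Vᴴ * (V * Matrix.diagonal (fun j => Complex.I * (d j : ℂ)) * Vᴴ) * V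
          = (Vᴴ * V) * Matrix.diagonal (fun j => Complex.I * (d j : ℂ)) * (Vᴴ * V) := by
            simp only [Matrix.mul_assoc]
        _ = _ := by rw [h1, one_mul, mul_one]
    simp [h3]
  rw [map_add, map_smul, hz, hb]
  ext (i | i) (j | j)
  · simp [zZero, blockLie, mul_comm]
  · simp [zZero, blockLie]
  · simp [zZero, blockLie]
  · by_cases hij : i = j
    · subst hij
      simp [zZero, blockLie]
      ring
    · simp [zZero, blockLie, hij]

end Reduction

/-! ### ### The classification -/

theorem mainTheorem9 (n : ℕ) (hn : 1 ≤ n) (H : Subgroup (GL (Unit ⊕ Fin n) ℂ))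
    (hH : IsMaximalAdmissible (SU1n n) H) (hI : IsClassI (SU1n n) H) :
    HomSpaceIsomorphic (SU1n n) H ((SUn n).map (blockEmb n)) ∨
    (∃ a ∈ lieAlg (SUn n), a ≠ 0 ∧
      IsClosed (torusT a : Set (GL (Unit ⊕ Fin n) ℂ)) ∧
      HomSpaceIsomorphic (SU1n n) H
        (torusT a ⊔ (analyticSubgroup (reducedCentralizer a)).map (blockEmb n))) ∨
    (∃ H' : Subgroup (GL (Fin n) ℂ), IsMaximalAdmissible (SUn n) H' ∧
      HomSpaceIsomorphic (SU1n n) H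
        (torusT (0 : Matrix (Fin n) (Fin n) ℂ) ⊔ H'.map (blockEmb n))) := by
  obtain ⟨g, hg, hgH, X, hX, hXL, hXf⟩ := IsClassI.exists_conj hI
  have hM := IsMaximalAdmissible.isMaximalFixing hH hg hgH
  by_cases hz : zZero n ∈ lieAlg (conjSubgroup g H)
  · obtain ⟨H', hH', hL⟩ := hM.exists_isMaximalAdmissible hn hz hX hXL hXf
    refine Or.inr (Or.inr ⟨H', hH', ?_⟩)
    rw [← hL]
    exact homSpaceIsomorphic_conj hg H
  -- The element `z₀` is central in the Lie algebra of `S(U_1 × U_n)`, so it serves as the fixed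
  -- vector outside `Lie L`.
  have hzf : ∀ h ∈ compactUn n, adMat h (zZero n) = zZero n := fun h hh =>
    adMat_eq_self_iff.2 (commute_zZero (mem_compactUn.1 hh).2.2)
  obtain ⟨X₀, hX₀, hX₀0, hX₀z, hX₀o, hX₀f⟩ := exists_fixed_orthogonal hgH frobForm_comm
    frobForm_pos (fun h hh => frobForm_adMat (compactUn_unitary hgH h hh))
    (zZero_mem_lieAlg hn) hz fun h hh => hzf h (hgH hh)
  obtain ⟨u, hu, x, hux⟩ := exists_conj_diagonal hn hX₀
  have huu := (mem_compactUn.1 hu).1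
  have hug : u * g ∈ SU1n n := mul_mem hu.1 hg
  have hLU : conjSubgroup (u * g) H ≤ compactUn n := by
    rw [conjSubgroup_mul]
    exact conjSubgroup_le hgH hu
  have hM' := IsMaximalAdmissible.isMaximalFixing hH hug hLU
  obtain ⟨y, hy, hy0, hyL, hyo⟩ := exists_integral_fixed hn hLU hM'.compact hM'.connected (x := x)
    (fun h hh => by
      rw [conjSubgroup_mul] at hh
      rw [← hux]
      exact adMat_eq_self_iff.1 (adMat_conj_fixed hX₀f h hh))
    (fun Y hY => by
      rw [conjSubgroup_mul, mem_lieAlg_conj_iff] at hY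
      have h1 := frobForm_adMat huu X₀ (adMat u⁻¹ Y)
      rw [adMat_adMat_inv] at h1
      rw [← hux, h1, hX₀o _ hY])
    -- The projection `X₀` of `z₀` satisfies `⟨X₀, z₀⟩ = ⟨X₀, X₀⟩ > 0`, and conjugation by `u` fixes
    -- `z₀`.
    (by
      have h1 := frobForm_adMat huu X₀ (zZero n)
      have h2 := hX₀o _ hX₀z
      rw [map_sub, sub_eq_zero] at h2
      rw [hzf u hu, h2] at h1
      rw [← hux, h1]
      exact (frobForm_pos _ hX₀0).ne')
  have hL := hM'.eq_orthCentralizer hy hy0 hyL hyo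
  have hiso := homSpaceIsomorphic_conj hug H
  -- The condition says that `y` is proportional to `z₀`, i.e. has no `𝔰𝔲_n`-part.
  by_cases hc : ∀ j, n * y (Sum.inr j) + y (Sum.inl ()) = 0
  · left
    rwa [hL, analyticSubgroup_orthCentralizer_const hn hy hy0 hc] at hiso
  · push Not at hc
    obtain ⟨j₀, hj₀⟩ := hc
    obtain ⟨a, ha, ha0, hac, haL⟩ := analyticSubgroup_orthCentralizer_torus hn hy hy0 hj₀
    refine Or.inr (Or.inl ⟨a, ha, ha0, hac, ?_⟩)
    rwa [hL, haL] at hiso
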